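/- Let $p$ be a prime, $k$ an algebraically closed field of characteristic $p$, and $\mathcal{O}$ a discrete valuation ring which is a finite extension of the Witt ring $W(k)$, with residue field $\kappa=k$. Let $|\cdot|$ be the absolute value of $\mathcal{O}[\frac1p]$ with unit ball $\mathcal{O}$ and $|p|=p^{-1}$, and put $v_p(a)=-\log_p|a|$. For a series $x=\sum_{i\in\mathbb{Q}}x_it^i$ with coefficients in $\mathcal{O}[\frac1p]$ and for $r>0$, put $w_r(x)=\sup_i|x_i|p^{-ri}\in[0,\infty]$. Define the following rings, with the usual addition and multiplication of series. * $\Omega_{\mathrm{an}}$: the power series $x=\sum_{n\in\mathbb{Z}_{\ge0}}x_nt^n$ with $w_r(x)<\infty$ for all $r>0$ (equivalently $\liminf_{n\to\infty} v_p(x_n)/n\ge 0$). * $\Omega^{\mathrm{imm}}_{\mathrm{an}}$: the series $x=\sum_{n\in\mathbb{Q}_{\ge0}}x_nt^n$ such that for each $r\in\mathbb{R}$ the set $\{n:|x_n|>p^r\}$ is well-ordered, and such that $w_r(x)<\infty$ for all $r>0$. * $\Omega^{\mathrm{alg}}_{\mathrm{an}}$: the $x\in\Omega^{\mathrm{imm}}_{\mathrm{an}}$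 such that for every $j\in\mathbb{Q}$ the truncation $\sum_{i<j}x_it^i$ lies in $\Gamma^{\mathrm{alg}}[\frac1p]$. Here $\Gamma^{\mathrm{imm}}$ is the ring of series $\sum_{n\in\mathbb{Q}}x_nt^n$ with $x_n\in\mathcal{O}$ and all sets $\{n:|x_n|>p^r\}$ well-ordered; its residue field is the field $\kappa((t^{\mathbb{Q}}))$ of generalized power series. $K^{\mathrm{alg}}$ is the algebraic closure of $K=\kappa((t))$ in $\kappa((t^{\mathbb{Q}}))$, and $\Gamma^{\mathrm{alg}}=W(K^{\mathrm{alg}})\otimes_{W(k)}\mathcal{O}\subseteq\Gamma^{\mathrm{imm}}$ is the $p$-adic closure in $\Gamma^{\mathrm{imm}}$ of the $\mathcal{O}$-span of the Teichmüller lifts of the elements of $K^{\mathrm{alg}}$. Let $R$ be one of these three rings, with the Fréchet topology defined by the norms $w_r$, $r>0$. The Newton polygon of $x\in R$ is the lower boundary of the convex hull of the points lying on or above some $(i,v_p(x_i))$ with $x_i\ne0$. A slope of $x$ is a real number $s>0$ such that the Newton polygon of $x$ contains a nondegenerate segment of slope $-s$. An element of $R$ is pure of slope $s$ if its constant coefficient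 is nonzero and $s$ is its only slope. Let $x\in R$ be nonzero; if $R$ is $\Omega^{\mathrm{alg}}_{\mathrm{an}}$ or $\Omega^{\mathrm{imm}}_{\mathrm{an}}$, assume moreover that $x$ has a term of lowest exponent, i.e. that $\{i:x_i\neq0\}$ has a least element. Then $x$ has a slope factorization $$x=c\,t^j\prod_{i=1}^{N}y_i,\qquad N\in\{0,1,2,\dots\}\cup\{\infty\},$$ where $c$ is a unit of $R$, with $c=1$ unless $N=0$; $t^j\in R$; each $y_i\in R$ is pure of some slope $s_i$; the sequence $s_1,s_2,\dots$ is strictly decreasing; and, if $N=\infty$, then $s_i\to0$ and the product converges in the Fréchet topology of $R$ to an element of $R$. -/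

import Mathlib

open scoped ENNReal Topology

noncomputable section

namespace SlopeFact

/-! Throughout, `E` is the field `𝒪[1/p]`, with its absolute value, and a formal series
`∑ i, x i * t ^ i` with exponents in `ℚ` and coefficients in `E` is the function `x : ℚ → E`. -/

section Series

variable {E : Type*} [NormedField E]

/-- The product of two series: `(x y)_n = ∑ x_i y_{n-i}`, an infinite sum which converges in the
complete field `E` whenever `x` and `y` lie in one of the rings considered below. -/
def seriesMul (x y : ℚ → E) : ℚ → E := fun n => ∑' i : ℚ, x i * y (n - i)

/-- The monomial `t ^ j`. -/
def tPow (j : ℚ) : ℚ → E := Pi.single j 1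

/-- The series `1`. -/
def seriesOne : ℚ → E := tPow 0

/-- The product `y 0 * y 1 * ⋯ * y (n - 1)`. -/
def partialProd (y : ℕ → ℚ → E) : ℕ → ℚ → E
  | 0 => seriesOne
  | n + 1 => seriesMul (partialProd y n) (y n)

/-- The power `x ^ n`. -/
def seriesPow (x : ℚ → E) (n : ℕ) : ℚ → E := partialProd (fun _ => x) n

/-- The norm `w_r(x) = sup_i |x_i| p ^ (-r i)`, with values in `[0, ∞]`. -/
def w (p : ℕ) (r : ℝ) (x : ℚ → E) : ℝ≥0∞ :=
  ⨆ i : ℚ, ENNReal.ofReal (‖x i‖ * (p : ℝ) ^ (-(r * (i : ℝ))))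

/-- For every real `r`, the set of exponents `n` with `|x_n| > p ^ r` is well-ordered. -/
def WellOrderedSupports (p : ℕ) (x : ℚ → E) : Prop :=
  ∀ r : ℝ, {n : ℚ | (p : ℝ) ^ r < ‖x n‖}.IsWF

/-- The `p`-adic valuation of a nonzero element of `E`. -/
def vp (p : ℕ) (a : E) : ℝ := -Real.logb p ‖a‖

/-- The closed-upward convex region whose lower boundary is the Newton polygon of `x`: the convex
hull of the points lying on or above some point `(i, v_p(x_i))` with `x_i ≠ 0`. -/
def newtonRegion (p : ℕ) (x : ℚ → E) : Set (ℝ × ℝ) :=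
  convexHull ℝ {P | ∃ i : ℚ, x i ≠ 0 ∧ P.1 = (i : ℝ) ∧ vp p (x i) ≤ P.2}

/-- `s > 0` is a slope of `x` if a nondegenerate segment of slope `-s` is contained in the Newton
polygon of `x`: the segment `[P, Q]` lies in the region and the region lies above the line through
`P` and `Q`. -/
def IsSlope (p : ℕ) (x : ℚ → E) (s : ℝ) : Prop :=
  0 < s ∧ ∃ P ∈ newtonRegion p x, ∃ Q ∈ newtonRegion p x,
    P.1 < Q.1 ∧ Q.2 - P.2 = -s * (Q.1 - P.1) ∧
    ∀ Z ∈ newtonRegion p x, P.2 - s * (Z.1 - P.1) ≤ Z.2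

/-- `x` is pure of slope `s`: its constant coefficient is nonzero and `s` is its only slope. -/
def IsPureOfSlope (p : ℕ) (x : ℚ → E) (s : ℝ) : Prop :=
  x 0 ≠ 0 ∧ ∀ s' : ℝ, IsSlope p x s' ↔ s' = s

/-- `c` is a unit of the ring with underlying set `R`. -/
def IsUnitOf (R : Set (ℚ → E)) (c : ℚ → E) : Prop :=
  c ∈ R ∧ ∃ d ∈ R, seriesMul c d = seriesOne

/-- `x` has a slope factorization `x = c t^j ∏_{i < N} y_i` in `R`, where `N` is finite or `∞`:
`c` is a unit of `R`, equal to `1` unless there are no factors `y_i`; each `y_i` is an element of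
`R` that is pure of slope `s_i`; the `s_i` are strictly decreasing; and, if `N = ∞`, `s_i → 0` and
the partial products converge in the Fréchet topology of `R`, defined by the norms `w_r`. -/
def HasSlopeFactorization (p : ℕ) (R : Set (ℚ → E)) (x : ℚ → E) : Prop :=
  ∃ (N : ℕ∞) (c : ℚ → E) (j : ℚ) (y : ℕ → ℚ → E) (s : ℕ → ℝ) (P : ℚ → E),
    IsUnitOf R c ∧ (N ≠ 0 → c = seriesOne) ∧
    (tPow j : ℚ → E) ∈ R ∧
    (∀ i : ℕ, (i : ℕ∞) < N → y i ∈ R ∧ IsPureOfSlope p (y i) (s i)) ∧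
    (∀ i i' : ℕ, i < i' → (i' : ℕ∞) < N → s i' < s i) ∧
    (N = ⊤ → Filter.Tendsto s Filter.atTop (𝓝 0)) ∧
    P ∈ R ∧
    (∀ n : ℕ, N = n → P = partialProd y n) ∧
    (N = ⊤ → ∀ r : ℝ, 0 < r →
      Filter.Tendsto (fun n => w p r (partialProd y n - P)) Filter.atTop (𝓝 0)) ∧
    x = seriesMul c (seriesMul (tPow j) P)

/-- `Ω^imm_an`: the series with exponents in `ℚ_{≥ 0}` and coefficients in `𝒪[1/p]` such that the
sets `{n : |x_n| > p ^ r}` are well-ordered and `w_r(x) < ∞` for all `r > 0`. -/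
def OmegaImmAn (p : ℕ) (E : Type*) [NormedField E] : Set (ℚ → E) :=
  {x | (∀ n : ℚ, n < 0 → x n = 0) ∧ WellOrderedSupports p x ∧ ∀ r : ℝ, 0 < r → w p r x < ⊤}

/-- `Ω_an`: the power series `∑_{n ≥ 0} x_n t ^ n` with integral exponents, with coefficients in
`𝒪[1/p]`, and with `liminf v_p(x_n) / n ≥ 0`, that is, `w_r(x) < ∞` for all `r > 0`. -/
def OmegaAn (p : ℕ) (E : Type*) [NormedField E] : Set (ℚ → E) :=
  {x | (∀ n : ℚ, (¬ ∃ m : ℕ, n = m) → x n = 0) ∧ ∀ r : ℝ, 0 < r → w p r x < ⊤}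

end Series

section Alg

variable (p : ℕ) (O : Type*) [CommRing O] [IsLocalRing O]
  (E : Type*) [NormedField E] [Algebra O E]

/-- `Γ^imm`: the series with exponents in `ℚ` and coefficients in `𝒪` such that the sets
`{n : |x_n| > p ^ r}` are well-ordered. -/
def GammaImm : Set (ℚ → E) :=
  {x | (∀ n : ℚ, x n ∈ Set.range (algebraMap O E)) ∧ WellOrderedSupports p x}

/-- The inclusion of `κ((t))` into the field `κ((t^ℚ))` of generalized power series. -/
def laurentToHahn (κ : Type*) [Field κ] : LaurentSeries κ →+* HahnSeries ℚ κ :=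
  HahnSeries.embDomainRingHom (Int.castAddHom ℚ) Int.cast_injective
    (fun _ _ => Int.cast_le)

/-- `a` belongs to the algebraic closure `K^alg` of `K = κ((t))` in `κ((t^ℚ))`. -/
def IsAlgebraicHahn {κ : Type*} [Field κ] (a : HahnSeries ℚ κ) : Prop :=
  ∃ f : Polynomial (LaurentSeries κ), f ≠ 0 ∧ f.eval₂ (laurentToHahn κ) a = 0

/-- `a` is the reduction of the series `x` modulo the maximal ideal of `𝒪`. -/
def IsReduction {O : Type*} [CommRing O] [IsLocalRing O] {E : Type*} [NormedField E] [Algebra O E]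
    (x : ℚ → E) (a : HahnSeries ℚ (IsLocalRing.ResidueField O)) : Prop :=
  ∀ n : ℚ, ∃ b : O, algebraMap O E b = x n ∧ IsLocalRing.residue O b = a.coeff n

/-- The Teichmüller lifts in `Γ^imm` of the elements of `K^alg`: the elements of `Γ^imm` which
reduce into `K^alg` and have a `p ^ m`-th root in `Γ^imm` for every `m`. -/
def algTeichmuller : Set (ℚ → E) :=
  {u | u ∈ GammaImm p O E ∧
    (∀ m : ℕ, ∃ v ∈ GammaImm p O E, seriesPow v (p ^ m) = u) ∧
    ∃ a : HahnSeries ℚ (IsLocalRing.ResidueField O), IsReduction u a ∧ IsAlgebraicHahn a}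

/-- `Γ^alg`, the `p`-adically complete extension of `Γ` with residue field `K^alg`, as a subring of
`Γ^imm`. It is `W(K^alg) ⊗_{W(k)} 𝒪`, that is, the `p`-adic closure in `Γ^imm` of the `𝒪`-span of
the Teichmüller lifts of the elements of `K^alg`. -/
def GammaAlg : Set (ℚ → E) :=
  {x | x ∈ GammaImm p O E ∧ ∀ m : ℕ, ∃ z ∈ Submodule.span O (algTeichmuller p O E),
    ∀ n : ℚ, ‖x n - z n‖ ≤ ((p : ℝ) ^ m)⁻¹}

/-- `Ω^alg_an`: the elements `x` of `Ω^imm_an` such that for each `j`, the truncation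
`∑_{i < j} x_i t ^ i` lies in `Γ^alg_con[1/p]`. (The overconvergence condition defining
`Γ^alg_con` in `Γ^alg` concerns only the coefficients of negative index, which are zero here.) -/
def OmegaAlgAn : Set (ℚ → E) :=
  {x | x ∈ OmegaImmAn p E ∧ ∀ j : ℚ, ∃ m : ℕ,
    (fun i : ℚ => if i < j then (p : E) ^ m * x i else 0) ∈ GammaAlg p O E}

end Alg

end SlopeFact

end

open scoped ENNReal Topology

set_option linter.unusedSectionVars false

noncomputable section

namespace SlopeFact

/-! ### Weights of exponents. -/

section Weight

/-! All three rings have the form `omega p C`: series with nonnegative exponents lying in the Gauss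
rings `gaussSet p E r` for all r > 0 and in a family `C` of series. The factorization is carried out
once, in `hasSlopeFactorization_omega`, for every family satisfying `IsStable`.

Slopes are read off from dominant terms. For each r, a nonzero element of `omega p C` has a first
and a last exponent at which the size |x_n| p^(-rn) is maximal; they exist because the value group
is discrete (`exists_dom`). By the ultrametric inequality both are additive under products
(`Dom.seriesMul`), and r is a slope exactly when they differ. A series with constant term strictly
dominant for every r (`IsFlat`) is therefore slopeless, and it is a unit by a Neumann series at each
radius.

After removing a monomial, let z have nonzero constant term. The infimum s of the radii r with
w_r(z) ≤ |z_0| is zero when z is flat, and is otherwise the largest slope. Let b be the last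
dominant exponent at s. For some r < s one has z = z_b t^b (1 + δ) with w_r(δ) < 1. A Wiener–Hopf
factorization (`exists_wienerHopf`) finds g with negative exponents such that v = (1 + δ)(1 + g) has
only nonnegative ones. Then y = z v⁻¹ = z_b t^b (1 + g)⁻¹ is supported in [0, b] and pure of slope
s, while all slopes of v are smaller (`exists_step`).

Iteration ends at a flat quotient, which the last factor absorbs, or goes on forever. In the second
case the slopes tend to 0, since each factor of slope at least ρ lowers the last dominant exponent
at ρ by an amount bounded below. The raw products need not converge, so the factors are corrected by
units: below a cutoff J_n tending to infinity the quotient Z_n has integral coefficients, so its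
truncation U_n is flat, and inserting U_(n+1) U_n⁻¹ into the n-th factor makes the partial products
telescope to x Z_n⁻¹ U_n, which tends to x (`IsDivisionChain.exists_convergent`).

For Ω^alg_an the work lies in proving stability. A truncated product is approximated by products of
truncations from which finitely many corner regions have been removed by inclusion and exclusion
(`exists_approx_trunc_mul`). Closure under limits rests on Γ^alg being saturated in Γ^imm: if ϖx
lies in Γ^alg, so does x. This holds because a sum of Teichmüller lifts is, modulo p, a p^N-th power
for every N. -/

/-- The weight `p ^ (-r n)` of the exponent `n`. -/
def weight (p : ℕ) (r : ℝ) (n : ℚ) : ℝ := (p : ℝ) ^ (-(r * (n : ℝ)))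

variable {p : ℕ} [hpr : Fact p.Prime]

lemma one_lt_p : (1 : ℝ) < p := by exact_mod_cast hpr.out.one_lt

lemma p_pos : (0 : ℝ) < p := zero_lt_one.trans one_lt_p

lemma weight_pos (r : ℝ) (n : ℚ) : 0 < weight p r n := Real.rpow_pos_of_pos p_pos _

lemma weight_add (r : ℝ) (m n : ℚ) : weight p r (m + n) = weight p r m * weight p r n := by
  unfold weight
  rw [← Real.rpow_add p_pos]
  push_cast
  ring_nf

@[simp] lemma weight_zero (r : ℝ) : weight p r 0 = 1 := by simp [weight]

@[simp] lemma weight_zero_left (n : ℚ) : weight p 0 n = 1 := by simp [weight]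

lemma weight_le_weight {r s : ℝ} {m n : ℚ} (h : s * n ≤ r * m) : weight p r m ≤ weight p s n :=
  Real.rpow_le_rpow_of_exponent_le one_lt_p.le (by linarith)

lemma weight_lt_weight {r s : ℝ} {m n : ℚ} (h : s * n < r * m) : weight p r m < weight p s n :=
  Real.rpow_lt_rpow_of_exponent_lt one_lt_p (by linarith)

end Weight

/-! ### Gauss norms and the Gauss rings of generalized series. -/

section Gauss

variable {E : Type*} [NormedField E]

/-- The size of the term of exponent `n` of the series `x`, with respect to `w_r`. -/
def size (p : ℕ) (r : ℝ) (x : ℚ → E) (n : ℚ) : ℝ := ‖x n‖ * weight p r n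

/-- The series `x` satisfies `w_r(x) ≤ c`. -/
def IsBd (p : ℕ) (r : ℝ) (c : ℝ) (x : ℚ → E) : Prop := ∀ n, size p r x n ≤ c

/-- The series with `w_r(x) < ∞` for which the sets of exponents of terms of size bounded below
are well-ordered. -/
def gaussSet (p : ℕ) (E : Type*) [NormedField E] (r : ℝ) : Set (ℚ → E) :=
  {x | (∃ c, IsBd p r c x) ∧ ∀ ε : ℝ, 0 < ε → {n | ε < size p r x n}.IsWF}

variable {p : ℕ} [hpr : Fact p.Prime]

lemma size_nonneg (r : ℝ) (x : ℚ → E) (n : ℚ) : 0 ≤ size p r x n :=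
  mul_nonneg (norm_nonneg _) (weight_pos r n).le

lemma size_pos {r : ℝ} {x : ℚ → E} {n : ℚ} (h : x n ≠ 0) : 0 < size p r x n :=
  mul_pos (norm_pos_iff.2 h) (weight_pos r n)

lemma size_mul (r : ℝ) (x y : ℚ → E) (i n : ℚ) :
    ‖x i * y (n - i)‖ * weight p r n = size p r x i * size p r y (n - i) := by
  have : weight p r n = weight p r i * weight p r (n - i) := by rw [← weight_add]; ring_nf
  rw [size, size, norm_mul, this]; ring

lemma IsBd.nonneg {r c : ℝ} {x : ℚ → E} (h : IsBd p r c x) : 0 ≤ c :=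
  (size_nonneg r x 0).trans (h 0)

lemma IsBd.mono {r c d : ℝ} {x : ℚ → E} (h : IsBd p r c x) (hcd : c ≤ d) : IsBd p r d x :=
  fun n => (h n).trans hcd

lemma IsBd.neg {r c : ℝ} {x : ℚ → E} (h : IsBd p r c x) : IsBd p r c (-x) := fun n => by
  simpa [size] using h n

lemma IsBd.smul {r c : ℝ} {x : ℚ → E} (h : IsBd p r c x) (a : E) : IsBd p r (‖a‖ * c) (a • x) :=
  fun n => by
    have := mul_le_mul_of_nonneg_left (h n) (norm_nonneg a)
    simpa [size, mul_assoc] using this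

lemma isBd_zero (r : ℝ) : IsBd p r 0 (0 : ℚ → E) := fun n => by simp [size]

lemma eq_zero_of_forall_isBd {r : ℝ} {x : ℚ → E} (h : ∀ ε : ℝ, 0 < ε → IsBd p r ε x) :
    x = 0 := by
  funext n
  have h0 : size p r x n ≤ 0 := le_of_forall_pos_le_add fun ε hε => by simpa using h ε hε n
  by_contra hn
  exact absurd (size_pos (p := p) (r := r) hn) h0.not_gt

section Ultra

variable [IsUltrametricDist E]

lemma size_add_le (r : ℝ) (x y : ℚ → E) (n : ℚ) :
    size p r (x + y) n ≤ max (size p r x n) (size p r y n) := by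
  unfold size
  rw [← max_mul_of_nonneg _ _ (weight_pos r n).le]
  exact mul_le_mul_of_nonneg_right (IsUltrametricDist.norm_add_le_max _ _) (weight_pos r n).le

lemma IsBd.add {r c : ℝ} {x y : ℚ → E} (hx : IsBd p r c x) (hy : IsBd p r c y) :
    IsBd p r c (x + y) := fun n => (size_add_le r x y n).trans (max_le (hx n) (hy n))

lemma IsBd.sub {r c : ℝ} {x y : ℚ → E} (hx : IsBd p r c x) (hy : IsBd p r c y) :
    IsBd p r c (x - y) := by
  rw [sub_eq_add_neg]; exact hx.add hy.neg

lemma IsBd.add_max {r c d : ℝ} {x y : ℚ → E} (hx : IsBd p r c x) (hy : IsBd p r d y) :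
    IsBd p r (max c d) (x + y) := (hx.mono (le_max_left _ _)).add (hy.mono (le_max_right _ _))

lemma add_mem_gaussSet {r : ℝ} {x y : ℚ → E} (hx : x ∈ gaussSet p E r)
    (hy : y ∈ gaussSet p E r) : x + y ∈ gaussSet p E r := by
  obtain ⟨⟨c, hc⟩, hx⟩ := hx
  obtain ⟨⟨d, hd⟩, hy⟩ := hy
  refine ⟨⟨_, hc.add_max hd⟩, fun ε hε => ((hx ε hε).union (hy ε hε)).mono fun n hn => ?_⟩
  exact lt_max_iff.1 (hn.trans_le (size_add_le r x y n))

lemma neg_mem_gaussSet {r : ℝ} {x : ℚ → E} (hx : x ∈ gaussSet p E r) : -x ∈ gaussSet p E r := by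
  obtain ⟨⟨c, hc⟩, hx⟩ := hx
  exact ⟨⟨c, hc.neg⟩, fun ε hε => by simpa [size] using hx ε hε⟩

lemma sub_mem_gaussSet {r : ℝ} {x y : ℚ → E} (hx : x ∈ gaussSet p E r)
    (hy : y ∈ gaussSet p E r) : x - y ∈ gaussSet p E r := by
  rw [sub_eq_add_neg]; exact add_mem_gaussSet hx (neg_mem_gaussSet hy)

lemma mem_gaussSet_of_size_le {r s K : ℝ} (hK : 0 < K) {x y : ℚ → E} (hx : x ∈ gaussSet p E r)
    (h : ∀ n, size p s y n ≤ K * size p r x n) : y ∈ gaussSet p E s := by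
  obtain ⟨⟨c, hc⟩, hx⟩ := hx
  refine ⟨⟨K * c, fun n => (h n).trans (mul_le_mul_of_nonneg_left (hc n) hK.le)⟩,
    fun ε hε => (hx (ε / K) (by positivity)).mono fun n hn => ?_⟩
  have : ε < K * size p r x n := lt_of_lt_of_le hn (h n)
  rw [Set.mem_ofPred_eq, div_lt_iff₀ hK]
  linarith

lemma smul_mem_gaussSet {r : ℝ} {x : ℚ → E} (hx : x ∈ gaussSet p E r) (a : E) :
    a • x ∈ gaussSet p E r := by
  refine mem_gaussSet_of_size_le (K := ‖a‖ + 1) (by positivity) hx fun n => ?_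
  have : 0 ≤ ‖x n‖ * weight p r n :=
    mul_nonneg (norm_nonneg _) (Real.rpow_nonneg (Nat.cast_nonneg p) _)
  simp only [size, Pi.smul_apply, smul_eq_mul, norm_mul]
  nlinarith

/-- If w_r(x - y) ≤ ε, every term of x of size above ε sits at an exponent where y also has size
above ε, so well-ordering passes to the limit. -/
lemma mem_gaussSet_of_approx {r : ℝ} {x : ℚ → E}
    (h : ∀ ε : ℝ, 0 < ε → ∃ y ∈ gaussSet p E r, IsBd p r ε (x - y)) : x ∈ gaussSet p E r := by
  have key : ∀ y : ℚ → E, ∀ n, size p r x n ≤ max (size p r (x - y) n) (size p r y n) :=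
    fun y n => by simpa using size_add_le r (x - y) y n
  refine ⟨?_, fun ε hε => ?_⟩
  · obtain ⟨y, ⟨⟨c, hc⟩, -⟩, hy⟩ := h 1 one_pos
    exact ⟨_, fun n => (key y n).trans (max_le_max (hy n) (hc n))⟩
  · obtain ⟨y, hyg, hy⟩ := h ε hε
    refine (hyg.2 ε hε).mono fun n hn => ?_
    rcases lt_max_iff.1 (lt_of_lt_of_le hn (key y n)) with h1 | h1
    · exact absurd h1 (hy n).not_gt
    · exact h1

lemma single_mem_gaussSet (r : ℝ) (q : ℚ) (a : E) : Pi.single q a ∈ gaussSet p E r := by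
  classical
  refine ⟨⟨size p r (Pi.single q a) q, fun n => ?_⟩, fun ε hε => ?_⟩
  · rcases eq_or_ne n q with rfl | h
    · rfl
    · simpa [size, h] using mul_nonneg (norm_nonneg a) (weight_pos (p := p) r q).le
  · refine (Set.finite_singleton q).isWF.mono fun n hn => ?_
    by_contra h
    have h : n ≠ q := h
    simp [size, h] at hn
    exact absurd hn hε.not_gt

/-- Strictness survives the infinite sum: only finitely many terms reach c / 2, so the supremum of
the norms is below c. -/
lemma norm_tsum_lt {ι : Type*} {f : ι → E} (hf : Filter.Tendsto f Filter.cofinite (𝓝 0)) {c : ℝ}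
    (hc : 0 < c) (h : ∀ i, ‖f i‖ < c) : ‖∑' i, f i‖ < c := by
  have hfin : {i | ¬ ‖f i‖ < c / 2}.Finite := by
    have := (tendsto_zero_iff_norm_tendsto_zero.1 hf).eventually (gt_mem_nhds (half_pos hc))
    exact Filter.eventually_cofinite.1 this
  obtain ⟨d, hd0, hdc, hd⟩ : ∃ d, 0 ≤ d ∧ d < c ∧ ∀ i, ‖f i‖ ≤ d := by
    rcases hfin.toFinset.eq_empty_or_nonempty with he | hne
    · refine ⟨c / 2, by linarith, by linarith, fun i => ?_⟩
      have : i ∉ hfin.toFinset := he ▸ Finset.notMem_empty i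
      simp only [Set.Finite.mem_toFinset, Set.mem_ofPred_eq, not_not] at this
      exact this.le
    · obtain ⟨j, hj, hmax⟩ := hfin.toFinset.exists_max_image (fun i => ‖f i‖) hne
      refine ⟨max (‖f j‖) (c / 2), by positivity, max_lt (h j) (by linarith), fun i => ?_⟩
      by_cases hi : i ∈ hfin.toFinset
      · exact le_max_of_le_left (hmax i hi)
      · simp at hi
        exact le_max_of_le_right hi.le
  exact (IsUltrametricDist.norm_tsum_le_of_forall_le_of_nonneg hd0 hd).trans_lt hdc

/-- If the product of the sizes exceeds ε, each size exceeds a fixed threshold, since the other is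
bounded. The exponents then form an antidiagonal of two well-ordered sets, which is finite. -/
lemma finite_large_terms {r : ℝ} {x y : ℚ → E} (hx : x ∈ gaussSet p E r)
    (hy : y ∈ gaussSet p E r) (n : ℚ) {ε : ℝ} (hε : 0 < ε) :
    {i | ε < size p r x i * size p r y (n - i)}.Finite := by
  obtain ⟨⟨c, hc⟩, hx⟩ := hx
  obtain ⟨⟨d, hd⟩, hy⟩ := hy
  have hc0 := hc.nonneg
  have hd0 := hd.nonneg
  have hX := (hx (ε / (d + 1)) (by positivity)).isPWO
  have hY := (hy (ε / (c + 1)) (by positivity)).isPWO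
  refine ((Set.AddAntidiagonal.finite_of_isPWO hX hY n).image Prod.fst).subset fun i hi => ?_
  refine ⟨(i, n - i), ⟨?_, ?_, by simp⟩, rfl⟩
  · have h1 : size p r y (n - i) ≤ d + 1 := (hd _).trans (by linarith)
    have h2 := mul_le_mul_of_nonneg_left h1 (size_nonneg (p := p) r x i)
    simp only [Set.mem_ofPred_eq] at hi ⊢
    rw [div_lt_iff₀ (by positivity)]
    linarith
  · have h1 : size p r x i ≤ c + 1 := (hc _).trans (by linarith)
    have h2 := mul_le_mul_of_nonneg_right h1 (size_nonneg (p := p) r y (n - i))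
    simp only [Set.mem_ofPred_eq] at hi ⊢
    rw [div_lt_iff₀ (by positivity)]
    linarith

lemma tendsto_terms {r : ℝ} {x y : ℚ → E} (hx : x ∈ gaussSet p E r)
    (hy : y ∈ gaussSet p E r) (n : ℚ) :
    Filter.Tendsto (fun i => x i * y (n - i)) Filter.cofinite (𝓝 0) := by
  rw [NormedAddGroup.tendsto_nhds_zero]
  intro ε hε
  rw [Filter.eventually_cofinite]
  have hw := weight_pos (p := p) r n
  refine (finite_large_terms hx hy n (ε := ε * weight p r n / 2) (by positivity)).subset
    fun i hi => ?_
  simp only [Set.mem_ofPred_eq, not_lt] at hi ⊢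
  rw [← size_mul]
  nlinarith

end Ultra

section Complete

variable [IsUltrametricDist E] [CompleteSpace E]

lemma summable_terms {r : ℝ} {x y : ℚ → E} (hx : x ∈ gaussSet p E r)
    (hy : y ∈ gaussSet p E r) (n : ℚ) : Summable fun i => x i * y (n - i) :=
  NonarchimedeanAddGroup.summable_of_tendsto_cofinite_zero (tendsto_terms hx hy n)

lemma size_seriesMul_le {r c : ℝ} {x y : ℚ → E} {n : ℚ} (hc : 0 ≤ c)
    (h : ∀ i, size p r x i * size p r y (n - i) ≤ c) : size p r (seriesMul x y) n ≤ c := by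
  have hw := weight_pos (p := p) r n
  rw [size, ← le_div_iff₀ hw]
  refine IsUltrametricDist.norm_tsum_le_of_forall_le_of_nonneg (by positivity) fun i => ?_
  rw [le_div_iff₀ hw, size_mul]
  exact h i

lemma size_seriesMul_lt {r c : ℝ} {x y : ℚ → E} (hx : x ∈ gaussSet p E r)
    (hy : y ∈ gaussSet p E r) {n : ℚ} (hc : 0 < c)
    (h : ∀ i, size p r x i * size p r y (n - i) < c) : size p r (seriesMul x y) n < c := by
  have hw := weight_pos (p := p) r n
  rw [size, ← lt_div_iff₀ hw]
  refine norm_tsum_lt (tendsto_terms hx hy n) (by positivity) fun i => ?_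
  rw [lt_div_iff₀ hw, size_mul]
  exact h i

lemma IsBd.mul {r c d : ℝ} {x y : ℚ → E} (hx : IsBd p r c x) (hy : IsBd p r d y) :
    IsBd p r (c * d) (seriesMul x y) := fun _ =>
  size_seriesMul_le (mul_nonneg hx.nonneg hy.nonneg) fun _ =>
    mul_le_mul (hx _) (hy _) (size_nonneg _ _ _) hx.nonneg

lemma mul_mem_gaussSet {r : ℝ} {x y : ℚ → E} (hx : x ∈ gaussSet p E r)
    (hy : y ∈ gaussSet p E r) : seriesMul x y ∈ gaussSet p E r := by
  obtain ⟨⟨c, hc⟩, hx⟩ := hx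
  obtain ⟨⟨d, hd⟩, hy⟩ := hy
  have hc0 := hc.nonneg
  have hd0 := hd.nonneg
  refine ⟨⟨_, hc.mul hd⟩, fun ε hε => ?_⟩
  have hX := (hx (ε / (d + 1)) (by positivity)).isPWO
  have hY := (hy (ε / (c + 1)) (by positivity)).isPWO
  refine (hX.add hY).isWF.mono fun n hn => ?_
  obtain ⟨i, hi⟩ : ∃ i, ε < size p r x i * size p r y (n - i) := by
    by_contra! hcon
    exact absurd hn (size_seriesMul_le hε.le hcon).not_gt
  refine Set.mem_add.2 ⟨i, ?_, n - i, ?_, by simp⟩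
  · have h1 : size p r y (n - i) ≤ d + 1 := (hd _).trans (by linarith)
    have h2 := mul_le_mul_of_nonneg_left h1 (size_nonneg (p := p) r x i)
    simp only [Set.mem_ofPred_eq]
    rw [div_lt_iff₀ (by positivity)]
    linarith
  · have h1 : size p r x i ≤ c + 1 := (hc _).trans (by linarith)
    have h2 := mul_le_mul_of_nonneg_right h1 (size_nonneg (p := p) r y (n - i))
    simp only [Set.mem_ofPred_eq]
    rw [div_lt_iff₀ (by positivity)]
    linarith

lemma seriesMul_comm (x y : ℚ → E) : seriesMul x y = seriesMul y x := by
  funext n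
  unfold seriesMul
  rw [← (Equiv.subLeft n).tsum_eq]
  exact tsum_congr fun i => by simp [mul_comm]

lemma seriesMul_add {r : ℝ} {x y z : ℚ → E} (hx : x ∈ gaussSet p E r) (hy : y ∈ gaussSet p E r)
    (hz : z ∈ gaussSet p E r) : seriesMul x (y + z) = seriesMul x y + seriesMul x z := by
  funext n
  simp only [seriesMul, Pi.add_apply, mul_add]
  exact (summable_terms hx hy n).tsum_add (summable_terms hx hz n)

lemma single_seriesMul (q : ℚ) (a : E) (x : ℚ → E) (n : ℚ) :
    seriesMul (Pi.single q a) x n = a * x (n - q) := by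
  classical
  unfold seriesMul
  rw [tsum_eq_single q]
  · simp
  · intro i hi
    simp [hi]

lemma tPow_seriesMul (q : ℚ) (x : ℚ → E) (n : ℚ) : seriesMul (tPow q) x n = x (n - q) := by
  simp [tPow, single_seriesMul]

lemma seriesOne_seriesMul (x : ℚ → E) : seriesMul seriesOne x = x := by
  funext n; simp [seriesOne, tPow_seriesMul]

lemma smul_seriesMul (a : E) (x y : ℚ → E) : seriesMul (a • x) y = a • seriesMul x y := by
  funext n
  simp only [seriesMul, Pi.smul_apply, smul_eq_mul, mul_assoc]
  exact tsum_mul_left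

/-- Fubini for a double series whose terms tend to zero: in a complete ultrametric field this
already gives summability. -/
lemma seriesMul_assoc {r : ℝ} {x y z : ℚ → E} (hx : x ∈ gaussSet p E r) (hy : y ∈ gaussSet p E r)
    (hz : z ∈ gaussSet p E r) :
    seriesMul (seriesMul x y) z = seriesMul x (seriesMul y z) := by
  funext n
  have hF : Summable fun q : ℚ × ℚ => x q.1 * y (q.2 - q.1) * z (n - q.2) := by
    refine NonarchimedeanAddGroup.summable_of_tendsto_cofinite_zero ?_
    rw [NormedAddGroup.tendsto_nhds_zero]
    intro ε hε
    rw [Filter.eventually_cofinite]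
    obtain ⟨⟨a, ha⟩, hxw⟩ := id hx
    obtain ⟨⟨b, hb⟩, hyw⟩ := id hy
    obtain ⟨⟨c, hc⟩, hzw⟩ := id hz
    have ha0 := ha.nonneg
    have hb0 := hb.nonneg
    have hc0 := hc.nonneg
    have hw := weight_pos (p := p) r n
    set δ := ε * weight p r n with hδ
    have hδ0 : 0 < δ := by positivity
    -- A triple product of size at least δ forces each factor to be at least δ divided by the bounds
    -- on the other two; the 2 makes the inequality strict.
    have hX := (hxw (δ / (2 * ((b + 1) * (c + 1)))) (by positivity)).isPWO
    have hY := (hyw (δ / (2 * ((a + 1) * (c + 1)))) (by positivity)).isPWO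
    have hZ := (hzw (δ / (2 * ((a + 1) * (b + 1)))) (by positivity)).isPWO
    have h1 := Set.AddAntidiagonal.finite_of_isPWO (hX.add hY) hZ n
    have h2 := fun m : ℚ × ℚ => Set.AddAntidiagonal.finite_of_isPWO hX hY m.1
    refine ((h1.biUnion fun m _ => (h2 m).image fun q => (q.1, m.1))).subset ?_
    rintro ⟨j, i⟩ hi
    simp only [Set.mem_ofPred_eq, not_lt, norm_mul] at hi
    have hsz : δ ≤ size p r x j * size p r y (i - j) * size p r z (n - i) := by
      have : weight p r n = weight p r j * weight p r (i - j) * weight p r (n - i) := by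
        rw [← weight_add, ← weight_add]; ring_nf
      have h3 := mul_le_mul_of_nonneg_right hi hw.le
      rw [hδ]
      refine h3.trans (le_of_eq ?_)
      rw [this]
      simp only [size]
      ring
    have sx := size_nonneg (p := p) r x j
    have sy := size_nonneg (p := p) r y (i - j)
    have sz := size_nonneg (p := p) r z (n - i)
    have bx : size p r x j ≤ a + 1 := (ha _).trans (by linarith)
    have by' : size p r y (i - j) ≤ b + 1 := (hb _).trans (by linarith)
    have bz : size p r z (n - i) ≤ c + 1 := (hc _).trans (by linarith)
    have mx : j ∈ {m | δ / (2 * ((b + 1) * (c + 1))) < size p r x m} := by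
      rw [Set.mem_ofPred_eq, div_lt_iff₀ (by positivity)]
      have : size p r y (i - j) * size p r z (n - i) ≤ (b + 1) * (c + 1) :=
        mul_le_mul by' bz sz (by positivity)
      nlinarith [mul_le_mul_of_nonneg_left this sx]
    have my : i - j ∈ {m | δ / (2 * ((a + 1) * (c + 1))) < size p r y m} := by
      rw [Set.mem_ofPred_eq, div_lt_iff₀ (by positivity)]
      have : size p r x j * size p r z (n - i) ≤ (a + 1) * (c + 1) :=
        mul_le_mul bx bz sz (by positivity)
      nlinarith [mul_le_mul_of_nonneg_left this sy]
    have mz : n - i ∈ {m | δ / (2 * ((a + 1) * (b + 1))) < size p r z m} := by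
      rw [Set.mem_ofPred_eq, div_lt_iff₀ (by positivity)]
      have : size p r x j * size p r y (i - j) ≤ (a + 1) * (b + 1) :=
        mul_le_mul bx by' sy (by positivity)
      nlinarith [mul_le_mul_of_nonneg_left this sz]
    refine Set.mem_iUnion₂.2 ⟨(i, n - i), ⟨Set.mem_add.2 ⟨j, mx, i - j, my, by simp⟩, mz, by simp⟩,
      ⟨(j, i - j), ⟨mx, my, by simp⟩, rfl⟩⟩
  have hcomm := hF.tsum_comm (f := fun j i => x j * y (i - j) * z (n - i))
  simp only [seriesMul]
  calc ∑' i, (∑' j, x j * y (i - j)) * z (n - i)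
      = ∑' i, ∑' j, x j * y (i - j) * z (n - i) := tsum_congr fun i => tsum_mul_right.symm
    _ = ∑' j, ∑' i, x j * y (i - j) * z (n - i) := hcomm
    _ = ∑' j, x j * ∑' k, y k * z (n - j - k) := by
        refine tsum_congr fun j => ?_
        rw [← tsum_mul_left, ← (Equiv.addRight j).tsum_eq]
        refine tsum_congr fun k => ?_
        simp only [Equiv.coe_addRight, add_sub_cancel_right, mul_assoc]
        rw [sub_sub, add_comm k j]

/-- The ring of series `gaussSet p E r`. -/
def GaussRing (p : ℕ) [Fact p.Prime] (E : Type*) [NormedField E] [IsUltrametricDist E] (r : ℝ) :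
    AddSubgroup (ℚ → E) where
  carrier := gaussSet p E r
  zero_mem' := by simpa using single_mem_gaussSet (p := p) r 0 (0 : E)
  add_mem' := add_mem_gaussSet
  neg_mem' := neg_mem_gaussSet

/-- This instance makes `ring` available for identities between series lying in a common Gauss ring.
-/
instance (r : ℝ) : CommRing (GaussRing p E r) :=
  { (inferInstance : AddCommGroup (GaussRing p E r)) with
    mul := fun x y => ⟨seriesMul x.1 y.1, mul_mem_gaussSet x.2 y.2⟩
    one := ⟨seriesOne, single_mem_gaussSet r 0 1⟩
    mul_assoc := fun x y z => Subtype.ext (seriesMul_assoc x.2 y.2 z.2)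
    mul_comm := fun x y => Subtype.ext (seriesMul_comm x.1 y.1)
    one_mul := fun x => Subtype.ext (seriesOne_seriesMul x.1)
    mul_one := fun x => Subtype.ext ((seriesMul_comm _ _).trans (seriesOne_seriesMul x.1))
    left_distrib := fun x y z => Subtype.ext (seriesMul_add x.2 y.2 z.2)
    right_distrib := fun x y z => Subtype.ext <| by
      have h := seriesMul_add z.2 x.2 y.2
      change seriesMul (x.1 + y.1) z.1 = seriesMul x.1 z.1 + seriesMul y.1 z.1
      rw [seriesMul_comm (x.1 + y.1), seriesMul_comm x.1, seriesMul_comm y.1, h]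
    zero_mul := fun x => Subtype.ext <| by
      change seriesMul (0 : ℚ → E) x.1 = 0
      funext n; simp [seriesMul]
    mul_zero := fun x => Subtype.ext <| by
      change seriesMul x.1 (0 : ℚ → E) = 0
      funext n; simp [seriesMul]
  }

@[simp] lemma coe_mul_gauss {r : ℝ} (x y : GaussRing p E r) : (x * y).1 = seriesMul x.1 y.1 := rfl

@[simp] lemma coe_one_gauss {r : ℝ} : (1 : GaussRing p E r).1 = seriesOne := rfl

end Complete

end Gauss

/-! ### Dominant terms and slopes. -/

section Dominant

variable {E : Type*} [NormedField E] {p : ℕ} [hpr : Fact p.Prime]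

/-- The term of exponent `a` of `x` is of maximal size for `w_r`, and, depending on the sign
of `σ`, is the first or the last one with this property. -/
def Dom (p : ℕ) (σ : ℚ) (r : ℝ) (x : ℚ → E) (a : ℚ) : Prop :=
  x a ≠ 0 ∧ ∀ n, size p r x n ≤ size p r x a ∧ (σ * n < σ * a → size p r x n < size p r x a)

lemma Dom.eq {σ : ℚ} (hσ : σ ≠ 0) {r : ℝ} {x : ℚ → E} {a b : ℚ} (ha : Dom p σ r x a)
    (hb : Dom p σ r x b) : a = b := by
  rcases lt_trichotomy (σ * a) (σ * b) with h | h | h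
  · exact absurd ((hb.2 a).2 h) (ha.2 b).1.not_gt
  · exact mul_left_cancel₀ hσ h
  · exact absurd ((ha.2 b).2 h) (hb.2 a).1.not_gt

/-- In the coefficient of exponent a + b, any pair of exponents other than (a, b) has one entry
strictly before a or b in the order given by σ. Hence x_a y_b strictly dominates the other terms and
fixes the norm of the sum. -/
lemma Dom.size_seriesMul [IsUltrametricDist E] [CompleteSpace E] {σ : ℚ} (hσ : σ ≠ 0) {r : ℝ}
    {x y : ℚ → E} {a b : ℚ} (hx : x ∈ gaussSet p E r) (hy : y ∈ gaussSet p E r)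
    (ha : Dom p σ r x a) (hb : Dom p σ r y b) :
    size p r (SlopeFact.seriesMul x y) (a + b) = size p r x a * size p r y b := by
  classical
  have sa := size_pos (p := p) (r := r) ha.1
  have sb := size_pos (p := p) (r := r) hb.1
  have hab : 0 < size p r x a * size p r y b := mul_pos sa sb
  set x' : ℚ → E := x - Pi.single a (x a) with hx'
  have hsingle : Pi.single a (x a) ∈ gaussSet p E r := single_mem_gaussSet r a (x a)
  have hx'm : x' ∈ gaussSet p E r := sub_mem_gaussSet hx hsingle
  have hxx : x = Pi.single a (x a) + x' := by simp [hx']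
  have h1 : SlopeFact.seriesMul x y (a + b) = x a * y b + SlopeFact.seriesMul x' y (a + b) := by
    conv_lhs => rw [hxx, seriesMul_comm, seriesMul_add hy hsingle hx'm, Pi.add_apply,
      seriesMul_comm y, seriesMul_comm y, single_seriesMul]
    simp
  have h2 : size p r (SlopeFact.seriesMul x' y) (a + b) < size p r x a * size p r y b := by
    refine size_seriesMul_lt hx'm hy hab fun i => ?_
    rcases eq_or_ne i a with rfl | hi
    · have : size p r x' i = 0 := by simp [size, hx']
      rw [this, zero_mul]; exact hab
    · have hsz : size p r x' i = size p r x i := by simp [size, hx', hi]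
      rw [hsz]
      have hor : σ * i < σ * a ∨ σ * (a + b - i) < σ * b := by
        have hne : σ * i ≠ σ * a := fun h => hi (mul_left_cancel₀ hσ h)
        rcases lt_or_gt_of_ne hne with h | h
        · exact Or.inl h
        · right; rw [mul_sub, mul_add]; linarith
      rcases hor with h | h
      · exact (mul_le_mul_of_nonneg_left (hb.2 _).1 (size_nonneg _ _ _)).trans_lt
          (mul_lt_mul_of_pos_right ((ha.2 i).2 h) sb)
      · exact mul_lt_mul' (ha.2 i).1 ((hb.2 _).2 h) (size_nonneg _ _ _) sa
  have hw := weight_pos (p := p) r (a + b)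
  have h3 : ‖x a * y b‖ * weight p r (a + b) = size p r x a * size p r y b := by
    have := size_mul (p := p) r x y a (a + b)
    simpa using this
  have h4 : ‖SlopeFact.seriesMul x' y (a + b)‖ < ‖x a * y b‖ := by
    rw [← h3] at h2
    exact lt_of_mul_lt_mul_right h2 hw.le
  rw [size, h1, IsUltrametricDist.norm_add_eq_max_of_norm_ne_norm h4.ne', max_eq_left h4.le, h3]

lemma Dom.seriesMul [IsUltrametricDist E] [CompleteSpace E] {σ : ℚ} (hσ : σ ≠ 0) {r : ℝ}
    {x y : ℚ → E} {a b : ℚ} (hx : x ∈ gaussSet p E r) (hy : y ∈ gaussSet p E r)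
    (ha : Dom p σ r x a) (hb : Dom p σ r y b) : Dom p σ r (seriesMul x y) (a + b) := by
  classical
  have sa := size_pos (p := p) (r := r) ha.1
  have sb := size_pos (p := p) (r := r) hb.1
  have hab : 0 < size p r x a * size p r y b := mul_pos sa sb
  have key := ha.size_seriesMul hσ hx hy hb
  refine ⟨fun h0 => ?_, fun n => ⟨?_, fun hn => ?_⟩⟩
  · rw [size, h0] at key
    simp at key
    rcases key with h | h
    · exact sa.ne' h
    · exact sb.ne' h
  · rw [key]
    exact size_seriesMul_le hab.le fun i =>
      mul_le_mul (ha.2 i).1 (hb.2 _).1 (size_nonneg _ _ _) sa.le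
  · rw [key]
    refine size_seriesMul_lt hx hy hab fun i => ?_
    have hor : σ * i < σ * a ∨ σ * (n - i) < σ * b := by
      by_contra! h
      rw [mul_sub] at h
      rw [mul_add] at hn
      linarith
    rcases hor with h | h
    · exact (mul_le_mul_of_nonneg_left (hb.2 _).1 (size_nonneg _ _ _)).trans_lt
            (mul_lt_mul_of_pos_right ((ha.2 i).2 h) sb)
    · exact mul_lt_mul' (ha.2 i).1 ((hb.2 _).2 h) (size_nonneg _ _ _) sa

/-- Up to sign this is the intercept of the line of slope -r through (n, v_p(x_n)), so maximal size
for w_r means touching the lowest supporting line of that slope. -/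
lemma logb_size {r : ℝ} {x : ℚ → E} {n : ℚ} (h : x n ≠ 0) :
    Real.logb p (size p r x n) = -(vp p (x n) + r * n) := by
  unfold size weight vp
  rw [Real.logb_mul (norm_ne_zero_iff.2 h) (Real.rpow_pos_of_pos p_pos _).ne',
    Real.logb_rpow p_pos one_lt_p.ne']
  ring

lemma size_le_size_iff {r : ℝ} {x : ℚ → E} {i j : ℚ} (hi : x i ≠ 0) (hj : x j ≠ 0) :
    size p r x i ≤ size p r x j ↔ vp p (x j) + r * j ≤ vp p (x i) + r * i := by
  rw [← Real.logb_le_logb (one_lt_p (p := p)) (size_pos hi) (size_pos hj), logb_size hi,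
    logb_size hj, neg_le_neg_iff]

/-- A slope is a value `s > 0` for which the maximal size of the terms is attained twice. -/
lemma isSlope_iff (x : ℚ → E) (s : ℝ) : IsSlope p x s ↔ 0 < s ∧ ∃ i j : ℚ, i < j ∧ x i ≠ 0 ∧
    x j ≠ 0 ∧ size p s x i = size p s x j ∧ ∀ n, size p s x n ≤ size p s x i := by
  have gen : ∀ i : ℚ, x i ≠ 0 → ((i : ℝ), vp p (x i)) ∈ newtonRegion p x := fun i hi =>
    subset_convexHull ℝ _ ⟨i, hi, rfl, le_rfl⟩
  constructor
  · rintro ⟨hs, P, hP, Q, hQ, hPQ, hslope, hmin⟩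
    refine ⟨hs, ?_⟩
    set m := P.2 + s * P.1 with hm
    have hmin' : ∀ i : ℚ, x i ≠ 0 → m ≤ vp p (x i) + s * i := fun i hi => by
      have := hmin _ (gen i hi)
      simp only at this
      rw [hm]; linarith
    obtain ⟨i, j, hij, hi, hj, hvi, hvj⟩ : ∃ i j : ℚ, i < j ∧ x i ≠ 0 ∧ x j ≠ 0 ∧
        vp p (x i) + s * i = m ∧ vp p (x j) + s * j = m := by
      by_contra! hcon
      obtain ⟨c, hc⟩ : ∃ c : ℚ, ∀ i : ℚ, x i ≠ 0 → vp p (x i) + s * i = m → i = c := by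
        by_cases hex : ∃ c : ℚ, x c ≠ 0 ∧ vp p (x c) + s * c = m
        · obtain ⟨c, hc, hcm⟩ := hex
          refine ⟨c, fun i hi him => ?_⟩
          rcases lt_trichotomy i c with h | h | h
          · exact absurd hcm (hcon i c h hi hc him)
          · exact h
          · exact absurd him (hcon c i h hc hi hcm)
        · exact ⟨0, fun i hi him => absurd ⟨i, hi, him⟩ hex⟩
      -- If the supporting line meets at most one generating vertical ray at its base, then "above
      -- the line, and on it only at abscissa c" is a convex condition satisfied by the whole
      -- region. It would force P and Q to share their abscissa.
      have hconv : Convex ℝ {Z : ℝ × ℝ | m ≤ Z.2 + s * Z.1 ∧ (Z.2 + s * Z.1 = m → Z.1 = c)} := by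
        rintro Y ⟨hY1, hY2⟩ Z ⟨hZ1, hZ2⟩ a b ha hb hab
        simp only [Set.mem_ofPred_eq, Prod.fst_add, Prod.snd_add, Prod.smul_fst, Prod.smul_snd,
          smul_eq_mul]
        have e : a * Y.2 + b * Z.2 + s * (a * Y.1 + b * Z.1) - m =
            a * (Y.2 + s * Y.1 - m) + b * (Z.2 + s * Z.1 - m) := by
          linear_combination m * hab
        have e1 := mul_nonneg ha (sub_nonneg.2 hY1)
        have e2 := mul_nonneg hb (sub_nonneg.2 hZ1)
        refine ⟨by linarith, fun heq => ?_⟩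
        have z1 : a * (Y.2 + s * Y.1 - m) = 0 := by linarith
        have z2 : b * (Z.2 + s * Z.1 - m) = 0 := by linarith
        have y1 : a * Y.1 = a * c := by
          rcases mul_eq_zero.1 z1 with h | h
          · simp [h]
          · rw [hY2 (by linarith)]
        have y2 : b * Z.1 = b * c := by
          rcases mul_eq_zero.1 z2 with h | h
          · simp [h]
          · rw [hZ2 (by linarith)]
        rw [y1, y2, ← add_mul, hab, one_mul]
      have hsub : newtonRegion p x ⊆
          {Z : ℝ × ℝ | m ≤ Z.2 + s * Z.1 ∧ (Z.2 + s * Z.1 = m → Z.1 = c)} := by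
        refine convexHull_min ?_ hconv
        rintro Z ⟨i, hi, hZ1, hZ2⟩
        have := hmin' i hi
        simp only [Set.mem_ofPred_eq, hZ1]
        refine ⟨by linarith, fun heq => ?_⟩
        rw [hc i hi (by linarith)]
      have hP1 := (hsub hP).2 hm.symm
      have hQ1 := (hsub hQ).2 (by rw [hm]; linarith)
      rw [hP1, hQ1] at hPQ
      exact lt_irrefl _ hPQ
    refine ⟨i, j, hij, hi, hj, le_antisymm ?_ ?_, fun n => ?_⟩
    · rw [size_le_size_iff hi hj]; linarith
    · rw [size_le_size_iff hj hi]; linarith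
    · by_cases hn : x n = 0
      · simpa [size, hn] using size_nonneg (p := p) s x i
      · rw [size_le_size_iff hn hi, hvi]
        exact hmin' n hn
  · rintro ⟨hs, i, j, hij, hi, hj, heq, hmax⟩
    have h1 := (size_le_size_iff hi hj).1 heq.le
    have h2 := (size_le_size_iff hj hi).1 heq.ge
    refine ⟨hs, _, gen i hi, _, gen j hj, by simpa using hij, ?_, fun Z hZ => ?_⟩
    · simp only; linarith
    · have hconv : Convex ℝ {Z : ℝ × ℝ | vp p (x i) + s * i ≤ s * Z.1 + Z.2} := by
        refine convex_halfSpace_ge (f := fun Z : ℝ × ℝ => s * Z.1 + Z.2) ⟨?_, ?_⟩ _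
        · intro Y Z; simp; ring
        · intro a Z; simp; ring
      have hsub : newtonRegion p x ⊆ {Z : ℝ × ℝ | vp p (x i) + s * i ≤ s * Z.1 + Z.2} := by
        refine convexHull_min ?_ hconv
        rintro Z ⟨n, hn, hZ1, hZ2⟩
        have := (size_le_size_iff hn hi).1 (hmax n)
        simp only [Set.mem_ofPred_eq, hZ1]
        linarith
      have := hsub hZ
      simp only [Set.mem_ofPred_eq] at this
      simp only
      linarith

lemma isSlope_iff_of_dom {x : ℚ → E} {s : ℝ} {a b : ℚ} (ha : Dom p 1 s x a)
    (hb : Dom p (-1) s x b) : IsSlope p x s ↔ 0 < s ∧ a ≠ b := by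
  rw [isSlope_iff]
  refine and_congr_right fun _ => ⟨?_, fun hab => ?_⟩
  · rintro ⟨i, j, hij, hi, hj, heq, hmax⟩ rfl
    have h1 : a ≤ i := by
      by_contra! h
      exact absurd ((ha.2 i).2 (by linarith)) (hmax a).not_gt
    have h2 : j ≤ a := by
      by_contra! h
      exact absurd ((hb.2 j).2 (by linarith)) (heq ▸ hmax a).not_gt
    linarith
  · refine ⟨a, b, lt_of_le_of_ne ?_ hab, ha.1, hb.1, le_antisymm (hb.2 a).1 (ha.2 b).1,
      fun n => (ha.2 n).1⟩
    by_contra! h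
    exact absurd ((ha.2 b).2 (by linarith)) (hb.2 a).1.not_gt

end Dominant

/-! ### Consequences of the discreteness of the value group. -/

section Discrete

/-- The value group of `E` is generated by `q > 1`. -/
def DiscreteNorm (E : Type*) [NormedField E] (q : ℝ) : Prop :=
  1 < q ∧ ∀ a : E, a ≠ 0 → ∃ k : ℤ, ‖a‖ = q ^ k

variable {E : Type*} [NormedField E] [IsUltrametricDist E] {p : ℕ} [hpr : Fact p.Prime] {q : ℝ}

lemma DiscreteNorm.le_norm (hq : DiscreteNorm E q) {a : E} (h : 1 < ‖a‖) : q ≤ ‖a‖ := by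
  obtain ⟨k, hk⟩ := hq.2 a (norm_pos_iff.1 (zero_lt_one.trans h))
  rw [hk] at h ⊢
  have h1 : 0 < k := (one_lt_zpow_iff_right₀ hq.1).1 h
  simpa using zpow_le_zpow_right₀ hq.1.le (show (1 : ℤ) ≤ k by lia)

lemma DiscreteNorm.finite_values (hq : DiscreteNorm E q) {c C : ℝ} (hc : 0 < c) :
    {v : ℝ | c ≤ v ∧ v ≤ C ∧ ∃ a : E, ‖a‖ = v}.Finite := by
  obtain ⟨N, hN⟩ := pow_unbounded_of_one_lt C hq.1
  obtain ⟨M, hM⟩ := pow_unbounded_of_one_lt c⁻¹ hq.1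
  refine ((Set.finite_Icc (-(M : ℤ)) N).image fun k : ℤ => q ^ k).subset ?_
  rintro v ⟨h1, h2, a, rfl⟩
  obtain ⟨k, hk⟩ := hq.2 a (norm_pos_iff.1 (hc.trans_le h1))
  refine ⟨k, ⟨?_, ?_⟩, hk.symm⟩
  · by_contra! h
    have h3 : q ^ k ≤ q ^ (-(M : ℤ)) := zpow_le_zpow_right₀ hq.1.le h.le
    rw [zpow_neg, zpow_natCast] at h3
    have h4 : (q ^ M)⁻¹ < c := inv_lt_of_inv_lt₀ hc hM
    linarith
  · have h3 : q ^ k < q ^ (N : ℤ) := by rw [zpow_natCast, ← hk]; linarith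
    exact ((zpow_lt_zpow_iff_right₀ hq.1).1 h3).le

/-- Terms of size at least c have exponents bounded below by well-ordering and above because w_{r'}
is finite for some r' < r. Their norms thus take finitely many values, and for a given norm the
least exponent gives the largest size, as r > 0. Questions about maximal sizes so become finite. -/
lemma finite_candidates (hq : DiscreteNorm E q) {r r' : ℝ} (hr : 0 < r) (hrr : r' < r)
    {x : ℚ → E} (hx : x ∈ gaussSet p E r) (hx' : x ∈ gaussSet p E r') {c : ℝ} (hc : 0 < c) :
    ∃ F : Set ℚ, F.Finite ∧ (∀ n ∈ F, x n ≠ 0) ∧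
      ∀ n, c ≤ size p r x n → ∃ m ∈ F, m ≤ n ∧ ‖x m‖ = ‖x n‖ := by
  obtain ⟨⟨C', hC'⟩, -⟩ := hx'
  obtain ⟨⟨C, hC⟩, hwf⟩ := hx
  -- Halving c makes the strict superlevel set contain every exponent of size at least c.
  have hX := hwf (c / 2) (by positivity)
  set X := {n | c / 2 < size p r x n} with hXdef
  rcases X.eq_empty_or_nonempty with he | hne
  · refine ⟨∅, Set.finite_empty, by simp, fun n hn => ?_⟩
    have : n ∈ X := by rw [hXdef, Set.mem_ofPred_eq]; linarith
    simp [he] at this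
  -- From size_r = size_{r'} · p^(-(r - r')n), exponents beyond this bound have size at most c / 2.
  obtain ⟨M, hM⟩ : ∃ M : ℚ, ∀ n ∈ X, n ≤ M := by
    obtain ⟨N, hN⟩ := exists_nat_gt (Real.logb p (2 * (C' + 1) / c) / (r - r'))
    refine ⟨N, fun n hn => ?_⟩
    by_contra! hlt
    have hlt' : (N : ℝ) < (n : ℝ) := by exact_mod_cast hlt
    have h1 : size p r x n = size p r' x n * (p : ℝ) ^ (-((r - r') * n)) := by
      simp only [size, weight, mul_assoc]
      rw [← Real.rpow_add p_pos]; ring_nf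
    have h2 : (p : ℝ) ^ (-((r - r') * n)) ≤ c / (2 * (C' + 1)) := by
      have hC0 := hC'.nonneg
      have h3 : c / (2 * (C' + 1)) = (p : ℝ) ^ (-(Real.logb p (2 * (C' + 1) / c))) := by
        rw [Real.rpow_neg p_pos.le, Real.rpow_logb p_pos one_lt_p.ne' (by positivity), inv_div]
      rw [h3]
      refine Real.rpow_le_rpow_of_exponent_le one_lt_p.le ?_
      rw [div_lt_iff₀ (by linarith)] at hN
      nlinarith
    have hC0 := hC'.nonneg
    have h4 : size p r x n ≤ (C' + 1) * (c / (2 * (C' + 1))) := by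
      rw [h1]
      exact mul_le_mul ((hC' n).trans (by linarith)) h2
        (Real.rpow_nonneg p_pos.le _) (by linarith)
    have h5 : (C' + 1) * (c / (2 * (C' + 1))) = c / 2 := by field_simp
    rw [hXdef, Set.mem_ofPred_eq] at hn
    linarith
  set n0 := hX.min hne with hn0
  have hn0le : ∀ n ∈ X, n0 ≤ n := fun n hn => hX.min_le hne hn
  set V := {v : ℝ | c / 2 * (weight p r n0)⁻¹ ≤ v ∧ v ≤ C * (weight p r M)⁻¹ ∧ ∃ a : E, ‖a‖ = v}
    with hV
  have hw0 := weight_pos (p := p) r n0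
  have hwM := weight_pos (p := p) r M
  have hVfin : V.Finite := hq.finite_values (by positivity)
  have hXv : ∀ v : ℝ, (X ∩ {n | ‖x n‖ = v}).IsWF := fun v => hX.mono Set.inter_subset_left
  classical
  -- One exponent per possible norm, the least one in `X`. The default `n0` also lies in `X`, so its
  -- coefficient is nonzero.
  set F : Set ℚ := (fun v => if h : (X ∩ {n | ‖x n‖ = v}).Nonempty then (hXv v).min h else n0) '' V
    with hF
  refine ⟨F, hVfin.image _, ?_, fun n hn => ?_⟩
  · have hXne : ∀ n ∈ X, x n ≠ 0 := fun n hn h0 => by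
      rw [hXdef, Set.mem_ofPred_eq] at hn
      simp [size, h0] at hn
      linarith
    rintro _ ⟨v, -, rfl⟩
    simp only
    split_ifs with h
    · exact hXne _ ((hXv v).min_mem h).1
    · exact hXne _ (hX.min_mem hne)
  · have hnX : n ∈ X := by rw [hXdef, Set.mem_ofPred_eq]; linarith
    have hvne : (X ∩ {m | ‖x m‖ = ‖x n‖}).Nonempty := ⟨n, hnX, rfl⟩
    refine ⟨(hXv ‖x n‖).min hvne, ⟨‖x n‖, ⟨?_, ?_, x n, rfl⟩, by simp [hvne]⟩,
      (hXv _).min_le hvne ⟨hnX, rfl⟩, ((hXv _).min_mem hvne).2⟩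
    · rw [← div_eq_mul_inv, div_le_iff₀ hw0]
      have h1 : weight p r n ≤ weight p r n0 :=
        weight_le_weight (mul_le_mul_of_nonneg_left (by exact_mod_cast hn0le n hnX) hr.le)
      have h2 : c / 2 < ‖x n‖ * weight p r n := hnX
      have h3 := mul_le_mul_of_nonneg_left h1 (norm_nonneg (x n))
      linarith
    · rw [← div_eq_mul_inv, le_div_iff₀ hwM]
      have h1 : weight p r M ≤ weight p r n :=
        weight_le_weight (mul_le_mul_of_nonneg_left (by exact_mod_cast hM n hnX) hr.le)
      have h3 := mul_le_mul_of_nonneg_left h1 (norm_nonneg (x n))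
      exact h3.trans (hC n)

lemma exists_dom (hq : DiscreteNorm E q) {r r' : ℝ} (hr : 0 < r) (hrr : r' < r)
    {x : ℚ → E} (hx : x ∈ gaussSet p E r) (hx' : x ∈ gaussSet p E r') (hx0 : x ≠ 0) :
    (∃ a, Dom p 1 r x a) ∧ ∃ b, Dom p (-1) r x b := by
  obtain ⟨n0, hn0⟩ := Function.ne_iff.1 hx0
  have hs0 := size_pos (p := p) (r := r) hn0
  obtain ⟨F, hF, hF0, hFm⟩ := finite_candidates hq hr hrr hx hx' hs0
  have hsz : ∀ n m : ℚ, m ≤ n → ‖x m‖ = ‖x n‖ → size p r x n ≤ size p r x m := by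
    intro n m hmn he
    rw [size, size, he]
    exact mul_le_mul_of_nonneg_left (weight_le_weight
      (mul_le_mul_of_nonneg_left (by exact_mod_cast hmn) hr.le)) (norm_nonneg _)
  have hFne : hF.toFinset.Nonempty := by
    obtain ⟨m, hm, -⟩ := hFm n0 le_rfl
    exact ⟨m, by simpa using hm⟩
  obtain ⟨j, hj, hjmax⟩ := hF.toFinset.exists_max_image (size p r x) hFne
  have hmax : ∀ n, size p r x n ≤ size p r x j := fun n => by
    rcases le_total (size p r x n0) (size p r x n) with h | h
    · obtain ⟨m, hm, hmn, he⟩ := hFm n h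
      exact (hsz n m hmn he).trans (hjmax m (by simpa using hm))
    · obtain ⟨m, hm, hmn, he⟩ := hFm n0 le_rfl
      exact h.trans ((hsz n0 m hmn he).trans (hjmax m (by simpa using hm)))
  have hj0 : x j ≠ 0 := hF0 j (by simpa using hj)
  -- An exponent of maximal size must be its own candidate: a smaller exponent with the same norm
  -- would have strictly larger size.
  have hmem : ∀ n, size p r x n = size p r x j → n ∈ F := fun n hn => by
    obtain ⟨m, hm, hmn, he⟩ := hFm n (by rw [hn]; exact hmax n0)
    rcases hmn.eq_or_lt with h | h
    · rwa [← h]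
    · have h1 : size p r x n < size p r x m := by
        rw [size, size, he]
        refine mul_lt_mul_of_pos_left (weight_lt_weight
          (mul_lt_mul_of_pos_left (by exact_mod_cast h) hr)) ?_
        rw [← he]; exact norm_pos_iff.2 (hF0 m hm)
      exact absurd (hmax m) (by rw [← hn]; exact h1.not_ge)
  have hAfin : {n | size p r x n = size p r x j}.Finite := hF.subset hmem
  have hAne : hAfin.toFinset.Nonempty := ⟨j, by simp⟩
  have hne : ∀ n, size p r x n = size p r x j → x n ≠ 0 := fun n hn => hF0 n (hmem n hn)
  constructor
  · refine ⟨hAfin.toFinset.min' hAne, ?_⟩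
    have hm := hAfin.toFinset.min'_mem hAne
    simp only [Set.Finite.mem_toFinset, Set.mem_ofPred_eq] at hm
    refine ⟨hne _ hm, fun n => ⟨hm.symm ▸ hmax n, fun hn => ?_⟩⟩
    rw [hm]
    refine lt_of_le_of_ne (hmax n) fun h => ?_
    have := hAfin.toFinset.min'_le n (by simpa using h)
    linarith
  · refine ⟨hAfin.toFinset.max' hAne, ?_⟩
    have hm := hAfin.toFinset.max'_mem hAne
    simp only [Set.Finite.mem_toFinset, Set.mem_ofPred_eq] at hm
    refine ⟨hne _ hm, fun n => ⟨hm.symm ▸ hmax n, fun hn => ?_⟩⟩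
    rw [hm]
    refine lt_of_le_of_ne (hmax n) fun h => ?_
    have := hAfin.toFinset.le_max' n (by simpa using h)
    linarith

/-- The supremum of the sizes is attained, so a strict termwise bound leaves a gap. The gap supplies
the contraction ratios. -/
lemma exists_isBd_lt (hq : DiscreteNorm E q) {r r' : ℝ} (hr : 0 < r) (hrr : r' < r)
    {x : ℚ → E} (hx : x ∈ gaussSet p E r) (hx' : x ∈ gaussSet p E r') {c : ℝ} (hc : 0 < c)
    (h : ∀ n, size p r x n < c) : ∃ d, d < c ∧ IsBd p r d x := by
  by_cases h0 : x = 0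
  · exact ⟨0, hc, h0 ▸ isBd_zero r⟩
  · obtain ⟨⟨a, ha⟩, -⟩ := exists_dom hq hr hrr hx hx' h0
    exact ⟨size p r x a, h a, fun n => (ha.2 n).1⟩

/-- If the terms of positive exponent are small for `w_s`, they are so for `w_r`, with
some `r < s`. -/
lemma exists_lt_forall_size_lt (hq : DiscreteNorm E q) {s s' : ℝ} (hs' : 0 ≤ s') (hs : s' < s)
    {x : ℚ → E} (hx : ∀ r, s' ≤ r → x ∈ gaussSet p E r) {c : ℝ} (hc : 0 < c)
    (h : ∀ n, 0 < n → size p s x n < c) :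
    ∃ r, s' < r ∧ r < s ∧ ∀ n, 0 < n → size p r x n < c := by
  classical
  set u : ℚ → E := fun n => if 0 < n then x n else 0 with hu
  have hule : ∀ r n, size p r u n ≤ 1 * size p r x n := fun r n => by
    by_cases hn : 0 < n
    · simp [size, hu, hn]
    · simpa [size, hu, hn] using size_nonneg (p := p) r x n
  have hum : ∀ r, s' ≤ r → u ∈ gaussSet p E r := fun r hr =>
    mem_gaussSet_of_size_le one_pos (hx r hr) (hule r)
  -- Candidates are taken at the midpoint, where finiteness of w at the smaller radius s' is
  -- available. For r > t and positive exponents, a term already below c at t stays so, and any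
  -- other is controlled by a candidate of equal norm.
  set t := (s + s') / 2 with ht
  have ht1 : s' < t := by rw [ht]; linarith
  have ht2 : t < s := by rw [ht]; linarith
  obtain ⟨F, hF, hF0, hFm⟩ := finite_candidates hq (hs'.trans_lt ht1) ht1 (hum t ht1.le)
    (hum s' le_rfl) hc
  have hpos : ∀ m ∈ F, 0 < m := fun m hm => by
    by_contra hcon
    exact hF0 m hm (by simp [hu, hcon])
  have hcont : ∀ m : ℚ, Continuous fun r : ℝ => size p r x m := fun m => by
    unfold size weight
    refine continuous_const.mul (Real.continuous_const_rpow p_pos.ne' |>.comp ?_)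
    fun_prop
  -- Only finitely many candidates matter, and each size is continuous in r.
  have hev : ∀ᶠ r in 𝓝[<] s, ∀ m ∈ F, size p r x m < c := by
    rw [Filter.eventually_all_finite hF]
    intro m hm
    exact (((hcont m).tendsto s).eventually (gt_mem_nhds (h m (hpos m hm)))).filter_mono
      nhdsWithin_le_nhds
  have hev2 : ∀ᶠ r in 𝓝[<] s, t < r :=
    (lt_mem_nhds ht2).filter_mono nhdsWithin_le_nhds
  have hev3 : ∀ᶠ r in 𝓝[<] s, r < s := eventually_mem_nhdsWithin
  obtain ⟨r, hr1, hr2, hr3⟩ := (hev.and (hev2.and hev3)).exists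
  refine ⟨r, ht1.trans hr2, hr3, fun n hn => ?_⟩
  have hn' : (0 : ℝ) < n := by exact_mod_cast hn
  have hr0 : 0 < r := by linarith
  rcases lt_or_ge (size p t u n) c with h1 | h1
  · have h2 : size p t u n = size p t x n := by simp [size, hu, hn]
    rw [h2] at h1
    refine lt_of_le_of_lt ?_ h1
    exact mul_le_mul_of_nonneg_left (weight_le_weight
      (mul_le_mul_of_nonneg_right hr2.le hn'.le)) (norm_nonneg _)
  · obtain ⟨m, hm, hmn, he⟩ := hFm n h1
    have he' : ‖x m‖ = ‖x n‖ := by simpa [hu, hn, hpos m hm] using he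
    refine lt_of_le_of_lt ?_ (hr1 m hm)
    rw [size, size, he']
    exact mul_le_mul_of_nonneg_left (weight_le_weight
      (mul_le_mul_of_nonneg_left (by exact_mod_cast hmn) hr0.le)) (norm_nonneg _)

end Discrete

/-! ### Completeness and contraction in the Gauss rings. -/

section Limits

variable {E : Type*} [NormedField E] [IsUltrametricDist E] [CompleteSpace E]
  {p : ℕ} [hpr : Fact p.Prime]

lemma exists_limit {r K θ : ℝ} (hθ0 : 0 ≤ θ) (hθ : θ < 1) (S : ℕ → ℚ → E)
    (hS : ∀ k, IsBd p r (K * θ ^ k) (S (k + 1) - S k)) :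
    ∃ x : ℚ → E, ∀ k, IsBd p r (K * θ ^ k) (x - S k) := by
  have hK : 0 ≤ K := by simpa using (hS 0).nonneg
  have hmono : ∀ k l, IsBd p r (K * θ ^ k) (S (k + l) - S k) := by
    intro k l
    induction l with
    | zero => simpa using (isBd_zero r).mono (by positivity)
    | succ l ih =>
      have h1 : IsBd p r (K * θ ^ k) (S (k + l + 1) - S (k + l)) :=
        (hS (k + l)).mono (mul_le_mul_of_nonneg_left
          (pow_le_pow_of_le_one hθ0 hθ.le (Nat.le_add_right k l)) hK)
      have := h1.add ih
      rwa [sub_add_sub_cancel] at this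
  have hlim0 : Filter.Tendsto (fun k => K * θ ^ k) Filter.atTop (𝓝 0) := by
    simpa using (tendsto_pow_atTop_nhds_zero_of_lt_one hθ0 hθ).const_mul K
  have hcauchy : ∀ n, CauchySeq fun k => S k n := by
    intro n
    have hw := weight_pos (p := p) r n
    refine cauchySeq_of_le_tendsto_0' (fun k => K * θ ^ k * (weight p r n)⁻¹) ?_ ?_
    · intro k m hkm
      obtain ⟨l, rfl⟩ := Nat.exists_eq_add_of_le hkm
      have := hmono k l n
      rw [dist_comm, dist_eq_norm, ← div_eq_mul_inv, le_div_iff₀ hw]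
      exact this
    · simpa using hlim0.mul_const (weight p r n)⁻¹
  choose x hx using fun n => cauchySeq_tendsto_of_complete (hcauchy n)
  refine ⟨x, fun k n => ?_⟩
  have h1 : Filter.Tendsto (fun l => size p r (S (k + l) - S k) n) Filter.atTop
      (𝓝 (size p r (x - S k) n)) := by
    have h2 : Filter.Tendsto (fun l => S (k + l) n) Filter.atTop (𝓝 (x n)) := by
      have := (Filter.tendsto_add_atTop_iff_nat k).2 (hx n)
      simpa [add_comm] using this
    exact ((h2.sub_const (S k n)).norm).mul_const _
  exact le_of_tendsto' h1 fun l => hmono k l n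

/-- The set `D` is closed in the ring `gaussSet p E r`. -/
def ClosedAt (p : ℕ) (r : ℝ) (D : Set (ℚ → E)) : Prop :=
  ∀ x ∈ gaussSet p E r, (∀ ε : ℝ, 0 < ε → ∃ y ∈ D, y ∈ gaussSet p E r ∧ IsBd p r ε (x - y)) →
    x ∈ D

lemma ClosedAt.inter {r : ℝ} {C D : Set (ℚ → E)} (hC : ClosedAt p r C) (hD : ClosedAt p r D) :
    ClosedAt p r (C ∩ D) := fun x hx h =>
  ⟨hC x hx fun ε hε => by
    obtain ⟨y, hy, h1, h2⟩ := h ε hε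
    exact ⟨y, hy.1, h1, h2⟩,
  hD x hx fun ε hε => by
    obtain ⟨y, hy, h1, h2⟩ := h ε hε
    exact ⟨y, hy.2, h1, h2⟩⟩

lemma closedAt_vanish (r : ℝ) (Z : ℚ → Prop) :
    ClosedAt p r {x : ℚ → E | ∀ n, Z n → x n = 0} := by
  intro x _ h n hn
  by_contra hxn
  have hs := size_pos (p := p) (r := r) hxn
  obtain ⟨y, hy, -, hb⟩ := h (size p r x n / 2) (by positivity)
  have h1 := hb n
  have h2 : size p r (x - y) n = size p r x n := by simp [size, hy n hn]
  rw [h2] at h1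
  linarith

/-- Banach iteration starting at c. The closed set D is carried along so that solutions keep extra
properties, such as membership in a stable family or vanishing of prescribed coefficients. -/
lemma exists_fixed {r θ : ℝ} (hθ0 : 0 ≤ θ) (hθ : θ < 1) {D : Set (ℚ → E)} (hD : ClosedAt p r D)
    (L : (ℚ → E) → ℚ → E)
    (hLsub : ∀ x ∈ gaussSet p E r, ∀ y ∈ gaussSet p E r, L x - L y = L (x - y))
    (hLmem : ∀ x ∈ gaussSet p E r, L x ∈ gaussSet p E r)
    (hL : ∀ x, ∀ d, IsBd p r d x → IsBd p r (θ * d) (L x))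
    {c : ℚ → E} (hc : c ∈ gaussSet p E r)
    (hDc : ∀ x ∈ D, x ∈ gaussSet p E r → c + L x ∈ D) (hcD : c ∈ D) :
    ∃ x ∈ D, x ∈ gaussSet p E r ∧ x = c + L x := by
  obtain ⟨K, hK⟩ := hc.1
  have hK0 := hK.nonneg
  set S : ℕ → ℚ → E := fun k => Nat.rec c (fun _ x => c + L x) k with hSdef
  have hS1 : ∀ k, S (k + 1) = c + L (S k) := fun k => rfl
  have hSm : ∀ k, S k ∈ gaussSet p E r := by
    intro k
    induction k with
    | zero => exact hc
    | succ k ih => rw [hS1]; exact add_mem_gaussSet hc (hLmem _ ih)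
  have hSD : ∀ k, S k ∈ D := by
    intro k
    induction k with
    | zero => exact hcD
    | succ k ih => rw [hS1]; exact hDc _ ih (hSm k)
  have hSb : ∀ k, IsBd p r (K * θ ^ k) (S (k + 1) - S k) := by
    intro k
    induction k with
    | zero =>
      have : S (0 + 1) - S 0 = L c := by rw [hS1 0]; simp [hSdef]
      rw [this, pow_zero, mul_one]
      exact (hL _ _ hK).mono (by nlinarith)
    | succ k ih =>
      have : S (k + 1 + 1) - S (k + 1) = L (S (k + 1) - S k) := by
        calc S (k + 1 + 1) - S (k + 1) = (c + L (S (k + 1))) - (c + L (S k)) := rfl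
          _ = L (S (k + 1)) - L (S k) := by abel
          _ = L (S (k + 1) - S k) := hLsub _ (hSm (k + 1)) _ (hSm k)
      rw [this]
      exact (hL _ _ ih).mono (by rw [pow_succ]; linarith)
  obtain ⟨x, hx⟩ := exists_limit hθ0 hθ S hSb
  have hlim0 : Filter.Tendsto (fun k => K * θ ^ k) Filter.atTop (𝓝 0) := by
    simpa using (tendsto_pow_atTop_nhds_zero_of_lt_one hθ0 hθ).const_mul K
  have hsmall : ∀ ε : ℝ, 0 < ε → ∃ k, K * θ ^ k ≤ ε := fun ε hε =>
    ((hlim0.eventually (gt_mem_nhds hε)).exists).imp fun k hk => hk.le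
  have hxm : x ∈ gaussSet p E r := mem_gaussSet_of_approx fun ε hε => by
    obtain ⟨k, hk⟩ := hsmall ε hε
    exact ⟨S k, hSm k, (hx k).mono hk⟩
  refine ⟨x, hD x hxm fun ε hε => ?_, hxm, ?_⟩
  · obtain ⟨k, hk⟩ := hsmall ε hε
    exact ⟨S k, hSD k, hSm k, (hx k).mono hk⟩
  · rw [← sub_eq_zero]
    refine eq_zero_of_forall_isBd (p := p) (r := r) fun ε hε => ?_
    obtain ⟨k, hk⟩ := hsmall ε hε
    have h1 : x - (c + L x) = (x - S (k + 1)) - (L (x - S k)) := by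
      rw [← hLsub _ hxm _ (hSm k), hS1]; abel
    rw [h1]
    refine ((hx (k + 1)).mono ?_).sub ((hL _ _ (hx k)).mono ?_)
    · refine le_trans ?_ hk
      rw [pow_succ]
      have : 0 ≤ K * θ ^ k := by positivity
      nlinarith
    · have : 0 ≤ K * θ ^ k := by positivity
      nlinarith

end Limits

/-! ### Stable families, flat series and units. -/

section Families

variable {E : Type*} [NormedField E] [IsUltrametricDist E] [CompleteSpace E]
  {p : ℕ} [hpr : Fact p.Prime]

/-- The part of the series `x` with exponents less than `j`. -/
def trunc (j : ℚ) (x : ℚ → E) : ℚ → E := fun i => if i < j then x i else 0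

lemma size_trunc_le (r : ℝ) (j : ℚ) (x : ℚ → E) (n : ℚ) :
    size p r (trunc j x) n ≤ size p r x n := by
  by_cases h : n < j
  · simp [size, trunc, h]
  · simpa [size, trunc, h] using size_nonneg (p := p) r x n

lemma IsBd.trunc {r c : ℝ} {x : ℚ → E} (h : IsBd p r c x) (j : ℚ) : IsBd p r c (trunc j x) :=
  fun n => (size_trunc_le r j x n).trans (h n)

lemma trunc_mem_gaussSet {r : ℝ} {x : ℚ → E} (hx : x ∈ gaussSet p E r) (j : ℚ) :
    trunc j x ∈ gaussSet p E r :=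
  mem_gaussSet_of_size_le one_pos hx fun n => by
    rw [one_mul]; exact size_trunc_le r j x n

lemma trunc_sub (j : ℚ) (x y : ℚ → E) : trunc j (x - y) = trunc j x - trunc j y := by
  funext n; by_cases h : n < j <;> simp [trunc, h]

lemma trunc_add (j : ℚ) (x y : ℚ → E) : trunc j (x + y) = trunc j x + trunc j y := by
  funext n; by_cases h : n < j <;> simp [trunc, h]

/-- A family of series which is stable under the operations used in the construction of
slope factorizations. -/
structure IsStable (p : ℕ) (C : Set (ℚ → E)) : Prop where
  one_mem : seriesOne ∈ C
  add_mem : ∀ x ∈ C, ∀ y ∈ C, x + y ∈ C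
  smul_mem : ∀ a : E, ∀ x ∈ C, a • x ∈ C
  tPow_mem : ∀ x ∈ C, ∀ j : ℚ, x j ≠ 0 → tPow j ∈ C ∧ tPow (-j) ∈ C
  trunc_mem : ∀ x ∈ C, ∀ j : ℚ, trunc j x ∈ C
  mul_mem : ∀ r : ℝ, 0 < r → ∀ x ∈ C, ∀ y ∈ C, x ∈ gaussSet p E r → y ∈ gaussSet p E r →
    seriesMul x y ∈ C
  closed : ∀ r : ℝ, 0 < r → ClosedAt p r C

lemma IsStable.neg_mem {C : Set (ℚ → E)} (hC : IsStable p C) {x : ℚ → E} (hx : x ∈ C) :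
    -x ∈ C := by
  simpa using hC.smul_mem (-1) x hx

lemma IsStable.sub_mem {C : Set (ℚ → E)} (hC : IsStable p C) {x y : ℚ → E} (hx : x ∈ C)
    (hy : y ∈ C) : x - y ∈ C := by
  rw [sub_eq_add_neg]; exact hC.add_mem _ hx _ (hC.neg_mem hy)

lemma one_mem_gaussSet (r : ℝ) : (seriesOne : ℚ → E) ∈ gaussSet p E r := single_mem_gaussSet r 0 1

lemma seriesMul_one (x : ℚ → E) : seriesMul x seriesOne = x := by
  rw [seriesMul_comm, seriesOne_seriesMul]

lemma isBd_one (r : ℝ) : IsBd p r 1 (seriesOne : ℚ → E) := fun n => by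
  classical
  by_cases h : n = 0
  · simp [size, seriesOne, tPow, h]
  · simp [size, seriesOne, tPow, h]

lemma seriesMul_sub {r : ℝ} {x y z : ℚ → E} (hx : x ∈ gaussSet p E r) (hy : y ∈ gaussSet p E r)
    (hz : z ∈ gaussSet p E r) : seriesMul x (y - z) = seriesMul x y - seriesMul x z := by
  have := mul_sub (⟨x, hx⟩ : GaussRing p E r) ⟨y, hy⟩ ⟨z, hz⟩
  exact congrArg Subtype.val this

lemma seriesMul_smul (a : E) (x y : ℚ → E) : seriesMul x (a • y) = a • seriesMul x y := by
  rw [seriesMul_comm, smul_seriesMul, seriesMul_comm]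

/-- The Neumann series of 1 + u, obtained as the fixed point of x ↦ 1 - ux. -/
lemma exists_inverse {r θ : ℝ} (hθ : θ < 1) {D : Set (ℚ → E)} (hD : ClosedAt p r D)
    {u : ℚ → E} (hu : u ∈ gaussSet p E r) (hb : IsBd p r θ u) (h1 : seriesOne ∈ D)
    (hDu : ∀ x ∈ D, x ∈ gaussSet p E r → seriesOne - seriesMul u x ∈ D) :
    ∃ x ∈ D, x ∈ gaussSet p E r ∧ x = seriesOne - seriesMul u x ∧
      seriesMul (seriesOne + u) x = seriesOne := by
  obtain ⟨x, hxD, hx, he⟩ := exists_fixed hb.nonneg hθ hD (fun x => -seriesMul u x)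
    (fun x hx y hy => by rw [seriesMul_sub hu hx hy]; abel)
    (fun x hx => neg_mem_gaussSet (mul_mem_gaussSet hu hx))
    (fun x d hd => (hb.mul hd).neg) (one_mem_gaussSet r)
    (fun x hx hxg => by simpa [sub_eq_add_neg] using hDu x hx hxg) h1
  rw [← sub_eq_add_neg] at he
  refine ⟨x, hxD, hx, he, ?_⟩
  have h2 := seriesMul_add hx (one_mem_gaussSet r) hu
  rw [seriesMul_comm, h2, seriesMul_one, seriesMul_comm x u]
  nth_rewrite 1 [he]
  abel

lemma seriesMul_eq_zero_of_le {a b : ℚ} {x y : ℚ → E} (hx : ∀ n, n < a → x n = 0)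
    (hy : ∀ n, n < b → y n = 0) {n : ℚ} (hn : n < a + b) : seriesMul x y n = 0 := by
  unfold seriesMul
  convert tsum_zero with i
  rcases lt_or_ge i a with h | h
  · rw [hx i h, zero_mul]
  · rw [hy (n - i) (by linarith), mul_zero]

lemma seriesMul_zero_coeff {x y : ℚ → E} (hx : ∀ n, n < 0 → x n = 0)
    (hy : ∀ n, n < 0 → y n = 0) : seriesMul x y 0 = x 0 * y 0 := by
  unfold seriesMul
  rw [tsum_eq_single 0]
  · simp
  · intro i hi
    rcases lt_or_gt_of_ne hi with h | h
    · rw [hx i h, zero_mul]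
    · rw [hy (0 - i) (by linarith), mul_zero]

/-- The ring of the series in `C` with nonnegative exponents and finite norms `w_r`, `r > 0`. -/
def omega (p : ℕ) (C : Set (ℚ → E)) : Set (ℚ → E) :=
  {x | (∀ n, n < 0 → x n = 0) ∧ (∀ r : ℝ, 0 < r → x ∈ gaussSet p E r) ∧ x ∈ C}

variable {C : Set (ℚ → E)}

lemma mem_gaussSet_of_le_of_nonneg {r s : ℝ} (hrs : r ≤ s) {x : ℚ → E}
    (h0 : ∀ n, n < 0 → x n = 0) (hx : x ∈ gaussSet p E r) : x ∈ gaussSet p E s := by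
  refine mem_gaussSet_of_size_le one_pos hx fun n => ?_
  rcases lt_or_ge n 0 with h | h
  · simp [size, h0 n h]
  · rw [one_mul]
    exact mul_le_mul_of_nonneg_left (weight_le_weight
      (mul_le_mul_of_nonneg_right hrs (by exact_mod_cast h))) (norm_nonneg _)

lemma one_mem_omega (hC : IsStable p C) : seriesOne ∈ omega p C :=
  ⟨fun n hn => by simp [seriesOne, tPow, hn.ne], fun r _ => one_mem_gaussSet r, hC.one_mem⟩

lemma mul_mem_omega (hC : IsStable p C) {x y : ℚ → E} (hx : x ∈ omega p C) (hy : y ∈ omega p C) :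
    seriesMul x y ∈ omega p C :=
  ⟨fun n hn => seriesMul_eq_zero_of_le hx.1 hy.1 (by simpa using hn),
    fun r hr => mul_mem_gaussSet (hx.2.1 r hr) (hy.2.1 r hr),
    hC.mul_mem 1 one_pos x hx.2.2 y hy.2.2 (hx.2.1 1 one_pos) (hy.2.1 1 one_pos)⟩

lemma smul_mem_omega (hC : IsStable p C) {x : ℚ → E} (hx : x ∈ omega p C) (a : E) :
    a • x ∈ omega p C :=
  ⟨fun n hn => by simp [hx.1 n hn], fun r hr => smul_mem_gaussSet (hx.2.1 r hr) a,
    hC.smul_mem a x hx.2.2⟩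

lemma trunc_mem_omega (hC : IsStable p C) {x : ℚ → E} (hx : x ∈ omega p C) (j : ℚ) :
    trunc j x ∈ omega p C :=
  ⟨fun n hn => by simp [trunc, hx.1 n hn], fun r hr => trunc_mem_gaussSet (hx.2.1 r hr) j,
    hC.trunc_mem x hx.2.2 j⟩

lemma omega_mul_assoc {x y z : ℚ → E} (hx : x ∈ omega p C) (hy : y ∈ omega p C)
    (hz : z ∈ omega p C) : seriesMul (seriesMul x y) z = seriesMul x (seriesMul y z) :=
  seriesMul_assoc (hx.2.1 1 one_pos) (hy.2.1 1 one_pos) (hz.2.1 1 one_pos)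

/-- The series all of whose terms of positive exponent are smaller than the constant term, for
all the norms `w_s`. -/
def IsFlat (p : ℕ) (x : ℚ → E) : Prop := ∀ s : ℝ, 0 < s → Dom p 1 s x 0 ∧ Dom p (-1) s x 0

lemma dom_zero_of_size_lt {s : ℝ} {x : ℚ → E} (h0 : ∀ n, n < 0 → x n = 0) (hx : x 0 ≠ 0)
    (h : ∀ n, 0 < n → size p s x n < ‖x 0‖) : Dom p 1 s x 0 ∧ Dom p (-1) s x 0 := by
  have hs0 : size p s x 0 = ‖x 0‖ := by simp [size]
  have hneg : ∀ n, n < 0 → size p s x n < size p s x 0 := fun n hn => by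
    rw [hs0, size, h0 n hn, norm_zero, zero_mul]; exact norm_pos_iff.2 hx
  have hle : ∀ n, size p s x n ≤ size p s x 0 := fun n => by
    rcases lt_trichotomy n 0 with hn | rfl | hn
    · exact (hneg n hn).le
    · rfl
    · rw [hs0]; exact (h n hn).le
  exact ⟨⟨hx, fun n => ⟨hle n, fun hn => hneg n (by linarith)⟩⟩,
    ⟨hx, fun n => ⟨hle n, fun hn => by rw [hs0]; exact h n (by linarith)⟩⟩⟩

lemma isFlat_of_norm_le {x : ℚ → E} (h0 : ∀ n, n < 0 → x n = 0) (hx : x 0 ≠ 0)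
    (h : ∀ n, ‖x n‖ ≤ ‖x 0‖) : IsFlat p x := fun s hs => by
  refine dom_zero_of_size_lt h0 hx fun n hn => ?_
  have h1 : weight p s n < 1 := by
    rw [← weight_zero (p := p) s]
    exact weight_lt_weight (mul_lt_mul_of_pos_left (by exact_mod_cast hn) hs)
  have h2 := norm_pos_iff.2 hx
  have h3 := weight_pos (p := p) s n
  have h4 := h n
  unfold size
  nlinarith

lemma isFlat_one : IsFlat p (seriesOne : ℚ → E) :=
  isFlat_of_norm_le (fun n hn => by simp [seriesOne, tPow, hn.ne]) (by simp [seriesOne, tPow])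
    fun n => by
      classical
      by_cases h : n = 0
      · simp [h]
      · simp [seriesOne, tPow, h]

/-- Dominant exponents exist and add up, so those of one factor are the differences of those of the
product and of the other factor. -/
lemma dom_right_of_mul {q : ℝ} (hq : DiscreteNorm E q) {x y : ℚ → E} (hx : x ∈ omega p C)
    (hy : y ∈ omega p C) (hy0 : y ≠ 0) {s : ℝ} (hs : 0 < s) {a b c d : ℚ}
    (hxa : Dom p 1 s x a) (hxb : Dom p (-1) s x b) (hc : Dom p 1 s (seriesMul x y) c)
    (hd : Dom p (-1) s (seriesMul x y) d) :
    Dom p 1 s y (c - a) ∧ Dom p (-1) s y (d - b) := by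
  obtain ⟨⟨a', ha'⟩, b', hb'⟩ := exists_dom hq hs (half_lt_self hs) (hy.2.1 s hs)
    (hy.2.1 _ (half_pos hs)) hy0
  have h1 := (hxa.seriesMul one_ne_zero (hx.2.1 s hs) (hy.2.1 s hs) ha').eq one_ne_zero hc
  have h2 := (hxb.seriesMul (by norm_num) (hx.2.1 s hs) (hy.2.1 s hs) hb').eq (by norm_num) hd
  rw [← h1, ← h2]
  simpa using ⟨ha', hb'⟩

/-- After scaling, u = 1 + v with w_r(v) < 1 for every r > 0, because the maximal size is attained.
No ratio works uniformly in r, so an inverse is constructed at each radius and the inverses are then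
identified. -/
lemma exists_inverse_of_isFlat {q : ℝ} (hq : DiscreteNorm E q) (hC : IsStable p C) {u : ℚ → E}
    (hu : u ∈ omega p C) (hflat : IsFlat p u) :
    ∃ d ∈ omega p C, IsFlat p d ∧ seriesMul u d = seriesOne := by
  have hu0 : u 0 ≠ 0 := (hflat 1 one_pos).1.1
  set v : ℚ → E := (u 0)⁻¹ • u - seriesOne with hv
  have hvu : u = (u 0) • (seriesOne + v) := by
    rw [hv]; simp [smul_smul, hu0]
  have hv0 : ∀ n, n ≤ 0 → v n = 0 := fun n hn => by
    rcases hn.lt_or_eq with h | rfl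
    · simp [hv, hu.1 n h, seriesOne, tPow, h.ne]
    · simp [hv, hu0, seriesOne, tPow]
  have hvg : ∀ r : ℝ, 0 < r → v ∈ gaussSet p E r := fun r hr =>
    sub_mem_gaussSet (smul_mem_gaussSet (hu.2.1 r hr) _) (one_mem_gaussSet r)
  have hvC : v ∈ C := hC.sub_mem (hC.smul_mem _ _ hu.2.2) hC.one_mem
  have hvlt : ∀ r : ℝ, 0 < r → ∀ n, size p r v n < 1 := fun r hr n => by
    rcases le_or_gt n 0 with h | h
    · simp [size, hv0 n h]
    · have h1 : v n = (u 0)⁻¹ * u n := by simp [hv, seriesOne, tPow, h.ne']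
      have h2 := ((hflat r hr).2.2 n).2 (by linarith)
      rw [size, h1, norm_mul, norm_inv, mul_assoc, inv_mul_lt_iff₀ (norm_pos_iff.2 hu0), mul_one]
      simpa [size] using h2
  have hinv : ∀ r : ℝ, 0 < r → ∃ x ∈ C ∩ {x : ℚ → E | ∀ n, n < 0 → x n = 0},
      x ∈ gaussSet p E r ∧ seriesMul (seriesOne + v) x = seriesOne := fun r hr => by
    obtain ⟨θ, hθ, hb⟩ := exists_isBd_lt hq hr (half_lt_self hr) (hvg r hr)
      (hvg _ (half_pos hr)) one_pos (hvlt r hr)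
    obtain ⟨x, hxD, hx, -, he⟩ := exists_inverse hθ
      ((hC.closed r hr).inter (closedAt_vanish r fun n => n < 0)) (hvg r hr) hb
      ⟨hC.one_mem, (one_mem_omega hC).1⟩ (fun x hx hxg =>
        ⟨hC.sub_mem hC.one_mem (hC.mul_mem r hr v hvC x hx.1 (hvg r hr) hxg), fun n hn => by
          rw [Pi.sub_apply, (one_mem_omega hC).1 n hn, seriesMul_eq_zero_of_le
            (fun n hn => hv0 n hn.le) hx.2 (by simpa using hn), sub_zero]⟩)
    exact ⟨x, hxD, hx, he⟩
  obtain ⟨x, hxD, hx, he⟩ := hinv 1 one_pos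
  have h1v : ∀ r : ℝ, 0 < r → seriesOne + v ∈ gaussSet p E r := fun r hr =>
    add_mem_gaussSet (one_mem_gaussSet r) (hvg r hr)
  -- With exponents nonnegative, the inverses found at 1 and at r both live in the Gauss ring of
  -- radius max 1 r, where inverses are unique.
  have hall : ∀ r : ℝ, 0 < r → x ∈ gaussSet p E r := fun r hr => by
    obtain ⟨y, hyD, hy, hey⟩ := hinv r hr
    have hm : 0 < max 1 r := lt_max_of_lt_left one_pos
    have hx' := mem_gaussSet_of_le_of_nonneg (le_max_left 1 r) hxD.2 hx
    have hy' := mem_gaussSet_of_le_of_nonneg (le_max_right 1 r) hyD.2 hy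
    have e1 : (⟨_, h1v _ hm⟩ : GaussRing p E (max 1 r)) * ⟨x, hx'⟩ = 1 := Subtype.ext he
    have e2 : (⟨_, h1v _ hm⟩ : GaussRing p E (max 1 r)) * ⟨y, hy'⟩ = 1 := Subtype.ext hey
    have : (⟨x, hx'⟩ : GaussRing p E (max 1 r)) = ⟨y, hy'⟩ := by
      calc (⟨x, hx'⟩ : GaussRing p E (max 1 r))
          = ⟨x, hx'⟩ * (⟨_, h1v _ hm⟩ * ⟨y, hy'⟩) := by rw [e2, mul_one]
        _ = (⟨_, h1v _ hm⟩ * ⟨x, hx'⟩) * ⟨y, hy'⟩ := by ring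
        _ = ⟨y, hy'⟩ := by rw [e1, one_mul]
    rw [show x = y from congrArg Subtype.val this]
    exact hy
  have hdmem : (u 0)⁻¹ • x ∈ omega p C := smul_mem_omega hC ⟨hxD.2, hall, hxD.1⟩ _
  have hprod : seriesMul u ((u 0)⁻¹ • x) = seriesOne := by
    rw [seriesMul_smul, hvu, smul_seriesMul, he, ← hvu, smul_smul, inv_mul_cancel₀ hu0, one_smul]
  -- Both u and the product 1 have only the dominant exponent 0, hence so does the inverse.
  refine ⟨_, hdmem, fun s hs => ?_, hprod⟩
  have hne : (u 0)⁻¹ • x ≠ 0 := fun h => by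
    rw [h] at hprod
    have h1 := congrFun hprod 0
    simp [seriesMul, seriesOne, tPow] at h1
  have := dom_right_of_mul hq hu hdmem hne hs (hflat s hs).1 (hflat s hs).2
    (hprod ▸ (isFlat_one s hs).1) (hprod ▸ (isFlat_one s hs).2)
  simpa using this

/-- A flat factor has dominant exponent 0 at every radius, so multiplying by it moves no dominant
exponent and changes no slope. -/
lemma IsPureOfSlope.mul_isFlat {q : ℝ} (hq : DiscreteNorm E q) {y u : ℚ → E} (hy : y ∈ omega p C)
    (hu : u ∈ omega p C) (hflat : IsFlat p u) {s : ℝ} (hs : IsPureOfSlope p y s) :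
    IsPureOfSlope p (seriesMul y u) s := by
  refine ⟨?_, fun s' => ?_⟩
  · rw [seriesMul_zero_coeff hy.1 hu.1]
    exact mul_ne_zero hs.1 (hflat 1 one_pos).1.1
  · rw [← hs.2 s']
    by_cases hs' : 0 < s'
    · have hy0 : y ≠ 0 := fun h => hs.1 (by rw [h]; rfl)
      obtain ⟨⟨a, ha⟩, b, hb⟩ := exists_dom hq hs' (half_lt_self hs') (hy.2.1 s' hs')
        (hy.2.1 _ (half_pos hs')) hy0
      rw [isSlope_iff_of_dom ha hb, isSlope_iff_of_dom
        (ha.seriesMul one_ne_zero (hy.2.1 s' hs') (hu.2.1 s' hs') (hflat s' hs').1)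
        (hb.seriesMul (by norm_num) (hy.2.1 s' hs') (hu.2.1 s' hs') (hflat s' hs').2)]
      simp
    · exact iff_of_false (fun h => hs' h.1) fun h => hs' h.1

end Families

/-! ### Splitting off the largest slope. -/

section Step

variable {E : Type*} [NormedField E] [IsUltrametricDist E] [CompleteSpace E]
  {p : ℕ} [hpr : Fact p.Prime] {C : Set (ℚ → E)}

lemma continuous_size (x : ℚ → E) (n : ℚ) : Continuous fun r : ℝ => size p r x n := by
  unfold size weight
  refine continuous_const.mul (Real.continuous_const_rpow p_pos.ne' |>.comp ?_)
  fun_prop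

lemma size_zero_exp (r : ℝ) (x : ℚ → E) : size p r x 0 = ‖x 0‖ := by simp [size]

lemma size_eq_size_mul (r s : ℝ) (x : ℚ → E) (n : ℚ) :
    size p r x n = size p s x n * weight p (r - s) n := by
  simp only [size, weight, mul_assoc]
  rw [← Real.rpow_add p_pos]; ring_nf

lemma weight_lt_one {r : ℝ} {n : ℚ} (h : 0 < r * n) : weight p r n < 1 := by
  rw [← weight_zero (p := p) 0]
  exact weight_lt_weight (by simpa using h)

lemma weight_le_one {r : ℝ} {n : ℚ} (h : 0 ≤ r * n) : weight p r n ≤ 1 := by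
  rw [← weight_zero (p := p) 0]
  exact weight_le_weight (by simpa using h)

/-- `s` is the largest slope of `z`. -/
def TopSlope (p : ℕ) (z : ℚ → E) (s : ℝ) : Prop :=
  0 < s ∧ (∀ n, size p s z n ≤ ‖z 0‖) ∧ ∃ n, 0 < n ∧ size p s z n = ‖z 0‖

/-- As r grows, the sizes of the finitely many candidates of positive exponent tend to 0, and the
other terms follow. -/
lemma exists_forall_size_le {q : ℝ} (hq : DiscreteNorm E q) {z : ℚ → E} (hz : z ∈ omega p C)
    (hz0 : z 0 ≠ 0) : ∃ r : ℝ, 0 < r ∧ ∀ n, size p r z n ≤ ‖z 0‖ := by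
  classical
  have hc := norm_pos_iff.2 hz0
  set u : ℚ → E := fun n => if 0 < n then z n else 0 with hu
  have hum : ∀ r, 0 < r → u ∈ gaussSet p E r := fun r hr =>
    mem_gaussSet_of_size_le one_pos (hz.2.1 r hr) fun n => by
      by_cases hn : 0 < n
      · simp [size, hu, hn]
      · simpa [size, hu, hn] using size_nonneg (p := p) r z n
  obtain ⟨F, hF, hF0, hFm⟩ := finite_candidates hq one_pos (half_lt_self one_pos)
    (hum 1 one_pos) (hum _ (half_pos one_pos)) hc
  have hpos : ∀ m ∈ F, 0 < m := fun m hm => by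
    by_contra hcon
    exact hF0 m hm (by simp [hu, hcon])
  have hev : ∀ᶠ r : ℝ in Filter.atTop, ∀ m ∈ F, size p r z m < ‖z 0‖ := by
    rw [Filter.eventually_all_finite hF]
    intro m hm
    have hm' : (0 : ℝ) < m := by exact_mod_cast hpos m hm
    have h1 : Filter.Tendsto (fun r : ℝ => size p r z m) Filter.atTop (𝓝 (‖z m‖ * 0)) := by
      refine Filter.Tendsto.const_mul _ ?_
      have h2 := tendsto_rpow_atBot_of_base_gt_one (p : ℝ) one_lt_p
      refine h2.comp ?_
      rw [Filter.tendsto_neg_atBot_iff]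
      exact Filter.tendsto_id.atTop_mul_const hm'
    rw [mul_zero] at h1
    exact h1.eventually (gt_mem_nhds hc)
  obtain ⟨r, hr1, hr2⟩ := (hev.and (Filter.eventually_ge_atTop 1)).exists
  have hr0 : 0 < r := by linarith
  refine ⟨r, hr0, fun n => ?_⟩
  rcases lt_trichotomy n 0 with hn | rfl | hn
  · simp [size, hz.1 n hn]
  · rw [size_zero_exp]
  have hn' : (0 : ℝ) < n := by exact_mod_cast hn
  rcases lt_or_ge (size p 1 u n) ‖z 0‖ with h1 | h1
  · have h2 : size p 1 u n = size p 1 z n := by simp [size, hu, hn]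
    rw [h2] at h1
    refine le_trans ?_ h1.le
    exact mul_le_mul_of_nonneg_left (weight_le_weight
      (mul_le_mul_of_nonneg_right hr2 hn'.le)) (norm_nonneg _)
  · obtain ⟨m, hm, hmn, he⟩ := hFm n h1
    have he' : ‖z m‖ = ‖z n‖ := by simpa [hu, hn, hpos m hm] using he
    refine le_trans ?_ (hr1 m hm).le
    rw [size, size, he']
    exact mul_le_mul_of_nonneg_left (weight_le_weight
      (mul_le_mul_of_nonneg_left (by exact_mod_cast hmn) hr0.le)) (norm_nonneg _)

/-- The infimum s of the radii at which the constant term is maximal decides. If s = 0, all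
coefficients have norm at most |z_0|. If s > 0, some positive exponent attains equality at s, for
otherwise the radius could still be decreased. -/
lemma isFlat_or_exists_topSlope {q : ℝ} (hq : DiscreteNorm E q) {z : ℚ → E} (hz : z ∈ omega p C)
    (hz0 : z 0 ≠ 0) : IsFlat p z ∨ ∃ s, TopSlope p z s := by
  set S : Set ℝ := {r | 0 < r ∧ ∀ n, size p r z n ≤ ‖z 0‖} with hS
  have hSne : S.Nonempty := exists_forall_size_le hq hz hz0
  have hSbd : BddBelow S := ⟨0, fun r hr => hr.1.le⟩
  set s := sInf S with hs
  have hs0 : 0 ≤ s := le_csInf hSne fun r hr => hr.1.le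
  have hmem : ∀ n, size p s z n ≤ ‖z 0‖ := fun n => by
    have hcl : s ∈ closure S := csInf_mem_closure hSne hSbd
    have : closure S ⊆ {r | size p r z n ≤ ‖z 0‖} :=
      closure_minimal (fun r hr => hr.2 n) (isClosed_le (continuous_size z n) continuous_const)
    exact this hcl
  rcases hs0.eq_or_lt with h0 | hspos
  · left
    refine isFlat_of_norm_le hz.1 hz0 fun n => ?_
    have := hmem n
    rw [← h0] at this
    simpa [size] using this
  · right
    refine ⟨s, hspos, hmem, ?_⟩
    by_contra! hcon
    obtain ⟨r, hr1, hr2, hr⟩ := exists_lt_forall_size_lt hq (half_pos hspos).le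
      (half_lt_self hspos) (x := z) (fun r hr => hz.2.1 r (by linarith)) (norm_pos_iff.2 hz0)
      (fun n hn => lt_of_le_of_ne (hmem n) (hcon n hn))
    have hrS : r ∈ S := ⟨by linarith, fun n => by
      rcases lt_trichotomy n 0 with hn | rfl | hn
      · simp [size, hz.1 n hn]
      · rw [size_zero_exp]
      · exact (hr n hn).le⟩
    exact absurd (csInf_le hSbd hrS) (by rw [← hs]; exact hr2.not_ge)

/-- The Newton polygon has a single segment of negative slope, from exponent 0 to exponent b. -/
lemma isPureOfSlope_of_segment {y : ℚ → E} {s : ℝ} {b : ℚ} (hs : 0 < s) (hb : 0 < b)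
    (hneg : ∀ n, n < 0 → y n = 0) (hlarge : ∀ n, b < n → y n = 0) (hy0 : y 0 ≠ 0)
    (hle : ∀ n, size p s y n ≤ ‖y 0‖) (heq : size p s y b = ‖y 0‖) : IsPureOfSlope p y s := by
  have hc := norm_pos_iff.2 hy0
  have hyb : y b ≠ 0 := fun h => by simp [size, h] at heq; exact hy0 (norm_eq_zero.1 heq.symm)
  refine ⟨hy0, fun s' => ⟨fun h => ?_, ?_⟩⟩
  · obtain ⟨hs', i, j, hij, hi, hj, he, hmax⟩ := (isSlope_iff y s').1 h
    have hi0 : 0 ≤ i := by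
      by_contra! hcon
      exact hi (hneg i hcon)
    have hjb : j ≤ b := by
      by_contra! hcon
      exact hj (hlarge j hcon)
    have hj0 : (0 : ℝ) < j := by exact_mod_cast hi0.trans_lt hij
    by_contra hne
    -- For s' < s the term at b strictly beats the one at i < b; for s' > s the constant term
    -- strictly beats the one at j > 0.
    rcases lt_or_gt_of_ne hne with hlt | hgt
    · have h1 := hmax b
      rw [size_eq_size_mul s' s y b, size_eq_size_mul s' s y i, heq] at h1
      have h2 : weight p (s' - s) i < weight p (s' - s) b := by
        refine weight_lt_weight ?_
        have : (i : ℝ) < b := by exact_mod_cast hij.trans_le hjb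
        nlinarith
      have h3 := weight_pos (p := p) (s' - s) i
      have h4 := mul_le_mul_of_nonneg_right (hle i) h3.le
      nlinarith
    · have h1 := hmax 0
      rw [he, size_zero_exp, size_eq_size_mul s' s y j] at h1
      have h2 : weight p (s' - s) j < 1 := weight_lt_one (mul_pos (by linarith) hj0)
      have h4 := mul_le_mul_of_nonneg_right (hle j) (weight_pos (p := p) (s' - s) j).le
      nlinarith
  · rintro rfl
    rw [isSlope_iff]
    refine ⟨hs, 0, b, hb, hy0, hyb, ?_, fun n => ?_⟩
    · rw [size_zero_exp, heq]
    · rw [size_zero_exp]; exact hle n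

/-- The data of the division of `z` by a factor `y` which is pure of slope `s`, with the
quotient `z'`. -/
structure StepData (p : ℕ) (C : Set (ℚ → E)) (z y z' : ℚ → E) (s : ℝ) : Prop where
  left_mem : y ∈ omega p C
  right_mem : z' ∈ omega p C
  eq_mul : z = seriesMul y z'
  coeff_zero : z' 0 = 1
  pure : IsPureOfSlope p y s
  right_lt : ∃ r, 0 < r ∧ r < s ∧ ∀ n, 0 < n → size p r z' n < 1
  left_le : ∀ n, size p s y n ≤ ‖y 0‖
  left_degree : ∃ b, 0 < b ∧ size p s y b = ‖y 0‖ ∧ ∀ n, b < n → y n = 0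

/-- A crude finite bound improves by the factor θ at each application, until only c remains. -/
lemma isBd_of_self_bound {r c θ : ℝ} (hc : 0 ≤ c) (hθ : θ < 1) (hθ0 : 0 ≤ θ) {g : ℚ → E}
    (hg : ∃ K, IsBd p r K g) (hstep : ∀ d, IsBd p r d g → IsBd p r (max c (θ * d)) g) :
    IsBd p r c g := by
  obtain ⟨K, hK⟩ := hg
  have hK0 := hK.nonneg
  intro n
  have h1 : ∀ k : ℕ, IsBd p r (max c (K * θ ^ k)) g := by
    intro k
    induction k with
    | zero => exact hK.mono (by simp)
    | succ k ih =>
      refine (hstep _ ih).mono ?_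
      rw [mul_max_of_nonneg _ _ hθ0]
      refine max_le (le_max_left _ _) (max_le ?_ ?_)
      · exact le_max_of_le_left (by nlinarith)
      · exact le_max_of_le_right (by rw [pow_succ]; linarith)
  have h2 : Filter.Tendsto (fun k : ℕ => max c (K * θ ^ k)) Filter.atTop (𝓝 (max c 0)) := by
    refine tendsto_const_nhds.max ?_
    simpa using (tendsto_pow_atTop_nhds_zero_of_lt_one hθ0 hθ).const_mul K
  rw [max_eq_left hc] at h2
  exact ge_of_tendsto' h2 fun k => h1 k n

/-- Wiener–Hopf factorization: the solution `g = 1 + g₋`, with `g₋` supported in negative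
exponents, of the condition that `(1 + δ) g` has only nonnegative exponents. -/
lemma exists_wienerHopf (hC : IsStable p C) {r θ : ℝ} (hr : 0 < r) (hθ : θ < 1) {δ : ℚ → E}
    (hδ : δ ∈ gaussSet p E r) (hδC : δ ∈ C) (hb : IsBd p r θ δ) :
    ∃ g ∈ C, g ∈ gaussSet p E r ∧ (∀ n, 0 ≤ n → g n = 0) ∧ IsBd p r θ g ∧
      ∀ n, n < 0 → seriesMul (seriesOne + δ) (seriesOne + g) n = 0 := by
  have hθ0 := hb.nonneg
  -- The equation is g = -(δ + δg)₋, where the subscript denotes the part in negative exponents. It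
  -- says exactly that the negative part of 1 + δ + g + δg vanishes.
  obtain ⟨g, hgD, hg, he⟩ := exists_fixed (c := -trunc 0 δ)
    hθ0 hθ ((hC.closed r hr).inter (closedAt_vanish (E := E) (p := p) r fun n => 0 ≤ n))
    (fun x => -trunc 0 (seriesMul δ x))
    (fun x hx y hy => by rw [seriesMul_sub hδ hx hy, trunc_sub]; abel)
    (fun x hx => neg_mem_gaussSet (trunc_mem_gaussSet (mul_mem_gaussSet hδ hx) 0))
    (fun x d hd => ((hb.mul hd).trunc 0).neg)
    (neg_mem_gaussSet (trunc_mem_gaussSet hδ 0))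
    (fun x hx hxg => ⟨hC.add_mem _ (hC.neg_mem (hC.trunc_mem _ hδC _)) _
      (hC.neg_mem (hC.trunc_mem _ (hC.mul_mem r hr δ hδC x hx.1 hδ hxg) _)), fun n hn => by
        simp [trunc, hn.not_gt]⟩)
    ⟨hC.neg_mem (hC.trunc_mem _ hδC _), fun n hn => by simp [trunc, hn.not_gt]⟩
  have hgb : IsBd p r θ g := by
    refine isBd_of_self_bound hθ0 hθ hθ0 hg.1 fun d hd => ?_
    rw [he]
    exact (hb.trunc 0).neg.add_max ((hb.mul hd).trunc 0).neg
  refine ⟨g, hgD.1, hg, hgD.2, hgb, fun n hn => ?_⟩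
  have h1 := seriesMul_add (add_mem_gaussSet (one_mem_gaussSet r) hδ) (one_mem_gaussSet r) hg
  have h2 := seriesMul_add hg (one_mem_gaussSet r) hδ
  rw [h1, seriesMul_one, seriesMul_comm _ g, h2, seriesMul_one, seriesMul_comm g]
  have h3 := congrFun he n
  simp only [trunc, Pi.add_apply, Pi.neg_apply, if_pos hn] at h3
  simp only [Pi.add_apply]
  rw [h3]
  simp [seriesOne, tPow, hn.ne]

/-- The last dominant term z_b t^b at the slope s becomes the only dominant one just below s.
Wiener–Hopf factorization of z / (z_b t^b) there separates a factor supported in [0, b], carrying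
the slope s, from a factor whose slopes are all smaller. -/
lemma exists_step {q : ℝ} (hq : DiscreteNorm E q) (hC : IsStable p C) {z : ℚ → E} {s : ℝ}
    (hz : z ∈ omega p C) (hz0 : z 0 ≠ 0) (hs : TopSlope p z s) :
    ∃ y z', StepData p C z y z' s := by
  obtain ⟨hs0, hle, n1, hn1, hn1e⟩ := hs
  have hc := norm_pos_iff.2 hz0
  have hzne : z ≠ 0 := fun h => hz0 (by rw [h]; rfl)
  obtain ⟨-, b, hbd⟩ := exists_dom hq hs0 (half_lt_self hs0) (hz.2.1 s hs0)
    (hz.2.1 _ (half_pos hs0)) hzne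
  have hsb : size p s z b = ‖z 0‖ :=
    le_antisymm (hle b) (by rw [← size_zero_exp (p := p) s]; exact (hbd.2 0).1)
  have hb0 : 0 < b := by
    by_contra! hcon
    have := (hbd.2 n1).2 (by linarith)
    rw [hn1e, hsb] at this
    exact lt_irrefl _ this
  have hzb := hbd.1
  have hzbn := norm_pos_iff.2 hzb
  obtain ⟨htb, htb'⟩ := hC.tPow_mem z hz.2.2 b hzb
  have htm : ∀ j : ℚ, ∀ r, (tPow j : ℚ → E) ∈ gaussSet p E r := fun j r =>
    single_mem_gaussSet r j 1
  -- the shifted series, with its dominant term in exponent zero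
  set u : ℚ → E := seriesMul (tPow (-b)) z with hu
  have hun : ∀ n, u n = z (n + b) := fun n => by rw [hu, tPow_seriesMul, sub_neg_eq_add]
  have hum : ∀ r, 0 < r → u ∈ gaussSet p E r := fun r hr =>
    mul_mem_gaussSet (htm _ r) (hz.2.1 r hr)
  have husz : ∀ r n, size p r u n * weight p r b = size p r z (n + b) := fun r n => by
    rw [size, hun, size, weight_add]; ring
  have hwb : ∀ r, 0 < weight p r b := fun r => weight_pos r b
  have hzbs : ‖z b‖ * weight p s b = ‖z 0‖ := hsb
  have hule : ∀ n, size p s u n ≤ ‖z b‖ := fun n => by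
    refine le_of_mul_le_mul_right ?_ (hwb s)
    rw [husz, hzbs]; exact hle _
  -- At s the terms of positive exponent of the shifted series are strictly smaller than z_b,
  -- because b is the last dominant exponent. This persists for some r < s, while lowering the
  -- radius makes terms of negative exponent relatively smaller.
  obtain ⟨r, hr1, hr2, hr⟩ := exists_lt_forall_size_lt hq (half_pos hs0).le
    (half_lt_self hs0) (x := u) (fun r hr => hum r (by linarith)) hzbn
    (fun n hn => by
      refine lt_of_mul_lt_mul_right ?_ (hwb s).le
      rw [husz, hzbs, ← hsb]
      exact (hbd.2 _).2 (by linarith))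
  have hr0 : 0 < r := by linarith
  have hrne : ∀ n, n ≠ 0 → size p r u n < ‖z b‖ := fun n hn => by
    rcases lt_or_gt_of_ne hn with h | h
    · rw [size_eq_size_mul r s]
      have h1 : weight p (r - s) n < 1 := by
        have : (n : ℝ) < 0 := by exact_mod_cast h
        exact weight_lt_one (mul_pos_of_neg_of_neg (by linarith) this)
      have h2 := hule n
      have h3 := weight_pos (p := p) (r - s) n
      nlinarith
    · exact hr n h
  set δ : ℚ → E := (z b)⁻¹ • u - seriesOne with hδdef
  have huC : u ∈ C := hC.mul_mem 1 one_pos _ htb' _ hz.2.2 (htm _ _) (hz.2.1 1 one_pos)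
  have hδC : δ ∈ C := hC.sub_mem (hC.smul_mem _ _ huC) hC.one_mem
  have hδm : ∀ ρ, 0 < ρ → δ ∈ gaussSet p E ρ := fun ρ hρ =>
    sub_mem_gaussSet (smul_mem_gaussSet (hum ρ hρ) _) (one_mem_gaussSet ρ)
  have hδlt : ∀ n, size p r δ n < 1 := fun n => by
    rcases eq_or_ne n 0 with rfl | hn
    · simp [size, hδdef, seriesOne, tPow, hun, hzb]
    · have h1 : δ n = (z b)⁻¹ * u n := by simp [hδdef, seriesOne, tPow, hn]
      rw [size, h1, norm_mul, norm_inv, mul_assoc, inv_mul_lt_iff₀ hzbn, mul_one]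
      exact hrne n hn
  obtain ⟨θ, hθ, hδb⟩ := exists_isBd_lt hq hr0 (half_lt_self hr0) (hδm r hr0)
    (hδm _ (half_pos hr0)) one_pos hδlt
  have hθ0 := hδb.nonneg
  have h1δ : seriesOne + δ = (z b)⁻¹ • u := by rw [hδdef]; abel
  have hz_eq : z = (z b) • seriesMul (tPow b) (seriesOne + δ) := by
    rw [h1δ, seriesMul_smul, smul_smul, mul_inv_cancel₀ hzb, one_smul]
    funext n
    rw [tPow_seriesMul, hun, sub_add_cancel]
  obtain ⟨g, hgC, hgm, hg0, hgb, hgneg⟩ := exists_wienerHopf hC hr0 hθ (hδm r hr0) hδC hδb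
  have h1δm : ∀ ρ, 0 < ρ → seriesOne + δ ∈ gaussSet p E ρ := fun ρ hρ =>
    add_mem_gaussSet (one_mem_gaussSet ρ) (hδm ρ hρ)
  have h1gm : ∀ ρ, ρ ≤ r → seriesOne + g ∈ gaussSet p E ρ := fun ρ hρ => by
    refine add_mem_gaussSet (one_mem_gaussSet ρ) (mem_gaussSet_of_size_le one_pos hgm fun n => ?_)
    rcases le_or_gt 0 n with hn | hn
    · simp [size, hg0 n hn]
    · rw [one_mul]
      have : (n : ℝ) < 0 := by exact_mod_cast hn
      exact mul_le_mul_of_nonneg_left (weight_le_weight (by nlinarith)) (norm_nonneg _)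
  set v : ℚ → E := seriesMul (seriesOne + δ) (seriesOne + g) with hv
  have hvr : v ∈ gaussSet p E r := mul_mem_gaussSet (h1δm r hr0) (h1gm r le_rfl)
  have hvm : ∀ ρ, 0 < ρ → v ∈ gaussSet p E ρ := fun ρ hρ => by
    -- For ρ ≤ r, multiply at ρ, where g still belongs since its exponents are negative. For ρ ≥ r,
    -- use that v has nonnegative exponents.
    rcases le_total ρ r with h | h
    · exact mul_mem_gaussSet (h1δm ρ hρ) (h1gm ρ h)
    · exact mem_gaussSet_of_le_of_nonneg h hgneg hvr
  have h1δC : seriesOne + δ ∈ C := hC.add_mem _ hC.one_mem _ hδC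
  have h1gC : seriesOne + g ∈ C := hC.add_mem _ hC.one_mem _ hgC
  have hvC : v ∈ C := hC.mul_mem r hr0 _ h1δC _ h1gC (h1δm r hr0) (h1gm r le_rfl)
  have hvom : v ∈ omega p C := ⟨hgneg, hvm, hvC⟩
  have hvb : IsBd p r θ (v - seriesOne) := by
    have h1 := seriesMul_add (h1δm r hr0) (one_mem_gaussSet r) hgm
    have h2 := seriesMul_add hgm (one_mem_gaussSet r) (hδm r hr0)
    have h3 : v - seriesOne = δ + (g + seriesMul g δ) := by
      rw [hv, h1, seriesMul_one, seriesMul_comm _ g, h2, seriesMul_one]; abel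
    rw [h3]
    exact hδb.add (hgb.add ((hgb.mul hδb).mono (by nlinarith)))
  have hv0 : ‖v 0‖ = 1 := by
    have h1 := hvb 0
    rw [size_zero_exp] at h1
    have h2 : ‖(v - seriesOne : ℚ → E) 0‖ < ‖(seriesOne : ℚ → E) 0‖ := by
      refine h1.trans_lt ?_
      simpa [seriesOne, tPow] using hθ
    have h3 : v 0 = (v - seriesOne : ℚ → E) 0 + (seriesOne : ℚ → E) 0 := by simp
    rw [h3, IsUltrametricDist.norm_add_eq_max_of_norm_ne_norm h2.ne, max_eq_right h2.le]
    simp [seriesOne, tPow]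
  have hv00 : v 0 ≠ 0 := norm_pos_iff.1 (by rw [hv0]; exact one_pos)
  -- the inverses of the two factors
  have hv1 : seriesOne + (v - seriesOne) = v := by abel
  obtain ⟨h, hhD, hhm, -, hhe⟩ := exists_inverse hθ
    ((hC.closed r hr0).inter (closedAt_vanish r fun n => n < 0))
    (sub_mem_gaussSet hvr (one_mem_gaussSet r)) hvb ⟨hC.one_mem, (one_mem_omega hC).1⟩
    (fun x hx hxg => ⟨hC.sub_mem hC.one_mem (hC.mul_mem r hr0 _ (hC.sub_mem hvC hC.one_mem) x hx.1
      (sub_mem_gaussSet hvr (one_mem_gaussSet r)) hxg), fun n hn => by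
        rw [Pi.sub_apply, (one_mem_omega hC).1 n hn, seriesMul_eq_zero_of_le (a := 0) (b := 0)
          (fun n hn => by simp [hgneg n hn, (one_mem_omega hC).1 n hn]) hx.2 (by simpa using hn),
          sub_zero]⟩)
  rw [hv1] at hhe
  obtain ⟨G, hGD, hGm, -, hGe⟩ := exists_inverse hθ
    (closedAt_vanish r fun n => 0 < n) hgm hgb (fun n hn => by simp [seriesOne, tPow, hn.ne'])
    (fun x hx hxg n hn => by
      have h1 : seriesMul g x n = 0 := by
        unfold seriesMul
        convert tsum_zero with i
        rcases le_or_gt 0 i with h | h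
        · rw [hg0 i h, zero_mul]
        · rw [hx (n - i) (by linarith), mul_zero]
      simp [h1, seriesOne, tPow, hn.ne'])
  -- Here (1 + δ)(1 + g)h = 1 and (1 + g)G = 1. So zh equals z_b t^b G, whose exponents are at most
  -- b, while as a product of z and h it has no negative ones.
  have hGh : seriesMul (seriesOne + δ) h = G := by
    let A : GaussRing p E r := ⟨_, h1δm r hr0⟩
    let B : GaussRing p E r := ⟨_, h1gm r le_rfl⟩
    let H : GaussRing p E r := ⟨h, hhm⟩
    let G' : GaussRing p E r := ⟨G, hGm⟩
    have e1 : A * B * H = 1 := Subtype.ext hhe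
    have e2 : B * G' = 1 := Subtype.ext hGe
    have : A * H = G' := by
      calc A * H = (A * B * H) * G' + A * H * (1 - B * G') := by ring
        _ = G' := by rw [e1, e2]; ring
    exact congrArg Subtype.val this
  set y : ℚ → E := seriesMul z h with hy
  have hzr := hz.2.1 r hr0
  have hyr : y ∈ gaussSet p E r := mul_mem_gaussSet hzr hhm
  have hyneg : ∀ n, n < 0 → y n = 0 := fun n hn =>
    seriesMul_eq_zero_of_le hz.1 hhD.2 (by simpa using hn)
  have hyG : y = (z b) • seriesMul (tPow b) G := by
    rw [hy, hz_eq, smul_seriesMul, seriesMul_assoc (htm b r) (h1δm r hr0) hhm, hGh, ← hz_eq]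
  have hylarge : ∀ n, b < n → y n = 0 := fun n hn => by
    rw [hyG, Pi.smul_apply, tPow_seriesMul, hGD (n - b) (by linarith), smul_zero]
  have hym : ∀ ρ, 0 < ρ → y ∈ gaussSet p E ρ := fun ρ hρ => by
    refine mem_gaussSet_of_size_le (K := weight p (-|ρ - r|) b) (weight_pos _ _) hyr fun n => ?_
    rcases lt_or_ge n 0 with h | h
    · simp [size, hyneg n h]
    rcases lt_or_ge b n with h' | h'
    · simp [size, hylarge n h']
    · rw [size_eq_size_mul ρ r, mul_comm]
      refine mul_le_mul_of_nonneg_right (weight_le_weight ?_) (size_nonneg _ _ _)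
      have h1 : (0 : ℝ) ≤ n := by exact_mod_cast h
      have h2 : (n : ℝ) ≤ b := by exact_mod_cast h'
      have h3 := neg_abs_le (ρ - r)
      have h4 := abs_nonneg (ρ - r)
      nlinarith
  have hyC : y ∈ C := hC.mul_mem r hr0 _ hz.2.2 _ hhD.1 hzr hhm
  have hyom : y ∈ omega p C := ⟨hyneg, hym, hyC⟩
  have hzyv : z = seriesMul y v := by
    rw [hy, seriesMul_assoc hzr hhm hvr, seriesMul_comm h, hhe, seriesMul_one]
  have hy0 : y 0 ≠ 0 := fun h0 => hz0 (by
    rw [hzyv, seriesMul_zero_coeff hyneg hgneg, h0, zero_mul])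
  have hyne : y ≠ 0 := fun h => hy0 (by rw [h]; rfl)
  have hvsz : ∀ n, 0 < n → size p r v n < 1 := fun n hn => by
    have h1 := hvb n
    have h2 : size p r (v - seriesOne) n = size p r v n := by
      simp [size, seriesOne, tPow, hn.ne']
    rw [h2] at h1
    exact h1.trans_lt hθ
  have hvs : ∀ n, 0 < n → size p s v n < ‖v 0‖ := fun n hn => by
    rw [hv0, size_eq_size_mul s r]
    have h1 := hvsz n hn
    have h2 : weight p (s - r) n ≤ 1 :=
      weight_le_one (mul_nonneg (by linarith) (by exact_mod_cast hn.le))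
    have h3 := size_nonneg (p := p) r v n
    have h4 := weight_pos (p := p) (s - r) n
    nlinarith
  obtain ⟨hv1', hv2'⟩ := dom_zero_of_size_lt hgneg hv00 hvs
  have hza : Dom p 1 s z 0 := ⟨hz0, fun n => ⟨by rw [size_zero_exp]; exact hle n, fun hn => by
    rw [size, hz.1 n (by linarith), norm_zero, zero_mul]; exact size_pos hz0⟩⟩
  -- At s the factor v has dominant exponent 0 only, so y inherits from z both dominant exponents, 0
  -- and b.
  have hdom := dom_right_of_mul (C := C) hq hvom hyom hyne hs0 hv1' hv2' (c := 0) (d := b)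
    (by rw [seriesMul_comm, ← hzyv]; exact hza) (by rw [seriesMul_comm, ← hzyv]; exact hbd)
  simp only [sub_zero] at hdom
  have hyle : ∀ n, size p s y n ≤ ‖y 0‖ := fun n => by
    rw [← size_zero_exp (p := p) s]; exact (hdom.1.2 n).1
  have hyb : size p s y b = ‖y 0‖ :=
    le_antisymm (hyle b) (by rw [← size_zero_exp (p := p) s]; exact (hdom.2.2 0).1)
  have hsmul : ∀ n, size p s ((v 0) • y) n = size p s y n := fun n => by
    simp [size, norm_mul, hv0]
  have hsmul0 : ‖((v 0) • y) 0‖ = ‖y 0‖ := by simp [norm_mul, hv0]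
  -- The constant v_0, of norm 1, is moved to the left factor so that the quotient has constant term
  -- 1.
  refine ⟨(v 0) • y, (v 0)⁻¹ • v, smul_mem_omega hC hyom _, smul_mem_omega hC hvom _, ?_, ?_, ?_,
    ⟨r, hr0, hr2, fun n hn => ?_⟩, fun n => ?_, b, hb0, ?_, fun n hn => ?_⟩
  · rw [smul_seriesMul, seriesMul_smul, smul_smul, mul_inv_cancel₀ hv00, one_smul, ← hzyv]
  · simp [hv00]
  · refine isPureOfSlope_of_segment hs0 hb0 (fun n hn => by simp [hyneg n hn])
      (fun n hn => by simp [hylarge n hn]) (by simp [hv00, hy0]) (fun n => ?_) ?_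
    · rw [hsmul, hsmul0]; exact hyle n
    · rw [hsmul, hsmul0]; exact hyb
  · have : size p r ((v 0)⁻¹ • v) n = size p r v n := by simp [size, norm_mul, hv0]
    rw [this]; exact hvsz n hn
  · rw [hsmul, hsmul0]; exact hyle n
  · rw [hsmul, hsmul0]; exact hyb
  · simp [hylarge n hn]

end Step

/-! ### Successive divisions, convergence, and the factorization theorem. -/

section Factorization

variable {E : Type*} [NormedField E] [IsUltrametricDist E] [CompleteSpace E]
  {p : ℕ} [hpr : Fact p.Prime] {C : Set (ℚ → E)}

lemma partialProd_mem_omega (hC : IsStable p C) {y : ℕ → ℚ → E} {n : ℕ}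
    (hy : ∀ i, i < n → y i ∈ omega p C) : partialProd y n ∈ omega p C := by
  induction n with
  | zero => exact one_mem_omega hC
  | succ n ih =>
    exact mul_mem_omega hC (ih fun i hi => hy i (by lia)) (hy n (by lia))

lemma partialProd_congr {y y' : ℕ → ℚ → E} {n : ℕ} (h : ∀ i, i < n → y i = y' i) :
    partialProd y n = partialProd y' n := by
  induction n with
  | zero => rfl
  | succ n ih =>
    simp only [partialProd]
    rw [ih fun i hi => h i (by lia), h n (by lia)]

lemma w_le_of_isBd {r c : ℝ} {x : ℚ → E} (h : IsBd p r c x) : w p r x ≤ ENNReal.ofReal c :=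
  iSup_le fun i => ENNReal.ofReal_le_ofReal (h i)

lemma TopSlope.lt_of_stepData {z y z' : ℚ → E} {s s' : ℝ} (h : StepData p C z y z' s)
    (hs' : TopSlope p z' s') : s' < s := by
  obtain ⟨r, hr0, hrs, hr⟩ := h.right_lt
  obtain ⟨n, hn, hne⟩ := hs'.2.2
  by_contra! hcon
  have h1 := hr n hn
  rw [h.coeff_zero, norm_one, size_eq_size_mul s' r] at hne
  have h2 : weight p (s' - r) n ≤ 1 :=
    weight_le_one (mul_nonneg (by linarith) (by exact_mod_cast hn.le))
  have h3 := size_nonneg (p := p) r z' n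
  have h4 := weight_pos (p := p) (s' - r) n
  nlinarith

/-- For ρ ≤ s, lowering the radius favours large exponents, so b is the last dominant exponent of y
at ρ as well. Purity gives |y_b / y_0| = p^(sb) > 1, and a norm above 1 is at least q. -/
lemma StepData.exists_degree {q : ℝ} (hq : DiscreteNorm E q) {z y z' : ℚ → E} {s ρ : ℝ}
    (h : StepData p C z y z' s) (hρ : 0 < ρ) (hρs : ρ ≤ s) {B : ℚ} (hB : Dom p (-1) ρ z B) :
    ∃ b B' : ℚ, Dom p (-1) ρ z' B' ∧ B = b + B' ∧ Real.logb p q ≤ s * b := by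
  obtain ⟨b, hb0, hbe, hbl⟩ := h.left_degree
  have hy0 := h.pure.1
  have hc := norm_pos_iff.2 hy0
  have hb0' : (0 : ℝ) < b := by exact_mod_cast hb0
  have hyb : y b ≠ 0 := fun h => by simp [size, h] at hbe; exact hy0 (norm_eq_zero.1 hbe.symm)
  have hs : 0 < s := hρ.trans_le hρs
  have hdom : Dom p (-1) ρ y b := by
    have hle : ∀ n, size p ρ y n ≤ size p ρ y b := fun n => by
      rcases lt_or_ge b n with hn | hn
      · simpa [size, hbl n hn] using size_nonneg (p := p) ρ y b
      · rw [size_eq_size_mul ρ s y n, size_eq_size_mul ρ s y b, hbe]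
        refine mul_le_mul (h.left_le n) (weight_le_weight ?_) (weight_pos _ _).le hc.le
        have : (n : ℝ) ≤ b := by exact_mod_cast hn
        nlinarith
    refine ⟨hyb, fun n => ⟨hle n, fun hn => ?_⟩⟩
    rw [size, hbl n (by linarith), norm_zero, zero_mul]
    exact size_pos hyb
  have hz'0 : z' ≠ 0 := fun h0 => by
    have := h.coeff_zero
    rw [h0] at this
    simp at this
  obtain ⟨-, B', hB'⟩ := exists_dom hq hρ (half_lt_self hρ) (h.right_mem.2.1 ρ hρ)
    (h.right_mem.2.1 _ (half_pos hρ)) hz'0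
  refine ⟨b, B', hB', ?_, ?_⟩
  · rw [h.eq_mul] at hB
    exact hB.eq (by norm_num)
      (hdom.seriesMul (by norm_num) (h.left_mem.2.1 ρ hρ) (h.right_mem.2.1 ρ hρ) hB')
  · have h1 : ‖y b * (y 0)⁻¹‖ = (p : ℝ) ^ (s * b) := by
      rw [norm_mul, norm_inv, ← hbe, size, weight, Real.rpow_neg p_pos.le]
      have := norm_pos_iff.2 hyb
      have h2 := Real.rpow_pos_of_pos (p_pos (p := p)) (s * b)
      field_simp
    have h2 : 1 < ‖y b * (y 0)⁻¹‖ := by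
      rw [h1]
      exact Real.one_lt_rpow one_lt_p (mul_pos hs hb0')
    have h3 := hq.le_norm h2
    rw [h1] at h3
    rw [Real.logb_le_iff_le_rpow one_lt_p (by linarith [hq.1])]
    exact h3

lemma isUnitOf_one (hC : IsStable p C) : IsUnitOf (omega p C) (seriesOne : ℚ → E) :=
  ⟨one_mem_omega hC, seriesOne, one_mem_omega hC, seriesOne_seriesMul _⟩

lemma IsFlat.seriesMul {x y : ℚ → E} (hx : x ∈ omega p C)
    (hy : y ∈ omega p C) (hfx : IsFlat p x) (hfy : IsFlat p y) : IsFlat p (seriesMul x y) :=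
  fun s hs => by
    have h1 := (hfx s hs).1.seriesMul one_ne_zero (hx.2.1 s hs) (hy.2.1 s hs) (hfy s hs).1
    have h2 := (hfx s hs).2.seriesMul (by norm_num) (hx.2.1 s hs) (hy.2.1 s hs) (hfy s hs).2
    rw [add_zero] at h1 h2
    exact ⟨h1, h2⟩

/-- A sequence of successive divisions of `x`, the `n`-th one dividing `Z n` by `Y n`. -/
structure IsDivisionChain (p : ℕ) (C : Set (ℚ → E)) (x : ℚ → E) (Z Y : ℕ → ℚ → E) (s : ℕ → ℝ)
    (N : ℕ∞) : Prop where
  start : Z 0 = x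
  start_mem : x ∈ omega p C
  step : ∀ n : ℕ, (n : ℕ∞) < N → StepData p C (Z n) (Y n) (Z (n + 1)) (s n)
  topSlope : ∀ n : ℕ, (n : ℕ∞) < N → TopSlope p (Z n) (s n)

namespace IsDivisionChain

variable {x : ℚ → E} {Z Y : ℕ → ℚ → E} {s : ℕ → ℝ} {N : ℕ∞}

lemma mem (h : IsDivisionChain p C x Z Y s N) {n : ℕ} (hn : (n : ℕ∞) ≤ N) :
    Z n ∈ omega p C := by
  cases n with
  | zero => rw [h.start]; exact h.start_mem
  | succ n => exact (h.step n (lt_of_lt_of_le (by exact_mod_cast n.lt_succ_self) hn)).right_mem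

lemma prod_eq (hC : IsStable p C) (h : IsDivisionChain p C x Z Y s N) {n : ℕ}
    (hn : (n : ℕ∞) ≤ N) : x = seriesMul (partialProd Y n) (Z n) := by
  induction n with
  | zero => rw [partialProd, seriesOne_seriesMul, h.start]
  | succ n ih =>
    have hlt : (n : ℕ∞) < N := lt_of_lt_of_le (by exact_mod_cast n.lt_succ_self) hn
    have hst := h.step n hlt
    rw [ih hlt.le, partialProd, omega_mul_assoc (partialProd_mem_omega hC fun i hi =>
      (h.step i (lt_trans (by exact_mod_cast hi) hlt)).left_mem) hst.left_mem hst.right_mem,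
      ← hst.eq_mul]

lemma slope_lt (h : IsDivisionChain p C x Z Y s N) {i i' : ℕ} (hi : i < i')
    (hi' : (i' : ℕ∞) < N) : s i' < s i := by
  induction i' with
  | zero => lia
  | succ n ih =>
    have hlt : (n : ℕ∞) < N := lt_trans (by exact_mod_cast n.lt_succ_self) hi'
    have h1 := (h.topSlope (n + 1) hi').lt_of_stepData (h.step n hlt)
    rcases Nat.lt_succ_iff_lt_or_eq.1 hi with h2 | rfl
    · exact h1.trans (ih h2 hlt)
    · exact h1

lemma slope_antitone (h : IsDivisionChain p C x Z Y s ⊤) : Antitone s :=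
  (strictAnti_nat_of_succ_lt fun n => h.slope_lt n.lt_succ_self (ENat.natCast_lt_top _)).antitone

/-- If all slopes stayed at least ρ, every division would lower the last dominant exponent at ρ by
at least log_p q / s_0. That exponent can never become negative. -/
lemma tendsto_slope {q : ℝ} (hq : DiscreteNorm E q) (h : IsDivisionChain p C x Z Y s ⊤) :
    Filter.Tendsto s Filter.atTop (𝓝 0) := by
  have hpos : ∀ n, 0 < s n := fun n => (h.topSlope n (ENat.natCast_lt_top _)).1
  have hex : ∀ ρ : ℝ, 0 < ρ → ∃ n, s n < ρ := by
    intro ρ hρ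
    by_contra! hcon
    have hx0 : Z 0 ≠ 0 := fun h0 => by
      obtain ⟨n, hn, hne⟩ := (h.topSlope 0 (ENat.natCast_lt_top _)).2.2
      have := (h.step 0 (ENat.natCast_lt_top _)).pure.1
      have h2 := (h.step 0 (ENat.natCast_lt_top _))
      have h3 := congrFun h2.eq_mul 0
      rw [seriesMul_zero_coeff h2.left_mem.1 h2.right_mem.1, h2.coeff_zero, mul_one, h0] at h3
      exact this h3.symm
    have hZ0 := h.mem (n := 0) le_top
    obtain ⟨-, B, hB⟩ := exists_dom hq hρ (half_lt_self hρ) (hZ0.2.1 ρ hρ)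
      (hZ0.2.1 _ (half_pos hρ)) hx0
    have hlog : 0 < Real.logb p q := Real.logb_pos one_lt_p hq.1
    have key : ∀ n : ℕ, ∃ B' : ℚ, Dom p (-1) ρ (Z n) B' ∧
        n * (Real.logb p q / s 0) + B' ≤ B := by
      intro n
      induction n with
      | zero => exact ⟨B, hB, by simp⟩
      | succ n ih =>
        obtain ⟨B₁, hB₁, hle⟩ := ih
        obtain ⟨b, B₂, hB₂, he, hb⟩ := (h.step n (ENat.natCast_lt_top _)).exists_degree hq hρ (hcon n)
          hB₁
        refine ⟨B₂, hB₂, ?_⟩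
        have h1 : Real.logb p q / s 0 ≤ b := by
          rw [div_le_iff₀ (hpos 0)]
          have h2 := h.slope_antitone (Nat.zero_le n)
          have h3 : 0 < (b : ℝ) := by
            by_contra! hb0
            nlinarith [hpos n]
          nlinarith
        have h2 : (B₁ : ℝ) = b + B₂ := by exact_mod_cast he
        push_cast
        linarith
    have hlog' : 0 < Real.logb p q / s 0 := div_pos hlog (hpos 0)
    obtain ⟨n, hn⟩ := exists_nat_gt ((B : ℝ) / (Real.logb p q / s 0))
    obtain ⟨B', hB', hle⟩ := key n
    have hB0 : 0 ≤ B' := by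
      by_contra! hcon
      exact hB'.1 ((h.mem (n := n) le_top).1 B' hcon)
    have hB0' : (0 : ℝ) ≤ B' := by exact_mod_cast hB0
    rw [div_lt_iff₀ hlog'] at hn
    linarith
  rw [Metric.tendsto_atTop]
  intro ε hε
  obtain ⟨n, hn⟩ := hex ε hε
  refine ⟨n, fun m hm => ?_⟩
  rw [Real.dist_eq, sub_zero, abs_of_pos (hpos m)]
  exact (h.slope_antitone hm).trans_lt hn

end IsDivisionChain

lemma exists_divisionChain {q : ℝ} (hq : DiscreteNorm E q) (hC : IsStable p C) {x : ℚ → E}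
    (hx : x ∈ omega p C) (hx0 : x 0 ≠ 0) :
    ∃ Z Y s N, IsDivisionChain p C x Z Y s N ∧ ∀ n : ℕ, N = n → IsFlat p (Z n) := by
  classical
  -- Division is made a total function with junk values, so that the chain can be defined by plain
  -- recursion. It is only used up to the first flat quotient.
  have key : ∀ z : ℚ → E, ∃ t : (ℚ → E) × (ℚ → E) × ℝ, z ∈ omega p C → z 0 ≠ 0 → ¬ IsFlat p z →
      TopSlope p z t.2.2 ∧ StepData p C z t.1 t.2.1 t.2.2 := fun z => by
    by_cases h : z ∈ omega p C ∧ z 0 ≠ 0 ∧ ¬ IsFlat p z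
    · obtain ⟨s, hs⟩ := (isFlat_or_exists_topSlope hq h.1 h.2.1).resolve_left h.2.2
      obtain ⟨y, z', hst⟩ := exists_step hq hC h.1 h.2.1 hs
      exact ⟨(y, z', s), fun _ _ _ => ⟨hs, hst⟩⟩
    · exact ⟨(0, 0, 0), fun h1 h2 h3 => absurd ⟨h1, h2, h3⟩ h⟩
  choose f hf using key
  let Z : ℕ → ℚ → E := fun n => Nat.rec x (fun _ z => (f z).2.1) n
  have hZ1 : ∀ n, Z (n + 1) = (f (Z n)).2.1 := fun n => rfl
  have hgood : ∀ n, (∀ m < n, ¬ IsFlat p (Z m)) → Z n ∈ omega p C ∧ Z n 0 ≠ 0 := by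
    intro n
    induction n with
    | zero => exact fun _ => ⟨hx, hx0⟩
    | succ n ih =>
      intro hm
      obtain ⟨h1, h2⟩ := ih fun m hmn => hm m (by lia)
      have h3 := (hf (Z n) h1 h2 (hm n (by lia))).2
      rw [hZ1]
      exact ⟨h3.right_mem, by rw [h3.coeff_zero]; exact one_ne_zero⟩
  by_cases hall : ∀ n, ¬ IsFlat p (Z n)
  · have hst := fun n => hf (Z n) (hgood n fun m _ => hall m).1 (hgood n fun m _ => hall m).2
      (hall n)
    exact ⟨Z, fun n => (f (Z n)).1, fun n => (f (Z n)).2.2, ⊤,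
      ⟨rfl, hx, fun n _ => (hst n).2, fun n _ => (hst n).1⟩,
      fun n hn => absurd hn (ENat.top_ne_natCast n)⟩
  · push Not at hall
    have hmin : ∀ m < Nat.find hall, ¬ IsFlat p (Z m) := fun m hm => Nat.find_min hall hm
    have hst : ∀ n < Nat.find hall, _ := fun n hn =>
      hf (Z n) (hgood n fun m hm => hmin m (hm.trans hn)).1
        (hgood n fun m hm => hmin m (hm.trans hn)).2 (hmin n hn)
    refine ⟨Z, fun n => (f (Z n)).1, fun n => (f (Z n)).2.2, (Nat.find hall : ℕ),
      ⟨rfl, hx, fun n hn => (hst n (by exact_mod_cast hn)).2,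
        fun n hn => (hst n (by exact_mod_cast hn)).1⟩, fun n hn => ?_⟩
    have : Nat.find hall = n := by exact_mod_cast hn
    rw [← this]
    exact Nat.find_spec hall

/-- Units `U n`, which approximate the quotients of a division chain, and their inverses. -/
lemma IsDivisionChain.exists_units {q : ℝ} (hq : DiscreteNorm E q) (hC : IsStable p C) {x : ℚ → E}
    {Z Y : ℕ → ℚ → E} {s : ℕ → ℝ} (h : IsDivisionChain p C x Z Y s ⊤) :
    ∃ (U V : ℕ → ℚ → E) (J : ℕ → ℕ), U 0 = seriesOne ∧
      (∀ n, U n ∈ omega p C ∧ V n ∈ omega p C ∧ IsFlat p (U n) ∧ IsFlat p (V n) ∧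
        seriesMul (U n) (V n) = seriesOne ∧ V n 0 = 1) ∧
      Filter.Tendsto J Filter.atTop Filter.atTop ∧
      ∀ r : ℝ, 0 < r → ∀ᶠ n in Filter.atTop, IsBd p r (weight p (r / 2) (J n)) (U n - Z n) := by
  classical
  have hpos : ∀ n, 0 < s n := fun n => (h.topSlope n (ENat.natCast_lt_top _)).1
  have hlog : 0 < Real.logb p q := Real.logb_pos one_lt_p hq.1
  -- For i below log_p q / s_n, the bound |Z_n,i| ≤ p^(s_n i) < q forces |Z_n,i| ≤ 1 by
  -- discreteness.
  set J : ℕ → ℕ := fun n => ⌊Real.logb p q / s n⌋₊ with hJ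
  have hJt : Filter.Tendsto J Filter.atTop Filter.atTop := by
    refine tendsto_nat_floor_atTop.comp ?_
    have h1 : Filter.Tendsto s Filter.atTop (𝓝[>] 0) :=
      tendsto_nhdsWithin_iff.2 ⟨h.tendsto_slope hq, Filter.Eventually.of_forall hpos⟩
    exact (tendsto_inv_nhdsGT_zero.comp h1).const_mul_atTop hlog
  -- Two exceptional cases use 1: at n = 0, so that the telescoping product starts at 1 (and Z_0
  -- need not have constant term 1), and when J_n = 0, where the truncation would lose the constant
  -- term.
  set U : ℕ → ℚ → E := fun n => if n = 0 ∨ J n = 0 then seriesOne else trunc (J n) (Z n) with hU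
  have hZ1 : ∀ n, n ≠ 0 → Z n 0 = 1 := fun n hn => by
    obtain ⟨m, rfl⟩ := Nat.exists_eq_succ_of_ne_zero hn
    exact (h.step m (ENat.natCast_lt_top _)).coeff_zero
  have hZle : ∀ n, n ≠ 0 → ∀ i, size p (s n) (Z n) i ≤ 1 := fun n hn i => by
    have := (h.topSlope n (ENat.natCast_lt_top _)).2.1 i
    rwa [hZ1 n hn, norm_one] at this
  have hUom : ∀ n, U n ∈ omega p C := fun n => by
    by_cases hn : n = 0 ∨ J n = 0
    · simp only [hU, if_pos hn]; exact one_mem_omega hC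
    · simp only [hU, if_neg hn]; exact trunc_mem_omega hC (h.mem le_top) _
  have hU0 : ∀ n, U n 0 = 1 := fun n => by
    by_cases hn : n = 0 ∨ J n = 0
    · simp only [hU, if_pos hn]; simp [seriesOne, tPow]
    · simp only [hU, if_neg hn]
      push Not at hn
      have h1 : (0 : ℚ) < J n := by exact_mod_cast Nat.pos_of_ne_zero hn.2
      simp [trunc, h1, hZ1 n hn.1, -Nat.cast_pos]
  have hUf : ∀ n, IsFlat p (U n) := fun n => by
    by_cases hn : n = 0 ∨ J n = 0
    · simp only [hU, if_pos hn]; exact isFlat_one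
    · refine isFlat_of_norm_le (hUom n).1 (by rw [hU0]; exact one_ne_zero) fun i => ?_
      rw [hU0, norm_one]
      rcases lt_or_ge i 0 with hi0 | hi0
      · rw [(hUom n).1 i hi0, norm_zero]; exact zero_le_one
      simp only [hU, if_neg hn]
      push Not at hn
      by_cases hi : i < J n
      · simp only [trunc, if_pos hi]
        by_contra! hcon
        have h1 := hq.le_norm hcon
        have h2 := hZle n hn.1 i
        have h3 : (i : ℝ) < Real.logb p q / s n := by
          have h4 : (i : ℝ) < (J n : ℝ) := by exact_mod_cast hi
          exact h4.trans_le (Nat.floor_le (div_nonneg hlog.le (hpos n).le))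
        rw [lt_div_iff₀ (hpos n)] at h3
        have h5 : (p : ℝ) ^ (s n * i) < q := by
          calc (p : ℝ) ^ (s n * i) < (p : ℝ) ^ Real.logb p q :=
                Real.rpow_lt_rpow_of_exponent_lt one_lt_p (by linarith)
            _ = q := Real.rpow_logb p_pos one_lt_p.ne' (by linarith [hq.1])
        have h6 := Real.rpow_pos_of_pos (p_pos (p := p)) (s n * i)
        rw [size, weight, Real.rpow_neg p_pos.le, ← div_eq_mul_inv, div_le_iff₀ h6] at h2
        linarith
      · simp only [trunc, if_neg hi, norm_zero]; exact zero_le_one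
  choose V hVom hVf hUV using fun n => exists_inverse_of_isFlat hq hC (hUom n) (hUf n)
  refine ⟨U, V, J, by simp [hU], fun n => ⟨hUom n, hVom n, hUf n, hVf n, hUV n, ?_⟩, hJt,
    fun r hr => ?_⟩
  · have h1 := congrFun (hUV n) 0
    rw [seriesMul_zero_coeff (hUom n).1 (hVom n).1, hU0, one_mul] at h1
    simpa [seriesOne, tPow] using h1
  · filter_upwards [(h.tendsto_slope hq).eventually (gt_mem_nhds (half_pos hr)),
      Filter.eventually_gt_atTop 0, hJt.eventually (Filter.eventually_gt_atTop 0)] with n h1 h2 h3 i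
    have hn : ¬ (n = 0 ∨ J n = 0) := by lia
    by_cases hi : i < J n
    · have : (U n - Z n) i = 0 := by simp [hU, hn, trunc, hi]
      rw [size, this, norm_zero, zero_mul]
      exact (weight_pos _ _).le
    · have h4 : (U n - Z n) i = - Z n i := by simp [hU, hn, trunc, hi]
      have h5 : size p r (U n - Z n) i = size p (s n) (Z n) i * weight p (r - s n) i := by
        rw [← size_eq_size_mul, size, size, h4, norm_neg]
      rw [h5]
      have h6 := hZle n h2.ne' i
      push Not at hi
      -- Eventually s_n < r / 2, so r - s_n > r / 2, and the remaining exponents are at least J_n.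
      have h7 : weight p (r - s n) i ≤ weight p (r / 2) (J n) := by
        refine weight_le_weight ?_
        have h8 : ((J n : ℚ) : ℝ) ≤ i := by exact_mod_cast hi
        have h9 : (0 : ℝ) ≤ ((J n : ℚ) : ℝ) := by positivity
        nlinarith
      calc _ ≤ 1 * weight p (r - s n) i := mul_le_mul_of_nonneg_right h6 (weight_pos _ _).le
        _ ≤ _ := by rw [one_mul]; exact h7

lemma IsFlat.isBd {x : ℚ → E} (h : IsFlat p x) {r : ℝ} (hr : 0 < r) :
    IsBd p r ‖x 0‖ x := fun n => by
  rw [← size_zero_exp (p := p) r]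
  exact ((h r hr).1.2 n).1

/-- Flat corrections leave purity and slopes intact, which leaves the freedom needed to make the
product converge. The partial products P_n satisfy P_n - x = P_n U_n⁻¹ (U_n - Z_n), and the last
factor tends to zero for each w_r. -/
lemma IsDivisionChain.exists_convergent {q : ℝ} (hq : DiscreteNorm E q) (hC : IsStable p C)
    {x : ℚ → E} {Z Y : ℕ → ℚ → E} {s : ℕ → ℝ} (h : IsDivisionChain p C x Z Y s ⊤) :
    ∃ y : ℕ → ℚ → E, (∀ i, y i ∈ omega p C ∧ IsPureOfSlope p (y i) (s i)) ∧
      ∀ r : ℝ, 0 < r → Filter.Tendsto (fun n => w p r (partialProd y n - x)) Filter.atTop (𝓝 0) := by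
  obtain ⟨U, V, J, hU0, hUV, hJ, hb⟩ := h.exists_units hq hC
  have hst := fun n => h.step n (ENat.natCast_lt_top _)
  have hVU : ∀ n, seriesMul (U (n + 1)) (V n) ∈ omega p C := fun n =>
    mul_mem_omega hC (hUV _).1 (hUV _).2.1
  -- With V_n = U_n⁻¹ the corrections telescope, leaving U_n in the product of the first n factors.
  set y : ℕ → ℚ → E := fun n => seriesMul (Y n) (seriesMul (U (n + 1)) (V n)) with hy
  have hym : ∀ i, y i ∈ omega p C := fun i => mul_mem_omega hC (hst i).left_mem (hVU i)
  have hYP : ∀ n, partialProd Y n ∈ omega p C := fun n =>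
    partialProd_mem_omega hC fun i _ => (hst i).left_mem
  have hyP : ∀ n, partialProd y n ∈ omega p C := fun n => partialProd_mem_omega hC fun i _ => hym i
  let ι : omega p C → GaussRing p E 1 := fun a => ⟨a.1, a.2.2.1 1 one_pos⟩
  have hprod : ∀ n, partialProd y n = seriesMul (partialProd Y n) (U n) := by
    intro n
    induction n with
    | zero => rw [hU0, seriesMul_one]; rfl
    | succ n ih =>
      rw [partialProd, partialProd, ih]
      have e1 : ι ⟨_, (hUV n).1⟩ * ι ⟨_, (hUV n).2.1⟩ = 1 := Subtype.ext (hUV n).2.2.2.2.1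
      have e2 : (ι ⟨_, hYP n⟩ * ι ⟨_, (hUV n).1⟩) * (ι ⟨_, (hst n).left_mem⟩ *
          (ι ⟨_, (hUV (n + 1)).1⟩ * ι ⟨_, (hUV n).2.1⟩)) =
          (ι ⟨_, hYP n⟩ * ι ⟨_, (hst n).left_mem⟩) * ι ⟨_, (hUV (n + 1)).1⟩ := by
        calc _ = (ι ⟨_, hYP n⟩ * ι ⟨_, (hst n).left_mem⟩) * ι ⟨_, (hUV (n + 1)).1⟩ *
              (ι ⟨_, (hUV n).1⟩ * ι ⟨_, (hUV n).2.1⟩) := by ring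
          _ = _ := by rw [e1, mul_one]
      exact congrArg Subtype.val e2
  refine ⟨y, fun i => ⟨hym i, IsPureOfSlope.mul_isFlat hq (hst i).left_mem (hVU i)
    ((hUV _).2.2.1.seriesMul (hUV _).1 (hUV _).2.1 (hUV _).2.2.2.1) (hst i).pure⟩,
    fun r hr => ?_⟩
  set ε : ℕ → ℚ → E := fun n => seriesMul (V n) (U n - Z n) with hε
  have hZom : ∀ n, Z n ∈ omega p C := fun n => h.mem le_top
  have hUZ : ∀ ρ, 0 < ρ → ∀ n, U n - Z n ∈ gaussSet p E ρ := fun ρ hρ n =>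
    sub_mem_gaussSet ((hUV n).1.2.1 ρ hρ) ((hZom n).2.1 ρ hρ)
  have hdiff : ∀ n, partialProd y n - x = seriesMul (partialProd y n) (ε n) := by
    intro n
    have e1 : ι ⟨_, (hUV n).1⟩ * ι ⟨_, (hUV n).2.1⟩ = 1 := Subtype.ext (hUV n).2.2.2.2.1
    have e2 : ι ⟨_, hYP n⟩ * ι ⟨_, (hUV n).1⟩ - ι ⟨_, hYP n⟩ * ι ⟨_, hZom n⟩ =
        ι ⟨_, hYP n⟩ * ι ⟨_, (hUV n).1⟩ *
          (ι ⟨_, (hUV n).2.1⟩ * (ι ⟨_, (hUV n).1⟩ - ι ⟨_, hZom n⟩)) := by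
      calc _ = ι ⟨_, hYP n⟩ * (ι ⟨_, (hUV n).1⟩ - ι ⟨_, hZom n⟩) := by ring
        _ = ι ⟨_, hYP n⟩ * (ι ⟨_, (hUV n).1⟩ - ι ⟨_, hZom n⟩) *
            (ι ⟨_, (hUV n).1⟩ * ι ⟨_, (hUV n).2.1⟩) := by rw [e1, mul_one]
        _ = _ := by ring
    rw [hprod n]
    conv_lhs => rw [h.prod_eq hC (n := n) le_top]
    exact congrArg Subtype.val e2
  obtain ⟨c, hc⟩ := (h.start_mem.2.1 r hr).1
  have hc0 := hc.nonneg
  have hwt : Filter.Tendsto (fun n => weight p (r / 2) (J n)) Filter.atTop (𝓝 0) := by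
    have h2 := tendsto_rpow_atBot_of_base_gt_one (p : ℝ) one_lt_p
    refine h2.comp ?_
    rw [Filter.tendsto_neg_atBot_iff]
    have h3 : Filter.Tendsto (fun n => (J n : ℝ)) Filter.atTop Filter.atTop :=
      tendsto_natCast_atTop_atTop.comp hJ
    simpa using h3.const_mul_atTop (half_pos hr)
  have hbound : ∀ᶠ n in Filter.atTop,
      w p r (partialProd y n - x) ≤ ENNReal.ofReal (c * weight p (r / 2) (J n)) := by
    filter_upwards [hb r hr, hwt.eventually (gt_mem_nhds one_pos)] with n hn hlt
    have hεb : IsBd p r (weight p (r / 2) (J n)) (ε n) := by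
      have h1 := ((hUV n).2.2.2.1.isBd hr).mul hn
      rwa [(hUV n).2.2.2.2.2, norm_one, one_mul] at h1
    refine w_le_of_isBd ?_
    have hP : IsBd p r c (partialProd y n) := by
      -- P_n = x + P_n ε_n with w_r(ε_n) < 1 yields w_r(P_n) ≤ w_r(x)'s bound c, uniformly for large
      -- n.
      refine isBd_of_self_bound hc0 hlt (weight_pos _ _).le ((hyP n).2.1 r hr).1 fun d hd => ?_
      have h1 : partialProd y n = x + seriesMul (partialProd y n) (ε n) := by
        rw [← hdiff]; abel
      rw [h1]
      refine hc.add_max ?_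
      rw [mul_comm]
      exact hd.mul hεb
    rw [hdiff]
    exact hP.mul hεb
  refine tendsto_of_tendsto_of_tendsto_of_le_of_le' tendsto_const_nhds ?_
    (Filter.Eventually.of_forall fun _ => zero_le) hbound
  have h1 := ENNReal.tendsto_ofReal (hwt.const_mul c)
  simpa using h1

theorem hasSlopeFactorization_omega {q : ℝ} (hq : DiscreteNorm E q) (hC : IsStable p C)
    {x : ℚ → E} (hx : x ∈ omega p C) {j : ℚ} (hj : IsLeast (Function.support x) j) :
    HasSlopeFactorization p (omega p C) x := by
  classical
  have hxj : x j ≠ 0 := hj.1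
  have hxlt : ∀ n, n < j → x n = 0 := fun n hn => by
    by_contra h
    exact absurd (hj.2 h) hn.not_ge
  have hj0 : 0 ≤ j := by
    by_contra! h
    exact hxj (hx.1 j h)
  obtain ⟨htj, htj'⟩ := hC.tPow_mem x hx.2.2 j hxj
  have htm : ∀ i : ℚ, ∀ r, (tPow i : ℚ → E) ∈ gaussSet p E r := fun i r =>
    single_mem_gaussSet r i 1
  have htom : (tPow j : ℚ → E) ∈ omega p C :=
    ⟨fun n hn => by simp [tPow, (hn.trans_le hj0).ne], fun r _ => htm j r, htj⟩
  set x' : ℚ → E := seriesMul (tPow (-j)) x with hx'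
  have hx'n : ∀ n, x' n = x (n + j) := fun n => by rw [hx', tPow_seriesMul, sub_neg_eq_add]
  have hxx' : x = seriesMul (tPow j) x' := by
    funext n; rw [tPow_seriesMul, hx'n, sub_add_cancel]
  have hx'om : x' ∈ omega p C :=
    ⟨fun n hn => by rw [hx'n]; exact hxlt _ (by linarith),
      fun r hr => mul_mem_gaussSet (htm _ r) (hx.2.1 r hr),
      hC.mul_mem 1 one_pos _ htj' _ hx.2.2 (htm _ _) (hx.2.1 1 one_pos)⟩
  have hx'0 : x' 0 ≠ 0 := by rw [hx'n, zero_add]; exact hxj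
  obtain ⟨Z, Y, s, N, hch, hflat⟩ := exists_divisionChain hq hC hx'om hx'0
  rcases eq_or_ne N ⊤ with rfl | hN
  · obtain ⟨y, hy, hconv⟩ := hch.exists_convergent hq hC
    exact ⟨⊤, seriesOne, j, y, s, x', isUnitOf_one hC, fun _ => rfl, htom, fun i _ => hy i,
      fun i i' hi hi' => hch.slope_lt hi hi', fun _ => hch.tendsto_slope hq, hx'om,
      fun n hn => absurd hn (ENat.top_ne_natCast n), fun _ => hconv,
      by rw [seriesOne_seriesMul, ← hxx']⟩
  · lift N to ℕ using hN
    have hZf := hflat N rfl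
    have hZm := hch.mem (n := N) le_rfl
    cases N with
    | zero =>
      rw [hch.start] at hZf
      obtain ⟨d, hd, -, hxd⟩ := exists_inverse_of_isFlat hq hC hx'om hZf
      refine ⟨0, x', j, fun _ => seriesOne, s, seriesOne, ⟨hx'om, d, hd, hxd⟩,
        fun h => absurd rfl h, htom, fun i hi => absurd hi (by simp),
        fun i i' _ hi => absurd hi (by simp), fun h => absurd h (by simp), one_mem_omega hC,
        fun n hn => ?_, fun h => absurd h (by simp), ?_⟩
      · have : n = 0 := by exact_mod_cast hn.symm
        rw [this]; rfl
      · rw [seriesMul_one, seriesMul_comm]; exact hxx'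
    | succ m =>
      have hst : ∀ i, i ≤ m → StepData p C (Z i) (Y i) (Z (i + 1)) (s i) := fun i hi =>
        hch.step i (by exact_mod_cast Nat.lt_succ_of_le hi)
      have hYm := (hst m le_rfl).left_mem
      -- The final flat quotient is absorbed into the last pure factor. This is why a unit c is
      -- needed only when there are no factors.
      set y : ℕ → ℚ → E := fun i => if i = m then seriesMul (Y m) (Z (m + 1)) else Y i with hy
      have hPP : partialProd y (m + 1) = x' := by
        have h1 : partialProd y m = partialProd Y m :=
          partialProd_congr fun i hi => by simp [hy, hi.ne]
        rw [hch.prod_eq hC (n := m + 1) le_rfl, partialProd, partialProd, h1, omega_mul_assoc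
          (partialProd_mem_omega hC fun i hi => (hst i hi.le).left_mem) hYm hZm]
        simp [hy]
      refine ⟨(m + 1 : ℕ), seriesOne, j, y, s, x', isUnitOf_one hC, fun _ => rfl, htom,
        fun i hi => ?_, fun i i' hi hi' => hch.slope_lt hi hi', fun h => absurd h
        (ENat.natCast_ne_top _), hx'om, fun n hn => ?_, fun h => absurd h (ENat.natCast_ne_top _),
        by rw [seriesOne_seriesMul, ← hxx']⟩
      · have him : i ≤ m := by
          have : i < m + 1 := by exact_mod_cast hi
          lia
        by_cases h : i = m
        · subst h
          simp only [hy, if_pos rfl]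
          exact ⟨mul_mem_omega hC hYm hZm, IsPureOfSlope.mul_isFlat hq hYm hZm hZf (hst i le_rfl).pure⟩
        · simp only [hy, if_neg h]
          exact ⟨(hst i him).left_mem, (hst i him).pure⟩
      · have : m + 1 = n := by exact_mod_cast hn
        rw [← this, hPP]

end Factorization

/-! ### The rings of the statement as instances of `omega`. -/

section Comparison

variable {E : Type*} [NormedField E] [IsUltrametricDist E]
  {p : ℕ} [hpr : Fact p.Prime]

lemma isBd_of_w_lt_top {r : ℝ} {x : ℚ → E} (h : w p r x < ⊤) : IsBd p r (w p r x).toReal x :=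
  fun n => by
    rw [← ENNReal.ofReal_le_iff_le_toReal h.ne]
    exact le_iSup (fun i : ℚ => ENNReal.ofReal (‖x i‖ * (p : ℝ) ^ (-(r * (i : ℝ))))) n

/-- Well-ordering may be tested with unweighted norms or with w_r for all r > 0: weights are at most
1 on nonnegative exponents, and on a descending sequence they are bounded below by the weight of its
first member. -/
lemma omegaImmAn_eq : OmegaImmAn p E = {x | (∀ n, n < 0 → x n = 0) ∧
    ∀ r : ℝ, 0 < r → x ∈ gaussSet p E r} := by
  ext x
  constructor
  · rintro ⟨h0, hwf, hw⟩
    refine ⟨h0, fun r hr => ⟨⟨_, isBd_of_w_lt_top (hw r hr)⟩, fun ε hε => ?_⟩⟩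
    refine (hwf (Real.logb p ε)).mono fun n hn => ?_
    rw [Set.mem_ofPred_eq, Real.rpow_logb p_pos one_lt_p.ne' hε]
    refine lt_of_lt_of_le (show ε < size p r x n from hn) ?_
    rcases lt_or_ge n 0 with h | h
    · simp [size, h0 n h]
    · refine mul_le_of_le_one_right (norm_nonneg _) (weight_le_one ?_)
      exact mul_nonneg hr.le (by exact_mod_cast h)
  · rintro ⟨h0, hg⟩
    refine ⟨h0, fun ρ => ?_, fun r hr => ?_⟩
    · rw [Set.isWF_iff_no_descending_seq]
      intro f hf hmem
      have hw := weight_pos (p := p) 1 (f 0)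
      have hρ := Real.rpow_pos_of_pos (p_pos (p := p)) ρ
      have h1 := (hg 1 one_pos).2 ((p : ℝ) ^ ρ * weight p 1 (f 0)) (mul_pos hρ hw)
      rw [Set.isWF_iff_no_descending_seq] at h1
      refine h1 f hf fun n => ?_
      have h2 : (p : ℝ) ^ ρ < ‖x (f n)‖ := hmem n
      have h3 : weight p 1 (f 0) ≤ weight p 1 (f n) := by
        refine weight_le_weight ?_
        have : f n ≤ f 0 := hf.antitone (Nat.zero_le n)
        simpa using this
      exact mul_lt_mul h2 h3 hw (norm_nonneg _)
    · obtain ⟨c, hc⟩ := (hg r hr).1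
      exact (iSup_le fun i => ENNReal.ofReal_le_ofReal (hc i) :
        w p r x ≤ ENNReal.ofReal c).trans_lt ENNReal.ofReal_lt_top

variable [CompleteSpace E]

lemma omegaImmAn_eq_omega : OmegaImmAn p E = omega p Set.univ := by
  rw [omegaImmAn_eq]
  ext x
  simp [omega]

lemma isStable_univ : IsStable p (Set.univ : Set (ℚ → E)) :=
  ⟨trivial, fun _ _ _ _ => trivial, fun _ _ _ => trivial, fun _ _ _ _ => ⟨trivial, trivial⟩,
    fun _ _ _ => trivial, fun _ _ _ _ _ _ _ _ => trivial, fun _ _ _ _ _ => trivial⟩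

/-- The series with integral exponents. -/
def integralSeries (E : Type*) [NormedField E] : Set (ℚ → E) :=
  {x | ∀ n : ℚ, (¬ ∃ m : ℤ, n = m) → x n = 0}

lemma isStable_integralSeries : IsStable p (integralSeries E) where
  one_mem n hn := by
    have : n ≠ 0 := fun h => hn ⟨0, by simp [h]⟩
    simp [seriesOne, tPow, this]
  add_mem x hx y hy n hn := by simp [hx n hn, hy n hn]
  smul_mem a x hx n hn := by simp [hx n hn]
  tPow_mem x hx j hj := by
    obtain ⟨m, rfl⟩ : ∃ m : ℤ, j = m := by
      by_contra h
      exact hj (hx j h)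
    refine ⟨fun n hn => ?_, fun n hn => ?_⟩
    · have : n ≠ m := fun h => hn ⟨m, h⟩
      simp [tPow, this]
    · have : n ≠ -m := fun h => hn ⟨-m, by simp [h]⟩
      simp [tPow, this]
  trunc_mem x hx j n hn := by simp [trunc, hx n hn]
  mul_mem r _ x hx y hy _ _ n hn := by
    unfold seriesMul
    convert tsum_zero with i
    by_cases h : ∃ m : ℤ, i = m
    · obtain ⟨m, rfl⟩ := h
      rw [hy (n - m) fun ⟨l, hl⟩ => hn ⟨l + m, by push_cast; linarith⟩, mul_zero]
    · rw [hx i h, zero_mul]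
  closed r _ := closedAt_vanish r _

lemma omegaAn_eq_omega : OmegaAn p E = omega p (integralSeries E) := by
  ext x
  constructor
  · rintro ⟨h0, hw⟩
    refine ⟨fun n hn => h0 n ?_, fun r hr => ⟨⟨_, isBd_of_w_lt_top (hw r hr)⟩, fun ε hε => ?_⟩,
      fun n hn => h0 n ?_⟩
    · rintro ⟨m, rfl⟩
      exact absurd hn (by simp)
    · have h1 : (Set.range (Nat.cast : ℕ → ℚ)).IsPWO := by
        rw [← Set.image_univ]
        exact (Set.isWF_univ_iff.2 inferInstance).isPWO.image_of_monotone Nat.mono_cast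
      refine h1.isWF.mono fun n hn => ?_
      by_contra hcon
      have : x n = 0 := h0 n fun ⟨m, hm⟩ => hcon ⟨m, hm.symm⟩
      simp [size, this] at hn
      exact absurd hn hε.not_gt
    · rintro ⟨m, rfl⟩
      exact hn ⟨m, by simp⟩
  · rintro ⟨h0, hg, hC⟩
    refine ⟨fun n hn => ?_, fun r hr => ?_⟩
    · rcases lt_or_ge n 0 with h | h
      · exact h0 n h
      · refine hC n ?_
        rintro ⟨m, rfl⟩
        have hm : 0 ≤ m := by exact_mod_cast h
        lift m to ℕ using hm
        exact hn ⟨m, by simp⟩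
    · obtain ⟨c, hc⟩ := (hg r hr).1
      exact (w_le_of_isBd hc).trans_lt ENNReal.ofReal_lt_top

lemma exists_isLeast_support_omegaAn {x : ℚ → E} (hx : x ∈ OmegaAn p E) (hx0 : x ≠ 0) :
    ∃ j : ℚ, IsLeast (Function.support x) j := by
  classical
  have hex : ∃ m : ℕ, x m ≠ 0 := by
    by_contra! h
    refine hx0 (funext fun n => ?_)
    by_cases hn : ∃ m : ℕ, n = m
    · obtain ⟨m, rfl⟩ := hn
      exact h m
    · exact hx.1 n hn
  refine ⟨Nat.find hex, Nat.find_spec hex, fun n hn => ?_⟩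
  obtain ⟨m, rfl⟩ : ∃ m : ℕ, n = m := by
    by_contra h
    exact hn (hx.1 n h)
  exact_mod_cast Nat.find_min' hex hn

end Comparison

/-! ### Discreteness, completeness and residue field of the coefficient field. -/

section Base

variable {p : ℕ} [hpr : Fact p.Prime] {O : Type*} [CommRing O] [IsDomain O]
  {E : Type*} [NormedField E] [Algebra O E]

/-- The unit ball of `E` is `O`, and the norm is normalized by `‖p‖ = p⁻¹`. -/
structure IsUnitBall (p : ℕ) (O E : Type*) [CommRing O] [NormedField E] [Algebra O E] : Prop where
  norm_le_one_iff : ∀ a : E, ‖a‖ ≤ 1 ↔ a ∈ Set.range (algebraMap O E)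
  norm_p : ‖(p : E)‖ = (p : ℝ)⁻¹

namespace IsUnitBall

variable (hB : IsUnitBall p O E)
include hB

lemma norm_algebraMap_le (o : O) : ‖algebraMap O E o‖ ≤ 1 := (hB.norm_le_one_iff _).2 ⟨o, rfl⟩

lemma norm_p_lt_one : ‖(p : E)‖ < 1 := by
  rw [hB.norm_p]; exact inv_lt_one_of_one_lt₀ one_lt_p

lemma p_ne_zero : (p : E) ≠ 0 := norm_pos_iff.1 (by rw [hB.norm_p]; exact inv_pos.2 p_pos)

lemma norm_unit {u : O} (hu : IsUnit u) : ‖algebraMap O E u‖ = 1 := by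
  obtain ⟨v, hv⟩ := hu.exists_right_inv
  refine le_antisymm (hB.norm_algebraMap_le u) ?_
  have h1 : ‖algebraMap O E u‖ * ‖algebraMap O E v‖ = 1 := by
    rw [← norm_mul, ← map_mul, hv, map_one, norm_one]
  have h2 := hB.norm_algebraMap_le v
  have h3 := norm_nonneg (algebraMap O E u)
  nlinarith

variable [IsFractionRing O E]

lemma norm_lt_one_iff {o : O} : ‖algebraMap O E o‖ < 1 ↔ ¬ IsUnit o := by
  constructor
  · intro h hu
    rw [hB.norm_unit hu] at h
    exact lt_irrefl _ h
  · intro h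
    refine lt_of_le_of_ne (hB.norm_algebraMap_le o) fun h1 => h ?_
    have ho : algebraMap O E o ≠ 0 := norm_pos_iff.1 (by rw [h1]; exact one_pos)
    obtain ⟨v, hv⟩ := (hB.norm_le_one_iff (algebraMap O E o)⁻¹).1 (by rw [norm_inv, h1, inv_one])
    refine .of_mul_eq_one v (IsFractionRing.injective O E ?_)
    rw [map_mul, hv, map_one, mul_inv_cancel₀ ho]

variable [IsDiscreteValuationRing O]

lemma norm_lt_one_iff_mem {o : O} : ‖algebraMap O E o‖ < 1 ↔ IsLocalRing.residue O o = 0 := by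
  rw [hB.norm_lt_one_iff, IsLocalRing.residue_eq_zero_iff, IsLocalRing.mem_maximalIdeal,
    mem_nonunits_iff]

lemma norm_irreducible_lt {ϖ : O} (hϖ : Irreducible ϖ) : ‖algebraMap O E ϖ‖ < 1 :=
  hB.norm_lt_one_iff.2 hϖ.not_isUnit

lemma norm_le_irreducible {ϖ : O} (hϖ : Irreducible ϖ) {a : E} (ha : ‖a‖ < 1) :
    ‖a‖ ≤ ‖algebraMap O E ϖ‖ := by
  obtain ⟨o, rfl⟩ := (hB.norm_le_one_iff a).1 ha.le
  have h1 : o ∈ IsLocalRing.maximalIdeal O := by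
    rw [← IsLocalRing.residue_eq_zero_iff]; exact hB.norm_lt_one_iff_mem.1 ha
  rw [(IsDiscreteValuationRing.irreducible_iff_uniformizer ϖ).1 hϖ, Ideal.mem_span_singleton] at h1
  obtain ⟨c, rfl⟩ := h1
  rw [map_mul, norm_mul]
  exact mul_le_of_le_one_right (norm_nonneg _) (hB.norm_algebraMap_le c)

lemma norm_irreducible_pos {ϖ : O} (hϖ : Irreducible ϖ) : 0 < ‖algebraMap O E ϖ‖ := by
  rw [norm_pos_iff, Ne, FaithfulSMul.algebraMap_eq_zero_iff]
  exact hϖ.ne_zero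

/-- The generator of the value group is q = |ϖ|⁻¹ for a uniformizer ϖ. -/
lemma discreteNorm : ∃ q : ℝ, DiscreteNorm E q := by
  obtain ⟨ϖ, hϖ⟩ := IsDiscreteValuationRing.exists_irreducible O
  have h0 := hB.norm_irreducible_pos hϖ
  refine ⟨‖algebraMap O E ϖ‖⁻¹, (one_lt_inv₀ h0).2 (hB.norm_irreducible_lt hϖ), ?_⟩
  have key : ∀ o : O, o ≠ 0 → ∃ n : ℕ, ‖algebraMap O E o‖ = ‖algebraMap O E ϖ‖ ^ n := by
    intro o ho
    obtain ⟨n, u, rfl⟩ := IsDiscreteValuationRing.eq_unit_mul_pow_irreducible ho hϖ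
    refine ⟨n, ?_⟩
    rw [map_mul, norm_mul, hB.norm_unit u.isUnit, one_mul, map_pow, norm_pow]
  intro a ha
  rcases le_total ‖a‖ 1 with h | h
  · obtain ⟨o, rfl⟩ := (hB.norm_le_one_iff a).1 h
    obtain ⟨n, hn⟩ := key o (by rintro rfl; simp at ha)
    exact ⟨-n, by rw [hn, zpow_neg, inv_zpow, inv_inv, zpow_natCast]⟩
  · obtain ⟨o, ho⟩ := (hB.norm_le_one_iff a⁻¹).1 (by
      rw [norm_inv]; exact inv_le_one_of_one_le₀ h)
    obtain ⟨n, hn⟩ := key o (by rintro rfl; simp at ho; exact ha ho.symm)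
    rw [ho, norm_inv] at hn
    exact ⟨n, by rw [zpow_natCast, inv_pow, ← hn, inv_inv]⟩

end IsUnitBall

/-- Finiteness over W(k) reduces Cauchy sequences to coordinates in the p-adically complete ring
W(k), with respect to a finite generating set that need not be a basis. -/
lemma completeSpace_of_finite {k : Type*} [Field k] [IsAlgClosed k] [CharP k p]
    [Algebra (WittVector p k) O] [Module.Finite (WittVector p k) O] [IsUltrametricDist E]
    (hB : IsUnitBall p O E) : CompleteSpace E := by
  refine Metric.complete_of_convergent_controlled_sequences (fun n => (p : ℝ)⁻¹ ^ n)
    (fun n => pow_pos (inv_pos.2 p_pos) n) fun u hu => ?_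
  have hp0 := hB.p_ne_zero
  -- Consecutive differences are at most p^(-n), so they are p^n times an element of 𝒪.
  have hd : ∀ n, ∃ d : O, u (n + 1) - u n = (p : E) ^ n * algebraMap O E d := fun n => by
    have h1 := hu n (n + 1) n n.le_succ le_rfl
    rw [dist_eq_norm] at h1
    obtain ⟨d, hd⟩ := (hB.norm_le_one_iff (((p : E) ^ n)⁻¹ * (u (n + 1) - u n))).1 (by
      rw [norm_mul, norm_inv, norm_pow, hB.norm_p, inv_mul_le_iff₀ (pow_pos (inv_pos.2 p_pos) n),
        mul_one]
      exact h1.le)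
    exact ⟨d, by rw [hd, mul_inv_cancel_left₀ (pow_ne_zero n hp0)]⟩
  choose d hd using hd
  obtain ⟨m, e, he⟩ := Module.Finite.exists_fin (R := WittVector p k) (M := O)
  have hc : ∀ n, ∃ c : Fin m → WittVector p k, ∑ j, c j • e j = d n := fun n =>
    (Submodule.mem_span_range_iff_exists_fun _).1 (by rw [he]; trivial)
  choose c hc using hc
  set f : Fin m → ℕ → WittVector p k := fun j n => ∑ i ∈ Finset.range n, (p : WittVector p k) ^ i * c i j
    with hf
  have hlim : ∀ j, ∃ L : WittVector p k, ∀ n, (p : WittVector p k) ^ n ∣ f j n - L := by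
    intro j
    have hcau : ∀ {a b : ℕ}, a ≤ b → f j a ≡ f j b [SMOD ((Ideal.span {(p : WittVector p k)}) ^ a •
        ⊤ : Submodule (WittVector p k) (WittVector p k))] := by
      intro a b hab
      rw [smul_eq_mul, Ideal.mul_top, Ideal.span_singleton_pow]
      refine SModEq.symm ?_
      rw [SModEq.sub_mem, Ideal.mem_span_singleton, hf]
      simp only
      rw [Finset.sum_range_sub_sum_range hab]
      refine Finset.dvd_sum fun i hi => ?_
      simp only [Finset.mem_filter] at hi
      exact (pow_dvd_pow _ hi.2).mul_right _
    obtain ⟨L, hL⟩ := IsPrecomplete.prec' (f j) hcau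
    refine ⟨L, fun n => ?_⟩
    have := hL n
    rwa [smul_eq_mul, Ideal.mul_top, Ideal.span_singleton_pow, SModEq.sub_mem,
      Ideal.mem_span_singleton] at this
  choose L hL using hlim
  have hu_eq : ∀ n, u n = u 0 + algebraMap O E (∑ j, f j n • e j) := by
    intro n
    induction n with
    | zero => simp [hf]
    | succ n ih =>
      have h1 : u (n + 1) = u n + (p : E) ^ n * algebraMap O E (d n) := by rw [← hd]; ring
      have h2 : ∑ j, f j (n + 1) • e j = (∑ j, f j n • e j) + (p : O) ^ n * d n := by
        rw [← hc n, Finset.mul_sum, ← Finset.sum_add_distrib]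
        refine Finset.sum_congr rfl fun j _ => ?_
        simp only [hf, Finset.sum_range_succ, add_smul, mul_smul]
        congr 1
        simp [Algebra.smul_def]
      rw [h1, ih, h2, map_add, map_mul, map_pow, map_natCast]
      ring
  refine ⟨u 0 + algebraMap O E (∑ j, L j • e j), ?_⟩
  rw [tendsto_iff_norm_sub_tendsto_zero]
  have hz : Filter.Tendsto (fun n => (p : ℝ)⁻¹ ^ n) Filter.atTop (𝓝 0) :=
    tendsto_pow_atTop_nhds_zero_of_lt_one (inv_nonneg.2 p_pos.le) (inv_lt_one_of_one_lt₀ one_lt_p)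
  refine squeeze_zero (fun _ => norm_nonneg _) (fun n => ?_) hz
  choose g hg using fun j => hL j n
  have h1 : u n - (u 0 + algebraMap O E (∑ j, L j • e j)) =
      (p : E) ^ n * algebraMap O E (∑ j, g j • e j) := by
    rw [hu_eq n, add_sub_add_left_eq_sub, ← map_sub, ← Finset.sum_sub_distrib,
      ← map_natCast (algebraMap O E), ← map_pow, ← map_mul, Finset.mul_sum]
    congr 1
    refine Finset.sum_congr rfl fun j _ => ?_
    rw [← sub_smul, hg j]
    simp [Algebra.smul_def, mul_assoc]
  rw [h1, norm_mul, norm_pow, hB.norm_p]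
  exact mul_le_of_le_one_right (pow_nonneg (inv_nonneg.2 p_pos.le) n) (hB.norm_algebraMap_le _)

/-- The residue field of 𝒪 is integral over the algebraically closed field k, hence equal to it, and
p-power roots of a Witt vector Teichmüller lift come from roots in k. -/
lemma exists_teichmuller_residue [IsFractionRing O E] [IsDiscreteValuationRing O]
    {k : Type*} [Field k] [IsAlgClosed k] [CharP k p]
    [Algebra (WittVector p k) O] [Module.Finite (WittVector p k) O]
    (hB : IsUnitBall p O E) (o : O) : ∃ t : O, IsLocalRing.residue O t = IsLocalRing.residue O o ∧
      ∀ m : ℕ, ∃ v : O, v ^ p ^ m = t := by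
  let f : WittVector p k →+* IsLocalRing.ResidueField O :=
    (IsLocalRing.residue O).comp (algebraMap (WittVector p k) O)
  have hfint : f.IsIntegral := by
    refine RingHom.IsIntegral.trans _ _ ?_ (RingHom.isIntegral_of_surjective _
      IsLocalRing.residue_surjective)
    exact fun x => Algebra.IsIntegral.isIntegral x
  have hfp : ∀ a ∈ Ideal.span {(p : WittVector p k)}, f a = 0 := by
    intro a ha
    obtain ⟨b, rfl⟩ := Ideal.mem_span_singleton.1 ha
    have : f p = 0 := by
      change IsLocalRing.residue O (algebraMap (WittVector p k) O p) = 0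
      rw [← hB.norm_lt_one_iff_mem (E := E), map_natCast, map_natCast]
      exact hB.norm_p_lt_one
    rw [map_mul, this, zero_mul]
  let g : k →+* IsLocalRing.ResidueField O :=
    (Ideal.Quotient.lift _ f hfp).comp (WittVector.quotientPEquiv (p := p) (k := k)).symm.toRingHom
  have hg : ∀ a : WittVector p k, g (WittVector.constantCoeff a) = f a := by
    intro a
    have h1 : (WittVector.quotientPEquiv (p := p) (k := k)).symm (WittVector.constantCoeff a) =
        Ideal.Quotient.mk _ a := by
      rw [RingEquiv.symm_apply_eq]; rfl
    change Ideal.Quotient.lift _ f hfp (WittVector.quotientPEquiv.symm _) = f a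
    rw [h1, Ideal.Quotient.lift_mk]
  have hgint : g.IsIntegral := by
    refine RingHom.IsIntegral.tower_top (WittVector.constantCoeff (p := p) (R := k)) g ?_
    have : g.comp WittVector.constantCoeff = f := RingHom.ext hg
    rw [this]; exact hfint
  obtain ⟨c, hc⟩ := IsAlgClosed.ringHom_bijective_of_isIntegral g hgint |>.2
    (IsLocalRing.residue O o)
  refine ⟨algebraMap _ O (WittVector.teichmuller p c), ?_, fun m => ?_⟩
  · rw [← hc]
    have := hg (WittVector.teichmuller p c)
    rw [show WittVector.constantCoeff (WittVector.teichmuller p c) = c from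
      WittVector.teichmuller_coeff_zero p c] at this
    exact this.symm
  · obtain ⟨b, hb⟩ := IsAlgClosed.exists_pow_nat_eq c (pow_pos hpr.out.pos m)
    exact ⟨algebraMap _ O (WittVector.teichmuller p b), by rw [← map_pow, ← map_pow, hb]⟩

end Base

/-! ### Γ^imm as the unit ball at radius 0, and its reduction. -/

section UnitBall

variable {p : ℕ} [hpr : Fact p.Prime] {O : Type*} [CommRing O] [IsDomain O]
  [IsDiscreteValuationRing O] {E : Type*} [NormedField E] [IsUltrametricDist E] [CompleteSpace E]
  [Algebra O E] [IsFractionRing O E]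

lemma size_zero_weight (x : ℚ → E) (n : ℚ) : size p 0 x n = ‖x n‖ := by simp [size]

lemma mem_gammaImm_iff (hB : IsUnitBall p O E) {x : ℚ → E} :
    x ∈ GammaImm p O E ↔ x ∈ gaussSet p E 0 ∧ IsBd p 0 1 x := by
  constructor
  · rintro ⟨h1, h2⟩
    have hb : IsBd p 0 1 x := fun n => by
      rw [size_zero_weight]; exact (hB.norm_le_one_iff _).2 (h1 n)
    refine ⟨⟨⟨1, hb⟩, fun ε hε => ?_⟩, hb⟩
    have := h2 (Real.logb p ε)
    rw [Real.rpow_logb p_pos one_lt_p.ne' hε] at this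
    simpa only [size_zero_weight] using this
  · rintro ⟨⟨-, h1⟩, h2⟩
    refine ⟨fun n => (hB.norm_le_one_iff _).1 (by rw [← size_zero_weight (p := p)]; exact h2 n),
      fun r => ?_⟩
    simpa only [size_zero_weight] using h1 _ (Real.rpow_pos_of_pos (p_pos (p := p)) r)

lemma coe_pow_gauss {r : ℝ} (x : GaussRing p E r) (n : ℕ) : (x ^ n).1 = seriesPow x.1 n := by
  induction n with
  | zero => simp [seriesPow, partialProd]
  | succ n ih => rw [pow_succ, coe_mul_gauss, ih]; rfl

/-- The series with coefficients of norm at most one. -/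
def ballRing (p : ℕ) [Fact p.Prime] (E : Type*) [NormedField E] [IsUltrametricDist E]
    [CompleteSpace E] : Subring (GaussRing p E 0) where
  carrier := {x | IsBd p 0 1 x.1}
  mul_mem' hx hy := by
    have := IsBd.mul hx hy
    rwa [one_mul] at this
  one_mem' := isBd_one 0
  add_mem' hx hy := IsBd.add hx hy
  zero_mem' := (isBd_zero 0).mono zero_le_one
  neg_mem' hx := IsBd.neg hx

lemma mem_gammaImm_iff_ball (hB : IsUnitBall p O E) {x : ℚ → E} :
    x ∈ GammaImm p O E ↔ ∃ a : ballRing p E, a.1.1 = x := by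
  rw [mem_gammaImm_iff hB]
  exact ⟨fun h => ⟨⟨⟨x, h.1⟩, h.2⟩, rfl⟩, by rintro ⟨a, rfl⟩; exact ⟨a.1.2, a.2⟩⟩

/-- The multiples of constants, as a module structure on series, are products with constants. -/
lemma algebra_smul_eq (o : O) (x : ℚ → E) : o • x = (algebraMap O E o) • x := by
  funext n; simp [Algebra.smul_def]

/-- The reduction ring has no nilpotents. If x had a coefficient of norm 1, the first such exponent
would be dominant at radius 0, and by multiplicativity every power would also have a coefficient of
norm 1. -/
lemma IsBd.of_pow (hB : IsUnitBall p O E) {ϖ : O} (hϖ : Irreducible ϖ) {x : GaussRing p E 0}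
    (hx : IsBd p 0 1 x.1) {m : ℕ} (h : ∀ n, ‖(x ^ m).1 n‖ < 1) :
    IsBd p 0 ‖algebraMap O E ϖ‖ x.1 := by
  by_contra hcon
  have hwf := x.2.2 _ (hB.norm_irreducible_pos hϖ)
  have hne : {n | ‖algebraMap O E ϖ‖ < size p 0 x.1 n}.Nonempty := by
    by_contra he
    rw [Set.not_nonempty_iff_eq_empty] at he
    refine hcon fun n => ?_
    by_contra! hn
    have : n ∈ {n | ‖algebraMap O E ϖ‖ < size p 0 x.1 n} := hn
    rw [he] at this
    exact this
  set a := hwf.min hne with ha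
  have hone : ∀ n, ‖algebraMap O E ϖ‖ < size p 0 x.1 n → size p 0 x.1 n = 1 := fun n hn => by
    refine le_antisymm (hx n) ?_
    by_contra! hlt
    rw [size_zero_weight] at hn hlt
    exact absurd (hB.norm_le_irreducible hϖ hlt) hn.not_ge
  have ha1 : size p 0 x.1 a = 1 := hone a (hwf.min_mem hne)
  have hdom : Dom p 1 0 x.1 a := by
    refine ⟨fun h0 => by simp [size, h0] at ha1, fun n => ⟨by rw [ha1]; exact hx n, fun hn => ?_⟩⟩
    rw [ha1]
    refine lt_of_le_of_lt ?_ (hB.norm_irreducible_lt hϖ)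
    by_contra! hlt
    have := hwf.min_le hne hlt
    linarith
  have key : ∀ m : ℕ, ∃ b, Dom p 1 0 (x ^ m).1 b ∧ size p 0 (x ^ m).1 b = 1 := by
    intro m
    induction m with
    | zero =>
      refine ⟨0, ?_, by simp [size, seriesOne, tPow]⟩
      refine ⟨by simp [seriesOne, tPow], fun n => ⟨?_, fun hn => ?_⟩⟩
      · rw [size_zero_exp]
        have := (isBd_one (E := E) (p := p) 0) n
        simpa [seriesOne, tPow] using this
      · have hn0 : n ≠ 0 := by rintro rfl; exact lt_irrefl _ hn
        simp [size, seriesOne, tPow, hn0]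
    | succ m ih =>
      obtain ⟨b, hb, hb1⟩ := ih
      refine ⟨b + a, ?_, ?_⟩
      · rw [pow_succ]
        exact hb.seriesMul one_ne_zero (x ^ m).2 x.2 hdom
      · rw [pow_succ, coe_mul_gauss, hb.size_seriesMul one_ne_zero (x ^ m).2 x.2 hdom, hb1, ha1,
          one_mul]
  obtain ⟨b, -, hb⟩ := key m
  rw [size_zero_weight] at hb
  exact absurd hb (h b).ne

section Reduction

lemma residue_eq_iff (hB : IsUnitBall p O E) {b c : O} :
    IsLocalRing.residue O b = IsLocalRing.residue O c ↔
      ‖algebraMap O E b - algebraMap O E c‖ < 1 := by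
  rw [← sub_eq_zero, ← map_sub, ← map_sub, ← hB.norm_lt_one_iff_mem]

lemma exists_reduction (hB : IsUnitBall p O E) {x : ℚ → E} (hx : x ∈ GammaImm p O E) :
    ∃ a, IsReduction (O := O) x a := by
  obtain ⟨ϖ, hϖ⟩ := IsDiscreteValuationRing.exists_irreducible O
  have hx' := (mem_gammaImm_iff hB).1 hx
  choose b hb using hx.1
  refine ⟨⟨fun n => IsLocalRing.residue O (b n), ?_⟩, fun n => ⟨b n, hb n, rfl⟩⟩
  refine ((hx'.1.2 _ (hB.norm_irreducible_pos hϖ)).mono fun n hn => ?_).isPWO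
  by_contra hcon
  simp only [Set.mem_ofPred_eq, not_lt, size_zero_weight, ← hb n] at hcon
  exact hn ((hB.norm_lt_one_iff_mem (E := E)).1 (hcon.trans_lt (hB.norm_irreducible_lt hϖ)))

lemma IsReduction.unique {x : ℚ → E} {a a' : HahnSeries ℚ (IsLocalRing.ResidueField O)}
    (h : IsReduction x a) (h' : IsReduction x a') : a = a' := by
  ext n
  obtain ⟨b, hb, hba⟩ := h n
  obtain ⟨c, hc, hca⟩ := h' n
  rw [← hba, ← hca, IsFractionRing.injective O E (hb.trans hc.symm)]

/-- Outside the finite antidiagonal of the two residual supports, every term of the product sum has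
norm below 1, and so does their total by `norm_tsum_lt`. -/
lemma IsReduction.mul (hB : IsUnitBall p O E) {x y : ℚ → E}
    {a a' : HahnSeries ℚ (IsLocalRing.ResidueField O)} (hx : x ∈ GammaImm p O E)
    (hy : y ∈ GammaImm p O E) (h : IsReduction x a) (h' : IsReduction y a') :
    IsReduction (seriesMul x y) (a * a') := by
  classical
  obtain ⟨hxg, hxb⟩ := (mem_gammaImm_iff hB).1 hx
  obtain ⟨hyg, hyb⟩ := (mem_gammaImm_iff hB).1 hy
  choose u hu hua using h
  choose v hv hva using h'
  intro n
  have hxy : IsBd p 0 1 (seriesMul x y) := by simpa using hxb.mul hyb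
  obtain ⟨b, hb⟩ := (hB.norm_le_one_iff (seriesMul x y n)).1 (by
    rw [← size_zero_weight (p := p)]; exact hxy n)
  refine ⟨b, hb, ?_⟩
  set F := Finset.antidiagonal a.isPWO_support a'.isPWO_support n with hF
  have h1 : (a * a').coeff n = IsLocalRing.residue O (∑ ij ∈ F, u ij.1 * v ij.2) := by
    rw [HahnSeries.coeff_mul, map_sum]
    exact Finset.sum_congr rfl fun ij _ => by rw [map_mul, hua, hva]
  rw [h1, residue_eq_iff (E := E) hB, hb, map_sum]
  set f : ℚ → E := fun i => x i * y (n - i) with hf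
  have hsum : Summable f := summable_terms hxg hyg n
  have h2 : ∑ ij ∈ F, algebraMap O E (u ij.1 * v ij.2) = ∑ i ∈ F.image Prod.fst, f i := by
    rw [Finset.sum_image]
    · refine Finset.sum_congr rfl fun ij hij => ?_
      have h3 : ij.2 = n - ij.1 := by
        have := (Finset.mem_antidiagonal.1 hij).2.2
        linarith
      rw [map_mul, hu, hv, hf, h3]
    · intro i hi j hj hij
      have h3 := (Finset.mem_antidiagonal.1 hi).2.2
      have h4 := (Finset.mem_antidiagonal.1 hj).2.2
      exact Prod.ext hij (by linarith)
  have h3 : seriesMul x y n - ∑ i ∈ F.image Prod.fst, f i =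
      ∑' i, (f i - if i ∈ F.image Prod.fst then f i else 0) := by
    rw [hsum.tsum_sub (summable_of_hasFiniteSupport
      ((F.image Prod.fst).finite_toSet.subset fun i hi => by
        by_contra hcon
        simp only [Finset.mem_coe] at hcon
        exact hi (if_neg hcon)))]
    congr 1
    rw [tsum_eq_sum (s := F.image Prod.fst) fun i hi => if_neg hi]
    exact Finset.sum_congr rfl fun i hi => (if_pos hi).symm
  rw [h2, h3]
  refine norm_tsum_lt ?_ one_pos fun i => ?_
  · have h4 := tendsto_terms hxg hyg n
    have h5 : Filter.Tendsto (fun i => if i ∈ F.image Prod.fst then f i else 0) Filter.cofinite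
        (𝓝 0) := by
      refine tendsto_nhds_of_eventually_eq ?_
      filter_upwards [(F.image Prod.fst).finite_toSet.compl_mem_cofinite] with i hi
      exact if_neg hi
    simpa using h4.sub h5
  · by_cases hi : i ∈ F.image Prod.fst
    · simp [hi]
    · simp only [hi, if_false, sub_zero, hf, norm_mul]
      have hx1 : ‖x i‖ ≤ 1 := by rw [← size_zero_weight (p := p)]; exact hxb i
      have hy1 : ‖y (n - i)‖ ≤ 1 := by rw [← size_zero_weight (p := p)]; exact hyb _
      have hor : a.coeff i = 0 ∨ a'.coeff (n - i) = 0 := by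
        by_contra! hcon
        exact hi (Finset.mem_image.2 ⟨(i, n - i), Finset.mem_antidiagonal.2
          ⟨hcon.1, hcon.2, by simp⟩, rfl⟩)
      rcases hor with h | h
      · rw [← hua, ← hB.norm_lt_one_iff_mem (E := E), hu] at h
        exact (mul_le_of_le_one_right (norm_nonneg _) hy1).trans_lt h
      · rw [← hva, ← hB.norm_lt_one_iff_mem (E := E), hv] at h
        exact (mul_le_of_le_one_left (norm_nonneg _) hx1).trans_lt h

lemma isReduction_single (q : ℚ) (o : O) : IsReduction (Pi.single q (algebraMap O E o))
    (HahnSeries.single q (IsLocalRing.residue O o)) := by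
  classical
  intro n
  by_cases h : n = q
  · subst h
    exact ⟨o, by simp, by simp⟩
  · exact ⟨0, by simp [h], by rw [map_zero, HahnSeries.coeff_single_of_ne h]⟩

lemma IsReduction.pow (hB : IsUnitBall p O E) (x : ballRing p E)
    {a : HahnSeries ℚ (IsLocalRing.ResidueField O)} (h : IsReduction x.1.1 a) (n : ℕ) :
    IsReduction (x ^ n).1.1 (a ^ n) := by
  induction n with
  | zero =>
    have := isReduction_single (E := E) (0 : ℚ) (1 : O)
    rw [map_one, map_one] at this
    exact this
  | succ n ih =>
    rw [pow_succ, pow_succ]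
    exact IsReduction.mul hB ((mem_gammaImm_iff_ball hB).2 ⟨_, rfl⟩)
      ((mem_gammaImm_iff_ball hB).2 ⟨_, rfl⟩) ih h

section Algebraic

variable {κ : Type*} [Field κ]

lemma isAlgebraicHahn_iff (a : HahnSeries ℚ κ) :
    IsAlgebraicHahn a ↔ @IsAlgebraic (LaurentSeries κ) (HahnSeries ℚ κ) _ _
      (laurentToHahn κ).toAlgebra a := Iff.rfl

lemma IsAlgebraicHahn.mul {a b : HahnSeries ℚ κ} (ha : IsAlgebraicHahn a)
    (hb : IsAlgebraicHahn b) : IsAlgebraicHahn (a * b) := by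
  let _ := (laurentToHahn κ).toAlgebra
  rw [isAlgebraicHahn_iff] at *
  exact IsAlgebraic.mul ha hb

lemma IsAlgebraicHahn.of_pow {a : HahnSeries ℚ κ} {n : ℕ} (hn : 0 < n)
    (h : IsAlgebraicHahn (a ^ n)) : IsAlgebraicHahn a := by
  let _ := (laurentToHahn κ).toAlgebra
  rw [isAlgebraicHahn_iff] at *
  exact IsAlgebraic.of_pow hn h

/-- Raising to the denominator of q turns the monomial into one with integral exponent, which lies
in κ((t)). -/
lemma isAlgebraicHahn_single (q : ℚ) (c : κ) : IsAlgebraicHahn (HahnSeries.single q c) := by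
  let _ := (laurentToHahn κ).toAlgebra
  refine IsAlgebraicHahn.of_pow q.den_pos ?_
  have h1 : (HahnSeries.single q c) ^ q.den =
      laurentToHahn κ (HahnSeries.single q.num (c ^ q.den)) := by
    rw [HahnSeries.single_pow]
    have : q.den • q = ((q.num : ℤ) : ℚ) := by rw [nsmul_eq_mul, Rat.den_mul_eq_num]
    rw [this]
    exact (HahnSeries.embDomain_single (f := ⟨⟨Int.cast, Int.cast_injective⟩, Int.cast_le⟩)).symm
  rw [h1, isAlgebraicHahn_iff]
  exact isAlgebraic_algebraMap _

end Algebraic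

end Reduction

end UnitBall

/-! ### Ideals of series with bounded coefficients. -/

section Ball

variable {p : ℕ} [hpr : Fact p.Prime] {E : Type*} [NormedField E] [IsUltrametricDist E]
  [CompleteSpace E]

/-- The ideal of the series with coefficients of norm at most `c`. -/
def ballIdeal (p : ℕ) [Fact p.Prime] (E : Type*) [NormedField E] [IsUltrametricDist E]
    [CompleteSpace E] {c : ℝ} (hc : 0 ≤ c) : Ideal (ballRing p E) where
  carrier := {x | IsBd p 0 c x.1.1}
  add_mem' hx hy := IsBd.add hx hy
  zero_mem' := (isBd_zero 0).mono hc
  smul_mem' x y hy := by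
    have := IsBd.mul x.2 hy
    rwa [one_mul] at this

lemma mem_ballIdeal {c : ℝ} (hc : 0 ≤ c) {x : ballRing p E} :
    x ∈ ballIdeal p E hc ↔ IsBd p 0 c x.1.1 := Iff.rfl

lemma ballIdeal_pow_le {c : ℝ} (hc : 0 ≤ c) (m : ℕ) :
    (ballIdeal p E hc) ^ m ≤ ballIdeal p E (pow_nonneg hc m) := by
  induction m with
  | zero =>
    intro x _
    rw [mem_ballIdeal, pow_zero]
    exact x.2
  | succ m ih =>
    rw [pow_succ, Ideal.mul_le]
    intro x hx y hy
    rw [mem_ballIdeal, pow_succ]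
    exact IsBd.mul (ih hx) hy

lemma coe_pow_ball (x : ballRing p E) (n : ℕ) : (x ^ n).1.1 = seriesPow x.1.1 n :=
  coe_pow_gauss x.1 n

lemma coe_natCast_mul_ball (n : ℕ) (x : ballRing p E) :
    ((n : ballRing p E) * x).1.1 = (n : E) • x.1.1 := by
  rw [← nsmul_eq_mul, Nat.cast_smul_eq_nsmul]
  rfl

lemma natCast_mul_mem_ballIdeal (n : ℕ) (x : ballRing p E) :
    (n : ballRing p E) * x ∈ ballIdeal p E (norm_nonneg (n : E)) := by
  rw [mem_ballIdeal, coe_natCast_mul_ball]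
  have := IsBd.smul x.2 (n : E)
  rwa [mul_one] at this

lemma natCast_mem_ballIdeal (n : ℕ) :
    (n : ballRing p E) ∈ ballIdeal p E (norm_nonneg (n : E)) := by
  simpa using natCast_mul_mem_ballIdeal n (1 : ballRing p E)

lemma single_seriesMul_single (a b : ℚ) (c d : E) :
    seriesMul (Pi.single a c) (Pi.single b d) = Pi.single (a + b) (c * d) := by
  classical
  funext n
  rw [single_seriesMul]
  by_cases h : n = a + b
  · subst h; simp
  · have : n - a ≠ b := fun h' => h (by linarith)
    simp [h, this]

lemma seriesPow_single (q : ℚ) (c : E) (n : ℕ) :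
    seriesPow (Pi.single q c) n = Pi.single (n * q) (c ^ n) := by
  induction n with
  | zero => simp [seriesPow, partialProd, seriesOne, tPow]
  | succ n ih =>
    have : seriesPow (Pi.single q c : ℚ → E) (n + 1) =
      seriesMul (seriesPow (Pi.single q c) n) (Pi.single q c) := rfl
    rw [this, ih, single_seriesMul_single, pow_succ]
    congr 1
    push_cast
    ring

end Ball

/-! ### Teichmüller lifts, their span, and saturation of Γ^alg. -/

section Teichmuller

variable {p : ℕ} [hpr : Fact p.Prime] {O : Type*} [CommRing O] [IsDomain O]
  [IsDiscreteValuationRing O] {E : Type*} [NormedField E] [IsUltrametricDist E] [CompleteSpace E]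
  [Algebra O E] [IsFractionRing O E]

lemma mem_algTeichmuller_iff (hB : IsUnitBall p O E) {u : ℚ → E} :
    u ∈ algTeichmuller p O E ↔ ∃ U : ballRing p E, U.1.1 = u ∧ (∀ m : ℕ, ∃ V, V ^ p ^ m = U) ∧
      ∃ a : HahnSeries ℚ (IsLocalRing.ResidueField O), IsReduction u a ∧ IsAlgebraicHahn a := by
  constructor
  · rintro ⟨h1, h2, h3⟩
    obtain ⟨U, rfl⟩ := (mem_gammaImm_iff_ball hB).1 h1
    refine ⟨U, rfl, fun m => ?_, h3⟩
    obtain ⟨v, hv, hvu⟩ := h2 m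
    obtain ⟨V, rfl⟩ := (mem_gammaImm_iff_ball hB).1 hv
    exact ⟨V, Subtype.ext (Subtype.ext (by rw [coe_pow_ball, hvu]))⟩
  · rintro ⟨U, rfl, h2, h3⟩
    refine ⟨(mem_gammaImm_iff_ball hB).2 ⟨U, rfl⟩, fun m => ?_, h3⟩
    obtain ⟨V, rfl⟩ := h2 m
    exact ⟨V.1.1, (mem_gammaImm_iff_ball hB).2 ⟨V, rfl⟩, (coe_pow_ball V _).symm⟩

lemma mul_mem_algTeichmuller (hB : IsUnitBall p O E) {u v : ℚ → E}
    (hu : u ∈ algTeichmuller p O E) (hv : v ∈ algTeichmuller p O E) :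
    seriesMul u v ∈ algTeichmuller p O E := by
  have hu1 := hu.1
  have hv1 := hv.1
  rw [mem_algTeichmuller_iff hB] at hu hv ⊢
  obtain ⟨U, rfl, hU, a, ha, haa⟩ := hu
  obtain ⟨V, rfl, hV, b, hb, hbb⟩ := hv
  refine ⟨U * V, rfl, fun m => ?_, a * b, ha.mul hB hu1 hv1 hb, haa.mul hbb⟩
  obtain ⟨X, rfl⟩ := hU m
  obtain ⟨Y, rfl⟩ := hV m
  exact ⟨X * Y, mul_pow _ _ _⟩

lemma single_mem_algTeichmuller (hB : IsUnitBall p O E) (q : ℚ) {o : O}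
    (ho : ∀ m : ℕ, ∃ v, v ^ p ^ m = o) :
    Pi.single q (algebraMap O E o) ∈ algTeichmuller p O E := by
  classical
  have hmem : ∀ (q : ℚ) (o : O), Pi.single q (algebraMap O E o) ∈ GammaImm p O E := fun q o => by
    refine (mem_gammaImm_iff hB).2 ⟨single_mem_gaussSet 0 q _, fun n => ?_⟩
    rw [size_zero_weight]
    by_cases h : n = q
    · subst h; simpa using hB.norm_algebraMap_le o
    · simp [h]
  refine ⟨hmem q o, fun m => ?_, _, isReduction_single q o, isAlgebraicHahn_single q _⟩
  obtain ⟨v, rfl⟩ := ho m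
  refine ⟨_, hmem (q / (p ^ m : ℕ)) v, ?_⟩
  rw [seriesPow_single, map_pow]
  congr 1
  have : ((p ^ m : ℕ) : ℚ) ≠ 0 := by exact_mod_cast (pow_pos hpr.out.pos m).ne'
  field_simp

lemma tPow_mem_algTeichmuller (hB : IsUnitBall p O E) (q : ℚ) :
    tPow q ∈ algTeichmuller p O E := by
  have := single_mem_algTeichmuller hB q (o := (1 : O)) fun m => ⟨1, one_pow _⟩
  rwa [map_one] at this

lemma norm_p_le_irreducible (hB : IsUnitBall p O E) {ϖ : O} (hϖ : Irreducible ϖ) :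
    ‖(p : E)‖ ≤ ‖algebraMap O E ϖ‖ := hB.norm_le_irreducible hϖ hB.norm_p_lt_one

/-- The elements with `p`-power roots have roots of the same kind. -/
lemma exists_compatible_roots (hB : IsUnitBall p O E) {U : ballRing p E}
    (hU : ∀ m : ℕ, ∃ V, V ^ p ^ m = U) :
    ∃ v : ℕ → ballRing p E, v 0 = U ∧ ∀ N M, v (N + M) ^ p ^ M = v N := by
  obtain ⟨ϖ, hϖ⟩ := IsDiscreteValuationRing.exists_irreducible O
  set θ := ‖algebraMap O E ϖ‖ with hθ
  have hθ0 : 0 ≤ θ := norm_nonneg _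
  have hθ1 : θ < 1 := hB.norm_irreducible_lt hϖ
  have hpθ : ‖(p : E)‖ ≤ θ := norm_p_le_irreducible hB hϖ
  choose ω hω using hU
  set I := ballIdeal p E hθ0 with hI
  have hpI : (p : ballRing p E) ∈ I := IsBd.mono (natCast_mem_ballIdeal p) hpθ
  -- Both ω_(k+1)^p and ω_k have p^k-th power U, so modulo p a p^k-th power of their difference
  -- vanishes; `IsBd.of_pow` then makes the difference divisible by ϖ.
  have hstep : ∀ k, ω (k + 1) ^ p - ω k ∈ I := by
    intro k
    obtain ⟨r, hr⟩ := exists_add_pow_prime_pow_eq hpr.out (ω (k + 1) ^ p - ω k) (ω k) k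
    rw [sub_add_cancel, ← pow_mul, ← pow_succ', hω, hω] at hr
    have h1 : (ω (k + 1) ^ p - ω k) ^ p ^ k =
        (p : ballRing p E) * (-((ω (k + 1) ^ p - ω k) * ω k * r)) := by
      linear_combination -hr
    have h2 : (ω (k + 1) ^ p - ω k) ^ p ^ k ∈ I := by rw [h1]; exact I.mul_mem_right _ hpI
    refine IsBd.of_pow hB hϖ (ω (k + 1) ^ p - ω k).2 (m := p ^ k) fun n => ?_
    have := h2 n
    rw [size_zero_weight] at this
    exact this.trans_lt hθ1
  -- Teichmüller's limit construction: arbitrary roots are only compatible modulo ϖ, but p-th powers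
  -- sharpen congruences, so ω_(N+m)^(p^m) converges in m to compatible roots.
  set S : ℕ → ℕ → ballRing p E := fun N m => ω (N + m) ^ p ^ m with hS
  have hSstep : ∀ N m, IsBd p 0 (θ * θ ^ m) ((S N (m + 1)).1.1 - (S N m).1.1) := by
    intro N m
    have h1 : ω (N + m + 1) ^ p ≡ ω (N + m) [SMOD I] := SModEq.sub_mem.2 (hstep (N + m))
    have h2 := SModEq.sub_mem.1 (SModEq.pow_pow_add_one hpI h1 m)
    have h3 := ballIdeal_pow_le hθ0 (m + 1) h2
    rw [← pow_mul, ← pow_succ'] at h3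
    rw [← pow_succ']
    exact h3
  choose x hx using fun N => exists_limit hθ0 hθ1 (fun m => (S N m).1.1) (hSstep N)
  have hlim0 : Filter.Tendsto (fun k => θ * θ ^ k) Filter.atTop (𝓝 0) := by
    simpa using (tendsto_pow_atTop_nhds_zero_of_lt_one hθ0 hθ1).const_mul θ
  have hsmall : ∀ ε : ℝ, 0 < ε → ∃ k, θ * θ ^ k ≤ ε := fun ε hε =>
    ((hlim0.eventually (gt_mem_nhds hε)).exists).imp fun k hk => hk.le
  have hxg : ∀ N, x N ∈ gaussSet p E 0 := fun N => mem_gaussSet_of_approx fun ε hε => by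
    obtain ⟨k, hk⟩ := hsmall ε hε
    exact ⟨_, (S N k).1.2, (hx N k).mono hk⟩
  have hxb : ∀ N, IsBd p 0 1 (x N) := fun N => by
    have h1 : IsBd p 0 1 (x N - (S N 0).1.1) := (hx N 0).mono (by simpa using hθ1.le)
    have := h1.add (S N 0).2
    rwa [sub_add_cancel] at this
  set v : ℕ → ballRing p E := fun N => ⟨⟨x N, hxg N⟩, hxb N⟩ with hv
  have hc : ∀ k, 0 ≤ θ * θ ^ k := fun k => by positivity
  have hvS : ∀ N k, v N - S N k ∈ ballIdeal p E (hc k) := fun N k => hx N k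
  have heq : ∀ a b : ballRing p E, (∀ k, a - b ∈ ballIdeal p E (hc k)) → a = b := fun a b h => by
    rw [← sub_eq_zero]
    refine Subtype.ext (Subtype.ext (eq_zero_of_forall_isBd (p := p) (r := 0) fun ε hε => ?_))
    obtain ⟨k, hk⟩ := hsmall ε hε
    exact IsBd.mono (h k) hk
  refine ⟨v, heq _ _ fun k => ?_, fun N M => heq _ _ fun k => ?_⟩
  · have : S 0 k = U := by simp [hS, hω]
    rw [← this]
    exact hvS 0 k
  · have h1 : v (N + M) ^ p ^ M - S (N + M) k ^ p ^ M ∈ ballIdeal p E (hc k) :=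
      Ideal.mem_of_dvd _ (sub_dvd_pow_sub_pow _ _ _) (hvS _ _)
    have h2 : v N - S N (M + k) ∈ ballIdeal p E (hc k) :=
      IsBd.mono (hvS N (M + k)) (mul_le_mul_of_nonneg_left
        (pow_le_pow_of_le_one hθ0 hθ1.le (Nat.le_add_left k M)) hθ0)
    have h3 : S (N + M) k ^ p ^ M = S N (M + k) := by
      simp only [hS]
      rw [← pow_mul, ← pow_add, add_assoc, add_comm k M]
    rw [h3] at h1
    have := sub_mem h1 h2
    rwa [sub_sub_sub_cancel_right] at this

/-- Taken from a compatible system, the root has all p-power roots itself, and its reduction is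
algebraic because a power of it is. -/
lemma exists_root_algTeichmuller (hB : IsUnitBall p O E) {u : ℚ → E}
    (hu : u ∈ algTeichmuller p O E) (N : ℕ) :
    ∃ V : ballRing p E, V.1.1 ∈ algTeichmuller p O E ∧ (V ^ p ^ N).1.1 = u := by
  obtain ⟨U, rfl, hU, a, ha, haa⟩ := (mem_algTeichmuller_iff hB).1 hu
  obtain ⟨v, hv0, hv⟩ := exists_compatible_roots hB hU
  have hvN : v N ^ p ^ N = U := by
    have := hv 0 N
    rwa [zero_add, hv0] at this
  refine ⟨v N, (mem_algTeichmuller_iff hB).2 ⟨v N, rfl, fun M => ⟨_, hv N M⟩, ?_⟩, by rw [hvN]⟩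
  obtain ⟨b, hb⟩ := exists_reduction hB ((mem_gammaImm_iff_ball hB).2 ⟨v N, rfl⟩)
  refine ⟨b, hb, IsAlgebraicHahn.of_pow (n := p ^ N) (pow_pos hpr.out.pos N) ?_⟩
  have h1 := IsReduction.pow hB (v N) hb (p ^ N)
  rw [hvN] at h1
  rwa [h1.unique (E := E) ha]

/-- The `𝒪`-span of the Teichmüller lifts. -/
def teichSpan (p : ℕ) (O : Type*) [CommRing O] [IsLocalRing O] (E : Type*) [NormedField E]
    [Algebra O E] : Submodule O (ℚ → E) := Submodule.span O (algTeichmuller p O E)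

lemma isBd_smul_of_le (hB : IsUnitBall p O E) (o : O) {c : ℝ} {x : ℚ → E} (hx : IsBd p 0 c x) :
    IsBd p 0 c (o • x) := by
  rw [algebra_smul_eq]
  exact (hx.smul _).mono (mul_le_of_le_one_left hx.nonneg (hB.norm_algebraMap_le o))

lemma smul_mem_gammaImm (hB : IsUnitBall p O E) (o : O) {x : ℚ → E} (hx : x ∈ GammaImm p O E) :
    o • x ∈ GammaImm p O E := by
  rw [mem_gammaImm_iff hB] at hx ⊢
  refine ⟨?_, isBd_smul_of_le hB o hx.2⟩
  rw [algebra_smul_eq]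
  exact smul_mem_gaussSet hx.1 _

lemma add_mem_gammaImm (hB : IsUnitBall p O E) {x y : ℚ → E} (hx : x ∈ GammaImm p O E)
    (hy : y ∈ GammaImm p O E) : x + y ∈ GammaImm p O E := by
  rw [mem_gammaImm_iff hB] at hx hy ⊢
  exact ⟨add_mem_gaussSet hx.1 hy.1, hx.2.add hy.2⟩

lemma zero_mem_gammaImm (hB : IsUnitBall p O E) : (0 : ℚ → E) ∈ GammaImm p O E :=
  (mem_gammaImm_iff_ball hB).2 ⟨0, rfl⟩

lemma teichSpan_le (hB : IsUnitBall p O E) {x : ℚ → E} (hx : x ∈ teichSpan p O E) :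
    x ∈ GammaImm p O E := by
  induction hx using Submodule.span_induction with
  | mem x h => exact h.1
  | zero => exact zero_mem_gammaImm hB
  | add x y _ _ hx hy => exact add_mem_gammaImm hB hx hy
  | smul o x _ hx => exact smul_mem_gammaImm hB o hx

lemma mul_mem_teichSpan (hB : IsUnitBall p O E) {x y : ℚ → E} (hx : x ∈ teichSpan p O E)
    (hy : y ∈ teichSpan p O E) : seriesMul x y ∈ teichSpan p O E := by
  have hg : ∀ x ∈ teichSpan p O E, x ∈ gaussSet p E 0 := fun x hx =>
    ((mem_gammaImm_iff hB).1 (teichSpan_le hB hx)).1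
  have hzero : ∀ x : ℚ → E, seriesMul x 0 = 0 := fun x => by funext n; simp [seriesMul]
  have h1 : ∀ u ∈ algTeichmuller p O E, seriesMul u y ∈ teichSpan p O E := by
    intro u hu
    induction hy using Submodule.span_induction with
    | mem y h => exact Submodule.subset_span (mul_mem_algTeichmuller hB hu h)
    | zero => rw [hzero]; exact zero_mem _
    | add y z hy hz ihy ihz =>
      rw [seriesMul_add (hg u (Submodule.subset_span hu)) (hg y hy) (hg z hz)]
      exact add_mem ihy ihz
    | smul o y _ ih =>
      rw [algebra_smul_eq, seriesMul_smul, ← algebra_smul_eq]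
      exact Submodule.smul_mem _ o ih
  induction hx using Submodule.span_induction with
  | mem u h => exact h1 u h
  | zero => rw [seriesMul_comm, hzero]; exact zero_mem _
  | add x z hx hz ihx ihz =>
    rw [seriesMul_comm, seriesMul_add (hg y hy) (hg x hx) (hg z hz), seriesMul_comm y x,
      seriesMul_comm y z]
    exact add_mem ihx ihz
  | smul o x _ ih =>
    rw [algebra_smul_eq, smul_seriesMul, ← algebra_smul_eq]
    exact Submodule.smul_mem _ o ih

/-- The `𝒪`-span of the Teichmüller lifts, as a subring. -/
def teichRing (hB : IsUnitBall p O E) : Subring (ballRing p E) where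
  carrier := {x | x.1.1 ∈ teichSpan p O E}
  mul_mem' hx hy := mul_mem_teichSpan hB hx hy
  one_mem' := Submodule.subset_span (tPow_mem_algTeichmuller hB 0)
  add_mem' {x y} hx hy := (teichSpan p O E).add_mem (x := x.1.1) (y := y.1.1) hx hy
  zero_mem' := zero_mem (teichSpan p O E)
  neg_mem' {x} hx := by
    have h : x.1.1 ∈ teichSpan p O E := hx
    exact neg_mem h

/-- Each Teichmüller lift is a p^N-th power of another, and raising to the p^N-th power is additive
modulo p. -/
lemma exists_eq_pow_add (hB : IsUnitBall p O E) (N : ℕ) {x : ℚ → E}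
    (hx : x ∈ AddSubmonoid.closure (algTeichmuller p O E)) :
    ∃ V s : teichRing hB, x = (V.1 ^ p ^ N).1.1 + (p : E) • s.1.1.1 := by
  induction hx using AddSubmonoid.closure_induction with
  | mem u hu =>
    obtain ⟨V, hV, hVu⟩ := exists_root_algTeichmuller hB hu N
    have hV' : V.1.1 ∈ teichSpan p O E := Submodule.subset_span hV
    refine ⟨⟨V, hV'⟩, 0, ?_⟩
    rw [hVu]
    exact (by simp : u = u + (p : E) • (0 : ℚ → E))
  | zero =>
    refine ⟨0, 0, ?_⟩
    have h1 : ((0 : teichRing hB).1 ^ p ^ N) = 0 :=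
      zero_pow (pow_pos hpr.out.pos N).ne'
    rw [h1]
    exact (by simp : (0 : ℚ → E) = 0 + (p : E) • (0 : ℚ → E))
  | add x y _ _ ihx ihy =>
    obtain ⟨V, s, hx⟩ := ihx
    obtain ⟨W, t, hy⟩ := ihy
    obtain ⟨r, hr⟩ := exists_add_pow_prime_pow_eq hpr.out V W N
    refine ⟨V + W, s + t - V * W * r, ?_⟩
    have h1 : (V + W) ^ p ^ N + (p : teichRing hB) * (s + t - V * W * r) =
        (V ^ p ^ N + (p : teichRing hB) * s) + (W ^ p ^ N + (p : teichRing hB) * t) := by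
      rw [hr]; ring
    have h2 : ∀ A B : teichRing hB, (A ^ p ^ N + (p : teichRing hB) * B).1.1.1 =
        (A.1 ^ p ^ N).1.1 + (p : E) • B.1.1.1 := fun A B => by
      rw [← coe_natCast_mul_ball]
      rfl
    rw [hx, hy, ← h2, ← h2, ← h2, h1]
    rfl

/-- Every residue class of `O` contains an element with `p ^ m`-th roots for all `m`. -/
def HasTeichmuller (p : ℕ) (O : Type*) [CommRing O] [IsLocalRing O] : Prop :=
  ∀ o : O, ∃ t : O, IsLocalRing.residue O t = IsLocalRing.residue O o ∧
    ∀ m : ℕ, ∃ v : O, v ^ p ^ m = t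

lemma smul_eq_seriesMul_single (o : O) (x : ℚ → E) :
    o • x = seriesMul (Pi.single 0 (algebraMap O E o)) x := by
  funext n
  rw [single_seriesMul, sub_zero, algebra_smul_eq]
  rfl

lemma smul_mem_closure (hB : IsUnitBall p O E) {t : O} (ht : ∀ m : ℕ, ∃ v : O, v ^ p ^ m = t)
    {x : ℚ → E} (hx : x ∈ AddSubmonoid.closure (algTeichmuller p O E)) :
    t • x ∈ AddSubmonoid.closure (algTeichmuller p O E) := by
  induction hx using AddSubmonoid.closure_induction with
  | mem u hu =>
    rw [smul_eq_seriesMul_single]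
    exact AddSubmonoid.subset_closure
      (mul_mem_algTeichmuller hB (single_mem_algTeichmuller hB 0 ht) hu)
  | zero => rw [smul_zero]; exact zero_mem _
  | add x y _ _ hx hy => rw [smul_add]; exact add_mem hx hy

lemma closure_le_teichSpan {x : ℚ → E}
    (hx : x ∈ AddSubmonoid.closure (algTeichmuller p O E)) : x ∈ teichSpan p O E :=
  (AddSubmonoid.closure_le (S := (teichSpan p O E).toAddSubmonoid)).2 Submodule.subset_span hx

/-- Modulo ϖ each coefficient in 𝒪 may be replaced by one with all p-power roots, and such a
constant times a Teichmüller lift is again a lift. So the span is generated by plain sums modulo ϖ.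
-/
lemma exists_eq_closure_add (hB : IsUnitBall p O E) (hT : HasTeichmuller p O) {ϖ : O}
    (hϖ : Irreducible ϖ) {x : ℚ → E} (hx : x ∈ teichSpan p O E) :
    ∃ m ∈ AddSubmonoid.closure (algTeichmuller p O E), ∃ s ∈ teichSpan p O E,
      x = m + ϖ • s := by
  induction hx using Submodule.span_induction with
  | mem u hu => exact ⟨u, AddSubmonoid.subset_closure hu, 0, zero_mem _, by simp⟩
  | zero => exact ⟨0, zero_mem _, 0, zero_mem _, by simp⟩
  | add x y _ _ ihx ihy =>
    obtain ⟨m, hm, s, hs, rfl⟩ := ihx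
    obtain ⟨m', hm', s', hs', rfl⟩ := ihy
    exact ⟨m + m', add_mem hm hm', s + s', add_mem hs hs', by rw [smul_add]; abel⟩
  | smul o x _ ih =>
    obtain ⟨m, hm, s, hs, rfl⟩ := ih
    obtain ⟨t, hto, ht⟩ := hT o
    obtain ⟨c, hc⟩ : ϖ ∣ o - t := by
      rw [← Ideal.mem_span_singleton,
        ← (IsDiscreteValuationRing.irreducible_iff_uniformizer ϖ).1 hϖ,
        ← IsLocalRing.residue_eq_zero_iff, map_sub, hto, sub_self]
    refine ⟨t • m, smul_mem_closure hB ht hm, c • m + o • s,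
      add_mem (Submodule.smul_mem _ _ (closure_le_teichSpan hm)) (Submodule.smul_mem _ _ hs), ?_⟩
    have ho : o = t + ϖ * c := by rw [← hc]; ring
    rw [smul_add, smul_add, smul_comm o ϖ s, ← add_assoc, smul_smul ϖ c, ← add_smul, ← ho]

/-- Modulo ϖ times the span, x is a power V^(p^N). Its reduction vanishes, so V is divisible by ϖ in
the unit ball, and V^(p^N) is of size at most |ϖ|^(p^N). This approximate division stays inside the
span. -/
lemma exists_approx_smul (hB : IsUnitBall p O E) (hT : HasTeichmuller p O) {ϖ : O}
    (hϖ : Irreducible ϖ) {x : ℚ → E} (hx : x ∈ teichSpan p O E) (hx1 : ∀ n, ‖x n‖ < 1)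
    (N : ℕ) : ∃ s ∈ teichSpan p O E, IsBd p 0 (‖algebraMap O E ϖ‖ ^ N) (x - ϖ • s) := by
  obtain ⟨m, hm, s, hs, rfl⟩ := exists_eq_closure_add hB hT hϖ hx
  obtain ⟨V, t, rfl⟩ := exists_eq_pow_add hB N hm
  obtain ⟨c, hc⟩ : ϖ ∣ (p : O) := by
    rw [← Ideal.mem_span_singleton,
      ← (IsDiscreteValuationRing.irreducible_iff_uniformizer ϖ).1 hϖ,
      ← IsLocalRing.residue_eq_zero_iff, ← hB.norm_lt_one_iff_mem (E := E), map_natCast]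
    exact hB.norm_p_lt_one
  have hts : t.1.1.1 ∈ teichSpan p O E := t.2
  have hp : (p : E) • t.1.1.1 = ϖ • c • t.1.1.1 := by
    rw [smul_smul, ← hc, algebra_smul_eq (p : O), map_natCast]
  have heq : (V.1 ^ p ^ N).1.1 + (p : E) • t.1.1.1 + ϖ • s - ϖ • (c • t.1.1.1 + s) =
      (V.1 ^ p ^ N).1.1 := by
    rw [hp, smul_add]; abel
  refine ⟨c • t.1.1.1 + s, add_mem (Submodule.smul_mem _ _ hts) hs, ?_⟩
  rw [heq]
  have hr : c • t.1.1.1 + s ∈ teichSpan p O E := add_mem (Submodule.smul_mem _ _ hts) hs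
  have hb := ((mem_gammaImm_iff hB).1 (teichSpan_le hB hr)).2
  have hV : ∀ n, ‖(V.1 ^ p ^ N).1.1 n‖ < 1 := fun n => by
    rw [← heq]
    rw [Pi.sub_apply, sub_eq_add_neg]
    refine (IsUltrametricDist.norm_add_le_max _ _).trans_lt (max_lt (hx1 n) ?_)
    rw [norm_neg]
    have := hb.smul (algebraMap O E ϖ) n
    rw [← algebra_smul_eq, size_zero_weight, mul_one] at this
    exact this.trans_lt (hB.norm_irreducible_lt hϖ)
  have hVb : V.1 ∈ ballIdeal p E (norm_nonneg (algebraMap O E ϖ)) :=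
    IsBd.of_pow hB hϖ V.1.2 hV
  exact IsBd.mono (ballIdeal_pow_le _ _ (Ideal.pow_mem_pow hVb (p ^ N)))
    (pow_le_pow_of_le_one (norm_nonneg _) (hB.norm_irreducible_lt hϖ).le
      (Nat.lt_pow_self hpr.out.one_lt).le)

lemma mem_gammaAlg_iff {x : ℚ → E} :
    x ∈ GammaAlg p O E ↔ x ∈ GammaImm p O E ∧
      ∀ ε : ℝ, 0 < ε → ∃ z ∈ teichSpan p O E, IsBd p 0 ε (x - z) := by
  refine and_congr_right fun _ => ⟨fun h ε hε => ?_, fun h m => ?_⟩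
  · obtain ⟨m, hm⟩ := exists_pow_lt_of_lt_one hε (inv_lt_one_of_one_lt₀ (one_lt_p (p := p)))
    obtain ⟨z, hz, hb⟩ := h m
    refine ⟨z, hz, fun n => ?_⟩
    rw [size_zero_weight]
    refine (hb n).trans ?_
    rw [← inv_pow]
    exact hm.le
  · obtain ⟨z, hz, hb⟩ := h _ (inv_pos.2 (pow_pos (p_pos (p := p)) m))
    refine ⟨z, hz, fun n => ?_⟩
    have := hb n
    rwa [size_zero_weight] at this

/-- An approximation z of ϖx in the span has vanishing reduction once it is close enough, so z is
approximately ϖs with s in the span. Dividing by ϖ shows that s approximates x. -/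
lemma mem_gammaAlg_of_irreducible_smul (hB : IsUnitBall p O E) (hT : HasTeichmuller p O) {ϖ : O}
    (hϖ : Irreducible ϖ) {x : ℚ → E} (hx : x ∈ GammaImm p O E)
    (h : ϖ • x ∈ GammaAlg p O E) : x ∈ GammaAlg p O E := by
  rw [mem_gammaAlg_iff] at h ⊢
  refine ⟨hx, fun ε hε => ?_⟩
  have hx1 := ((mem_gammaImm_iff hB).1 hx).2
  set θ := ‖algebraMap O E ϖ‖ with hθ
  have hθ0 : 0 < θ := hB.norm_irreducible_pos hϖ
  have hθ1 : θ < 1 := hB.norm_irreducible_lt hϖ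
  obtain ⟨z, hz, hzb⟩ := h.2 (min θ (θ * ε)) (by positivity)
  have hz1 : ∀ n, ‖z n‖ < 1 := fun n => by
    have h1 : IsBd p 0 θ z := by
      have h2 := (hx1.smul (algebraMap O E ϖ)).sub (hzb.mono ((min_le_left _ _).trans
        (le_of_eq (mul_one θ).symm)))
      rw [← algebra_smul_eq, sub_sub_cancel, mul_one] at h2
      exact h2
    have := h1 n
    rw [size_zero_weight] at this
    exact this.trans_lt hθ1
  obtain ⟨N, hN⟩ := exists_pow_lt_of_lt_one (show 0 < θ * ε by positivity) hθ1
  obtain ⟨s, hs, hsb⟩ := exists_approx_smul hB hT hϖ hz hz1 N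
  refine ⟨s, hs, ?_⟩
  have h1 : IsBd p 0 (θ * ε) (ϖ • (x - s)) := by
    have := (hzb.mono (min_le_right _ _)).add (hsb.mono hN.le)
    rwa [sub_add_sub_cancel, ← smul_sub] at this
  intro n
  have := h1 n
  rw [size_zero_weight, algebra_smul_eq, Pi.smul_apply, smul_eq_mul, norm_mul] at this
  rw [size_zero_weight]
  exact le_of_mul_le_mul_left this hθ0

lemma smul_mem_gammaAlg (hB : IsUnitBall p O E) (o : O) {x : ℚ → E} (h : x ∈ GammaAlg p O E) :
    o • x ∈ GammaAlg p O E := by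
  rw [mem_gammaAlg_iff] at h ⊢
  refine ⟨smul_mem_gammaImm hB o h.1, fun ε hε => ?_⟩
  obtain ⟨z, hz, hb⟩ := h.2 ε hε
  exact ⟨o • z, Submodule.smul_mem _ o hz, by rw [← smul_sub]; exact isBd_smul_of_le hB o hb⟩

lemma add_mem_gammaAlg (hB : IsUnitBall p O E) {x y : ℚ → E} (hx : x ∈ GammaAlg p O E)
    (hy : y ∈ GammaAlg p O E) : x + y ∈ GammaAlg p O E := by
  rw [mem_gammaAlg_iff] at hx hy ⊢
  refine ⟨add_mem_gammaImm hB hx.1 hy.1, fun ε hε => ?_⟩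
  obtain ⟨z, hz, hzb⟩ := hx.2 ε hε
  obtain ⟨z', hz', hzb'⟩ := hy.2 ε hε
  exact ⟨z + z', add_mem hz hz', by rw [add_sub_add_comm]; exact hzb.add hzb'⟩

lemma mul_mem_gammaAlg (hB : IsUnitBall p O E) {x y : ℚ → E} (hx : x ∈ GammaAlg p O E)
    (hy : y ∈ GammaAlg p O E) : seriesMul x y ∈ GammaAlg p O E := by
  rw [mem_gammaAlg_iff] at hx hy ⊢
  obtain ⟨X, rfl⟩ := (mem_gammaImm_iff_ball hB).1 hx.1
  obtain ⟨Y, rfl⟩ := (mem_gammaImm_iff_ball hB).1 hy.1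
  refine ⟨(mem_gammaImm_iff_ball hB).2 ⟨X * Y, rfl⟩, fun ε hε => ?_⟩
  obtain ⟨z, hz, hzb⟩ := hx.2 ε hε
  obtain ⟨z', hz', hzb'⟩ := hy.2 ε hε
  obtain ⟨Z, rfl⟩ := (mem_gammaImm_iff_ball hB).1 (teichSpan_le hB hz)
  obtain ⟨Z', rfl⟩ := (mem_gammaImm_iff_ball hB).1 (teichSpan_le hB hz')
  refine ⟨_, mul_mem_teichSpan hB hz hz', ?_⟩
  have h1 : X - Z ∈ ballIdeal p E hε.le := hzb
  have h2 : Y - Z' ∈ ballIdeal p E hε.le := hzb'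
  have h3 : X * Y - Z * Z' ∈ ballIdeal p E hε.le := by
    have : X * Y - Z * Z' = Y * (X - Z) + Z * (Y - Z') := by ring
    rw [this]
    exact add_mem (Ideal.mul_mem_left _ _ h1) (Ideal.mul_mem_left _ _ h2)
  exact h3

lemma mem_gammaAlg_of_smul (hB : IsUnitBall p O E) (hT : HasTeichmuller p O) {o : O} (ho : o ≠ 0)
    {x : ℚ → E} (hx : x ∈ GammaImm p O E) (h : o • x ∈ GammaAlg p O E) :
    x ∈ GammaAlg p O E := by
  obtain ⟨ϖ, hϖ⟩ := IsDiscreteValuationRing.exists_irreducible O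
  obtain ⟨m, u, rfl⟩ := IsDiscreteValuationRing.eq_unit_mul_pow_irreducible ho hϖ
  have h1 : ϖ ^ m • x ∈ GammaAlg p O E := by
    have := smul_mem_gammaAlg hB (↑u⁻¹ : O) h
    rwa [smul_smul, ← mul_assoc, Units.inv_mul, one_mul] at this
  clear h ho
  induction m generalizing x with
  | zero => simpa using h1
  | succ m ih =>
    refine mem_gammaAlg_of_irreducible_smul hB hT hϖ hx (ih (smul_mem_gammaImm hB ϖ hx) ?_)
    rwa [smul_smul, ← pow_succ]

end Teichmuller

/-! ### Approximating truncated products. -/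

section Mask

variable {p : ℕ} [hpr : Fact p.Prime] {E : Type*} [NormedField E] [IsUltrametricDist E]
  [CompleteSpace E]

open Classical in
/-- The terms of the product `x y`, except those with exponents above an element of `F`. -/
def maskedTerm (F : Finset (ℚ × ℚ)) (x y : ℚ → E) (n i : ℚ) : E :=
  if ∃ f ∈ F, f.1 ≤ i ∧ f.2 ≤ n - i then 0 else x i * y (n - i)

/-- The sum of the products of the terms of `x` and `y`, except those with exponents above an
element of `F`. -/
def maskedMul (F : Finset (ℚ × ℚ)) (x y : ℚ → E) : ℚ → E := fun n => ∑' i, maskedTerm F x y n i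

lemma summable_maskedTerm {r : ℝ} {x y : ℚ → E} (hx : x ∈ gaussSet p E r)
    (hy : y ∈ gaussSet p E r) (F : Finset (ℚ × ℚ)) (n : ℚ) :
    Summable fun i => maskedTerm F x y n i := by
  refine NonarchimedeanAddGroup.summable_of_tendsto_cofinite_zero ?_
  refine squeeze_zero_norm (fun i => ?_)
    (tendsto_zero_iff_norm_tendsto_zero.1 (tendsto_terms hx hy n))
  unfold maskedTerm
  split_ifs
  · rw [norm_zero]; exact norm_nonneg _
  · rfl

lemma maskedMul_empty (x y : ℚ → E) : maskedMul ∅ x y = seriesMul x y := by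
  funext n
  simp [maskedMul, maskedTerm, seriesMul]

/-- One step of inclusion and exclusion: the terms newly removed by the corner at f are those of the
F-masked product of the tails of x and y from f on. -/
lemma maskedMul_insert {r : ℝ} {x y : ℚ → E} (hx : x ∈ gaussSet p E r)
    (hy : y ∈ gaussSet p E r) (F : Finset (ℚ × ℚ)) (f : ℚ × ℚ) [DecidableEq (ℚ × ℚ)] :
    maskedMul (insert f F) x y =
      maskedMul F x y - maskedMul F (x - trunc f.1 x) (y - trunc f.2 y) := by
  funext n
  have hx' := sub_mem_gaussSet hx (trunc_mem_gaussSet hx f.1)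
  have hy' := sub_mem_gaussSet hy (trunc_mem_gaussSet hy f.2)
  rw [Pi.sub_apply, maskedMul, maskedMul, maskedMul, ← (summable_maskedTerm hx hy F n).tsum_sub (summable_maskedTerm hx' hy' F n)]
  refine tsum_congr fun i => ?_
  unfold maskedTerm
  by_cases h : ∃ f ∈ F, f.1 ≤ i ∧ f.2 ≤ n - i
  · have h' : ∃ g ∈ insert f F, g.1 ≤ i ∧ g.2 ≤ n - i := by
      obtain ⟨g, hg, h1⟩ := h
      exact ⟨g, Finset.mem_insert_of_mem hg, h1⟩
    rw [if_pos h, if_pos h', if_pos h, sub_zero]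
  · rw [if_neg h, if_neg h]
    by_cases h1 : f.1 ≤ i ∧ f.2 ≤ n - i
    · rw [if_pos ⟨f, Finset.mem_insert_self _ _, h1⟩]
      simp [trunc, h1.1.not_gt, h1.2.not_gt]
    · rw [if_neg]
      · have : (x - trunc f.1 x) i * (y - trunc f.2 y) (n - i) = 0 := by
          rcases not_and_or.1 h1 with h2 | h2
          · simp [trunc, not_le.1 h2]
          · simp [trunc, not_le.1 h2]
        rw [this, sub_zero]
      · rintro ⟨g, hg, hg1⟩
        rcases Finset.mem_insert.1 hg with rfl | hg
        · exact h1 hg1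
        · exact h ⟨g, hg, hg1⟩

/-- Below exponent j the weights are at least that of j, so w_r controls the plain supremum norm of
a truncation. This passes from radius r to radius 0, where Γ^alg lives. -/
lemma size_zero_trunc_le {r : ℝ} (hr : 0 < r) (j : ℚ) (x : ℚ → E) (n : ℚ) :
    size p 0 (trunc j x) n ≤ (weight p r j)⁻¹ * size p r x n := by
  have hw := weight_pos (p := p) r j
  by_cases h : n < j
  · rw [size_zero_weight, trunc, if_pos h, le_inv_mul_iff₀ hw, mul_comm]
    refine mul_le_mul_of_nonneg_left (weight_le_weight ?_) (norm_nonneg _)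
    exact mul_le_mul_of_nonneg_left (by exact_mod_cast h.le) hr.le
  · rw [size_zero_weight, trunc, if_neg h, norm_zero]
    exact mul_nonneg (inv_nonneg.2 hw.le) (size_nonneg r x n)

lemma trunc_mem_gaussSet_zero {r : ℝ} (hr : 0 < r) {x : ℚ → E} (hx : x ∈ gaussSet p E r) (j : ℚ) :
    trunc j x ∈ gaussSet p E 0 :=
  mem_gaussSet_of_size_le (inv_pos.2 (weight_pos r j)) hx (size_zero_trunc_le hr j x)

lemma isBd_zero_trunc {r c : ℝ} (hr : 0 < r) {x : ℚ → E} (h : IsBd p r c x) (j : ℚ) :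
    IsBd p 0 ((weight p r j)⁻¹ * c) (trunc j x) := fun n =>
  (size_zero_trunc_le hr j x n).trans
    (mul_le_mul_of_nonneg_left (h n) (inv_nonneg.2 (weight_pos r j).le))

lemma trunc_trunc (i j : ℚ) (x : ℚ → E) : trunc i (trunc j x) = trunc (min i j) x := by
  funext n
  by_cases h1 : n < i <;> by_cases h2 : n < j <;> simp [trunc, h1, h2]

lemma trunc_tPow (i j : ℚ) : trunc i (tPow j : ℚ → E) = if j < i then tPow j else 0 := by
  classical
  funext n
  by_cases hn : n = j
  · subst hn; by_cases h : n < i <;> simp [trunc, h]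
  · by_cases h : n < i <;> by_cases h' : j < i <;> simp [trunc, tPow, h, h', hn]

lemma _root_.Set.IsWF.exists_lower_bound {X : Set ℚ} (hX : X.IsWF) : ∃ a, ∀ n ∈ X, a ≤ n := by
  rcases X.eq_empty_or_nonempty with rfl | h
  · exact ⟨0, by simp⟩
  · exact ⟨hX.min h, fun n hn => hX.min_le h hn⟩

lemma exists_isWF_of_lt_mul {r : ℝ} {x y : ℚ → E} (hx : x ∈ gaussSet p E r)
    (hy : y ∈ gaussSet p E r) {δ : ℝ} (hδ : 0 < δ) : ∃ X Y : Set ℚ, X.IsWF ∧ Y.IsWF ∧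
      ∀ i k, δ < size p r x i * size p r y k → i ∈ X ∧ k ∈ Y := by
  obtain ⟨⟨c, hc⟩, hxw⟩ := hx
  obtain ⟨⟨d, hd⟩, hyw⟩ := hy
  have hc0 := hc.nonneg
  have hd0 := hd.nonneg
  refine ⟨_, _, hxw (δ / (d + 1)) (by positivity), hyw (δ / (c + 1)) (by positivity),
    fun i k h => ⟨?_, ?_⟩⟩
  · rw [Set.mem_ofPred_eq, div_lt_iff₀ (by positivity)]
    exact h.trans_le (mul_le_mul_of_nonneg_left ((hd k).trans (by linarith)) (size_nonneg _ _ _))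
  · rw [Set.mem_ofPred_eq, div_lt_iff₀ (by positivity), mul_comm]
    exact h.trans_le (mul_le_mul_of_nonneg_right ((hc i).trans (by linarith)) (size_nonneg _ _ _))

/-- The pairs in a product of well-ordered sets with sum at least `j` are those above finitely many
of them. -/
lemma exists_finset_minimal {X Y : Set ℚ} (hX : X.IsWF) (hY : Y.IsWF) (j : ℚ) :
    ∃ F : Finset (ℚ × ℚ), (∀ f ∈ F, j ≤ f.1 + f.2) ∧
      ∀ a ∈ X, ∀ b ∈ Y, j ≤ a + b → ∃ f ∈ F, f.1 ≤ a ∧ f.2 ≤ b := by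
  have hZ : ({z : ℚ × ℚ | z ∈ X ×ˢ Y ∧ j ≤ z.1 + z.2}).IsPWO :=
    (hX.isPWO.prod hY.isPWO).mono fun z hz => hz.1
  set Z := {z : ℚ × ℚ | z ∈ X ×ˢ Y ∧ j ≤ z.1 + z.2}
  -- Minimal elements form an antichain, and an antichain in a partially well-ordered set is finite.
  have hfin : {z | Minimal (· ∈ Z) z}.Finite :=
    (setOfPred_minimal_antichain _).finite_of_partiallyWellOrderedOn (hZ.mono fun z hz => hz.1)
  refine ⟨hfin.toFinset, fun f hf => ?_, fun a ha b hb hab => ?_⟩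
  · exact ((Set.Finite.mem_toFinset _).1 hf).1.2
  · obtain ⟨f, hf, hfm⟩ := hZ.exists_le_minimal (a := (a, b)) ⟨⟨ha, hb⟩, hab⟩
    exact ⟨f, (Set.Finite.mem_toFinset _).2 hfm, hf⟩

/-- A truncated product is approximated by masked products of truncations. -/
lemma exists_approx_trunc_mul {r : ℝ} (hr : 0 < r) {x y : ℚ → E} (hx : x ∈ gaussSet p E r)
    (hy : y ∈ gaussSet p E r) (j : ℚ) {ε : ℝ} (hε : 0 < ε) :
    ∃ (a b : ℚ) (F : Finset (ℚ × ℚ)),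
      IsBd p 0 ε (trunc j (seriesMul x y) - maskedMul F (trunc a x) (trunc b y)) := by
  have hwj := weight_pos (p := p) r j
  obtain ⟨X, Y, hX, hY, hXY⟩ := exists_isWF_of_lt_mul hx hy (mul_pos hε hwj)
  obtain ⟨x₀, hx₀⟩ := hX.exists_lower_bound
  obtain ⟨y₀, hy₀⟩ := hY.exists_lower_bound
  -- A large pair has exponents at least x₀ and y₀; if their sum is below j, they are below j - y₀
  -- and j - x₀ respectively, so truncating there loses only negligible terms.
  set x' := trunc (j - y₀) x with hx'
  set y' := trunc (j - x₀) y with hy'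
  have hxg : x' ∈ gaussSet p E 0 := trunc_mem_gaussSet_zero hr hx _
  have hyg : y' ∈ gaussSet p E 0 := trunc_mem_gaussSet_zero hr hy _
  obtain ⟨X', Y', hX', hY', hXY'⟩ := exists_isWF_of_lt_mul hxg hyg hε
  -- The corners in F contain every large pair of total exponent at least j and no pair of smaller
  -- total exponent.
  obtain ⟨F, hF, hFmin⟩ := exists_finset_minimal hX' hY' j
  refine ⟨j - y₀, j - x₀, F, fun n => ?_⟩
  rw [size_zero_weight, Pi.sub_apply]
  have hM := summable_maskedTerm hxg hyg F n
  by_cases hn : n < j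
  · rw [trunc, if_pos hn, seriesMul, maskedMul, ← (summable_terms hx hy n).tsum_sub hM]
    refine IsUltrametricDist.norm_tsum_le_of_forall_le_of_nonneg hε.le fun i => ?_
    have hmask : ¬ ∃ f ∈ F, f.1 ≤ i ∧ f.2 ≤ n - i := by
      rintro ⟨f, hf, h1, h2⟩
      have := hF f hf
      linarith
    rw [maskedTerm, if_neg hmask]
    have hwn : weight p r j ≤ weight p r n :=
      weight_le_weight (mul_le_mul_of_nonneg_left (by exact_mod_cast hn.le) hr.le)
    by_cases hbig : ε * weight p r j < size p r x i * size p r y (n - i)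
    · obtain ⟨h1, h2⟩ := hXY _ _ hbig
      have h3 : i < j - y₀ := by have := hy₀ _ h2; linarith
      have h4 : n - i < j - x₀ := by have := hx₀ _ h1; linarith
      rw [hx', hy', trunc, trunc, if_pos h3, if_pos h4, sub_self, norm_zero]
      exact hε.le
    · have hle : ‖x i * y (n - i)‖ ≤ ε := by
        rw [not_lt, ← size_mul] at hbig
        refine le_of_mul_le_mul_right (le_trans ?_ hbig) hwj
        exact mul_le_mul_of_nonneg_left hwn (norm_nonneg _)
      have hcase : x' i * y' (n - i) = 0 ∨ x' i * y' (n - i) = x i * y (n - i) := by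
        rw [hx', hy', trunc, trunc]
        split_ifs <;> simp
      rcases hcase with h | h
      · rwa [h, sub_zero]
      · rw [h, sub_self, norm_zero]; exact hε.le
  · rw [trunc, if_neg hn, zero_sub, norm_neg, maskedMul]
    refine IsUltrametricDist.norm_tsum_le_of_forall_le_of_nonneg hε.le fun i => ?_
    unfold maskedTerm
    split_ifs with hmask
    · rw [norm_zero]; exact hε.le
    · by_contra! hbig
      rw [norm_mul, ← size_zero_weight (p := p) x', ← size_zero_weight (p := p) y'] at hbig
      obtain ⟨h1, h2⟩ := hXY' _ _ hbig
      exact hmask (hFmin _ h1 _ h2 (by linarith))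

end Mask

/-! ### Γ^alg[1/p] and stability of the family defining Ω^alg_an. -/

section Alg

variable {p : ℕ} [hpr : Fact p.Prime] {O : Type*} [CommRing O] [IsDomain O]
  [IsDiscreteValuationRing O] {E : Type*} [NormedField E] [IsUltrametricDist E] [CompleteSpace E]
  [Algebra O E] [IsFractionRing O E]

/-- The ring `Γ^alg[1/p]`. -/
def gammaAlgLoc (p : ℕ) (O : Type*) [CommRing O] [IsLocalRing O] (E : Type*) [NormedField E]
    [Algebra O E] : Set (ℚ → E) := {x | ∃ m : ℕ, (p : E) ^ m • x ∈ GammaAlg p O E}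

lemma p_pow_smul_mem_gammaAlg (hB : IsUnitBall p O E) (m : ℕ) {x : ℚ → E}
    (h : x ∈ GammaAlg p O E) : (p : E) ^ m • x ∈ GammaAlg p O E := by
  have := smul_mem_gammaAlg hB ((p : O) ^ m) h
  rwa [algebra_smul_eq, map_pow, map_natCast] at this

lemma mem_gammaAlg_of_p_pow_smul (hB : IsUnitBall p O E) (hT : HasTeichmuller p O) (m : ℕ)
    {x : ℚ → E} (hx : x ∈ GammaImm p O E) (h : (p : E) ^ m • x ∈ GammaAlg p O E) :
    x ∈ GammaAlg p O E := by
  refine mem_gammaAlg_of_smul hB hT (o := (p : O) ^ m) (fun h0 => ?_) hx ?_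
  · have := congrArg (algebraMap O E) h0
    rw [map_pow, map_natCast, map_zero] at this
    exact pow_ne_zero m hB.p_ne_zero this
  · rwa [algebra_smul_eq, map_pow, map_natCast]

lemma add_mem_gammaAlgLoc (hB : IsUnitBall p O E) {x y : ℚ → E} (hx : x ∈ gammaAlgLoc p O E)
    (hy : y ∈ gammaAlgLoc p O E) : x + y ∈ gammaAlgLoc p O E := by
  obtain ⟨m, hm⟩ := hx
  obtain ⟨n, hn⟩ := hy
  refine ⟨m + n, ?_⟩
  have h1 := p_pow_smul_mem_gammaAlg hB n hm
  have h2 := p_pow_smul_mem_gammaAlg hB m hn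
  rw [smul_smul, ← pow_add] at h1 h2
  rw [smul_add]
  rw [add_comm n m] at h1
  exact add_mem_gammaAlg hB h1 h2

lemma exists_p_pow_mul_norm_le (hB : IsUnitBall p O E) (c : ℝ) : ∃ m : ℕ, ‖(p : E) ^ m‖ * c ≤ 1 := by
  have h : Filter.Tendsto (fun m : ℕ => ‖(p : E)‖ ^ m * c) Filter.atTop (𝓝 0) := by
    simpa using (tendsto_pow_atTop_nhds_zero_of_lt_one (norm_nonneg _)
      hB.norm_p_lt_one).mul_const c
  obtain ⟨m, hm⟩ := (h.eventually (gt_mem_nhds one_pos)).exists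
  exact ⟨m, by rw [norm_pow]; exact hm.le⟩

lemma smul_mem_gammaAlgLoc (hB : IsUnitBall p O E) (a : E) {x : ℚ → E}
    (hx : x ∈ gammaAlgLoc p O E) : a • x ∈ gammaAlgLoc p O E := by
  obtain ⟨m, hm⟩ := hx
  obtain ⟨n, hn⟩ := exists_p_pow_mul_norm_le hB ‖a‖
  rw [← norm_mul] at hn
  obtain ⟨o, ho⟩ := (hB.norm_le_one_iff _).1 hn
  refine ⟨n + m, ?_⟩
  have := smul_mem_gammaAlg hB o hm
  rwa [algebra_smul_eq, ho, smul_smul, mul_right_comm, ← pow_add, ← smul_smul] at this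

lemma zero_mem_gammaAlgLoc (hB : IsUnitBall p O E) : (0 : ℚ → E) ∈ gammaAlgLoc p O E :=
  ⟨0, by
    rw [smul_zero, mem_gammaAlg_iff]
    exact ⟨zero_mem_gammaImm hB, fun ε hε => ⟨0, zero_mem _, by
      rw [sub_zero]; exact (isBd_zero 0).mono hε.le⟩⟩⟩

lemma sub_mem_gammaAlgLoc (hB : IsUnitBall p O E) {x y : ℚ → E} (hx : x ∈ gammaAlgLoc p O E)
    (hy : y ∈ gammaAlgLoc p O E) : x - y ∈ gammaAlgLoc p O E := by
  have := add_mem_gammaAlgLoc hB hx (smul_mem_gammaAlgLoc hB (-1) hy)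
  rwa [neg_one_smul, ← sub_eq_add_neg] at this

lemma mul_mem_gammaAlgLoc (hB : IsUnitBall p O E) {x y : ℚ → E} (hx : x ∈ gammaAlgLoc p O E)
    (hy : y ∈ gammaAlgLoc p O E) : seriesMul x y ∈ gammaAlgLoc p O E := by
  obtain ⟨m, hm⟩ := hx
  obtain ⟨n, hn⟩ := hy
  refine ⟨m + n, ?_⟩
  have := mul_mem_gammaAlg hB hm hn
  rwa [smul_seriesMul, seriesMul_smul, smul_smul, ← pow_add] at this

lemma gammaAlgLoc_subset (hB : IsUnitBall p O E) : gammaAlgLoc p O E ⊆ gaussSet p E 0 := by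
  rintro x ⟨m, hm⟩
  have := smul_mem_gaussSet ((mem_gammaImm_iff hB).1 hm.1).1 ((p : E) ^ m)⁻¹
  rwa [inv_smul_smul₀ (pow_ne_zero m hB.p_ne_zero)] at this

/-- One power of p brings x and its close approximants into Γ^imm. By saturation those approximants
then lie in Γ^alg itself, so their denominators do not grow along the limit. -/
lemma closedAt_gammaAlgLoc (hB : IsUnitBall p O E) (hT : HasTeichmuller p O) :
    ClosedAt p 0 (gammaAlgLoc p O E) := by
  intro x hx h
  obtain ⟨c, hc⟩ := hx.1
  obtain ⟨m, hm⟩ := exists_p_pow_mul_norm_le hB c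
  have hmx : IsBd p 0 1 ((p : E) ^ m • x) := (hc.smul _).mono hm
  refine ⟨m, mem_gammaAlg_iff.2 ⟨(mem_gammaImm_iff hB).2 ⟨smul_mem_gaussSet hx _, hmx⟩,
    fun ε hε => ?_⟩⟩
  obtain ⟨y, hy, hyg, hyb⟩ := h (min ε 1) (by positivity)
  have h1 : IsBd p 0 (min ε 1) ((p : E) ^ m • x - (p : E) ^ m • y) := by
    rw [← smul_sub]
    refine (hyb.smul _).mono (mul_le_of_le_one_left (by positivity) ?_)
    rw [norm_pow]
    exact pow_le_one₀ (norm_nonneg _) hB.norm_p_lt_one.le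
  have h2 : IsBd p 0 1 ((p : E) ^ m • y) := by
    have := hmx.sub (h1.mono (min_le_right _ _))
    rwa [sub_sub_cancel] at this
  obtain ⟨l, hl⟩ := smul_mem_gammaAlgLoc hB ((p : E) ^ m) hy
  have h3 := mem_gammaAlg_of_p_pow_smul hB hT l
    ((mem_gammaImm_iff hB).2 ⟨smul_mem_gaussSet hyg _, h2⟩) hl
  obtain ⟨z, hz, hzb⟩ := (mem_gammaAlg_iff.1 h3).2 ε hε
  refine ⟨z, hz, ?_⟩
  have := (h1.mono (min_le_left _ _)).add hzb
  rwa [sub_add_sub_cancel] at this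

lemma tPow_mem_gammaAlgLoc (hB : IsUnitBall p O E) (q : ℚ) : tPow q ∈ gammaAlgLoc p O E := by
  refine ⟨0, ?_⟩
  rw [pow_zero, one_smul, mem_gammaAlg_iff]
  have h := tPow_mem_algTeichmuller hB q
  exact ⟨h.1, fun ε hε => ⟨_, Submodule.subset_span h, by
    rw [sub_self]; exact (isBd_zero 0).mono hε.le⟩⟩

/-- The series all of whose truncations lie in `Γ^alg[1/p]`. -/
def algSeries (p : ℕ) (O : Type*) [CommRing O] [IsLocalRing O] (E : Type*) [NormedField E]
    [Algebra O E] : Set (ℚ → E) := {x | ∀ j : ℚ, trunc j x ∈ gammaAlgLoc p O E}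

/-- Tails keep both properties, which lets the induction on the mask apply to them. -/
lemma sub_trunc_mem (hB : IsUnitBall p O E) {x : ℚ → E} (hx : x ∈ gammaAlgLoc p O E)
    (hx' : x ∈ algSeries p O E) (a : ℚ) :
    x - trunc a x ∈ gammaAlgLoc p O E ∧ x - trunc a x ∈ algSeries p O E :=
  ⟨sub_mem_gammaAlgLoc hB hx (hx' a), fun j => by
    rw [trunc_sub, trunc_trunc]
    exact sub_mem_gammaAlgLoc hB (hx' _) (hx' _)⟩

lemma maskedMul_mem_gammaAlgLoc (hB : IsUnitBall p O E) (F : Finset (ℚ × ℚ)) {x y : ℚ → E}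
    (hx : x ∈ gammaAlgLoc p O E) (hx' : x ∈ algSeries p O E) (hy : y ∈ gammaAlgLoc p O E)
    (hy' : y ∈ algSeries p O E) : maskedMul F x y ∈ gammaAlgLoc p O E := by
  classical
  induction F using Finset.induction_on generalizing x y with
  | empty => rw [maskedMul_empty]; exact mul_mem_gammaAlgLoc hB hx hy
  | insert f F _ ih =>
    rw [maskedMul_insert (gammaAlgLoc_subset hB hx) (gammaAlgLoc_subset hB hy)]
    have h1 := sub_trunc_mem hB hx hx' f.1
    have h2 := sub_trunc_mem hB hy hy' f.2
    exact sub_mem_gammaAlgLoc hB (ih hx hx' hy hy') (ih h1.1 h1.2 h2.1 h2.2)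

lemma trunc_mem_algSeries {x : ℚ → E} (hx : x ∈ algSeries p O E) (j : ℚ) :
    trunc j x ∈ algSeries p O E := fun i => by rw [trunc_trunc]; exact hx _

lemma tPow_mem_algSeries (hB : IsUnitBall p O E) (q : ℚ) : tPow q ∈ algSeries p O E := fun j => by
  rw [trunc_tPow]
  split_ifs
  · exact tPow_mem_gammaAlgLoc hB q
  · exact zero_mem_gammaAlgLoc hB

lemma trunc_smul (j : ℚ) (a : E) (x : ℚ → E) : trunc j (a • x) = a • trunc j x := by
  funext n; by_cases h : n < j <;> simp [trunc, h]

/-- Products and limits at radius r are checked on truncations at radius 0, by closedness of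
Γ^alg[1/p]. -/
lemma isStable_algSeries (hB : IsUnitBall p O E) (hT : HasTeichmuller p O) :
    IsStable p (algSeries p O E) where
  one_mem := tPow_mem_algSeries hB 0
  add_mem x hx y hy j := by rw [trunc_add]; exact add_mem_gammaAlgLoc hB (hx j) (hy j)
  smul_mem a x hx j := by rw [trunc_smul]; exact smul_mem_gammaAlgLoc hB a (hx j)
  tPow_mem _ _ j _ := ⟨tPow_mem_algSeries hB j, tPow_mem_algSeries hB (-j)⟩
  trunc_mem _ hx j := trunc_mem_algSeries hx j
  mul_mem r hr x hx y hy hxg hyg j := by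
    refine closedAt_gammaAlgLoc hB hT _ (trunc_mem_gaussSet_zero hr (mul_mem_gaussSet hxg hyg) j)
      fun ε hε => ?_
    obtain ⟨a, b, F, hF⟩ := exists_approx_trunc_mul hr hxg hyg j hε
    have hmem := maskedMul_mem_gammaAlgLoc hB F (hx a) (trunc_mem_algSeries hx a) (hy b)
      (trunc_mem_algSeries hy b)
    exact ⟨_, hmem, gammaAlgLoc_subset hB hmem, hF⟩
  closed r hr x hx h j := by
    refine closedAt_gammaAlgLoc hB hT _ (trunc_mem_gaussSet_zero hr hx j) fun ε hε => ?_
    obtain ⟨y, hy, -, hb⟩ := h (weight p r j * ε) (mul_pos (weight_pos r j) hε)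
    refine ⟨_, hy j, gammaAlgLoc_subset hB (hy j), ?_⟩
    have := isBd_zero_trunc hr hb j
    rwa [trunc_sub, inv_mul_cancel_left₀ (weight_pos r j).ne'] at this

lemma omegaAlgAn_eq_omega : OmegaAlgAn p O E = omega p (algSeries p O E) := by
  have h : ∀ (x : ℚ → E) (j : ℚ) (m : ℕ),
      (fun i : ℚ => if i < j then (p : E) ^ m * x i else 0) = (p : E) ^ m • trunc j x := by
    intro x j m
    funext n
    by_cases hn : n < j <;> simp [trunc, hn]
  ext x
  simp only [OmegaAlgAn, h, omegaImmAn_eq, omega, algSeries, gammaAlgLoc, Set.mem_ofPred_eq,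
    and_assoc]

end Alg

end SlopeFact

end

theorem mainTheorem4 (p : ℕ) [Fact p.Prime]
    (k : Type*) [Field k] [IsAlgClosed k] [CharP k p]
    (O : Type*) [CommRing O] [IsDomain O] [IsDiscreteValuationRing O]
    [Algebra (WittVector p k) O] [Module.Finite (WittVector p k) O]
    [FaithfulSMul (WittVector p k) O]
    (E : Type*) [NormedField E] [IsUltrametricDist E] [Algebra O E] [IsFractionRing O E]
    (hO : ∀ a : E, ‖a‖ ≤ 1 ↔ a ∈ Set.range (algebraMap O E))
    (hp : ‖(p : E)‖ = (p : ℝ)⁻¹) :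
    (∀ x ∈ SlopeFact.OmegaAn p E, x ≠ 0 →
      SlopeFact.HasSlopeFactorization p (SlopeFact.OmegaAn p E) x) ∧
    (∀ x ∈ SlopeFact.OmegaAlgAn p O E, (∃ j : ℚ, IsLeast (Function.support x) j) →
      SlopeFact.HasSlopeFactorization p (SlopeFact.OmegaAlgAn p O E) x) ∧
    (∀ x ∈ SlopeFact.OmegaImmAn p E, (∃ j : ℚ, IsLeast (Function.support x) j) →
      SlopeFact.HasSlopeFactorization p (SlopeFact.OmegaImmAn p E) x) := by
  have hB : SlopeFact.IsUnitBall p O E := ⟨hO, hp⟩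
  have : CompleteSpace E := SlopeFact.completeSpace_of_finite (k := k) hB
  obtain ⟨q, hq⟩ := hB.discreteNorm
  have hT : SlopeFact.HasTeichmuller p O := SlopeFact.exists_teichmuller_residue (k := k) hB
  refine ⟨fun x hx hx0 => ?_, fun x hx ⟨j, hj⟩ => ?_, fun x hx ⟨j, hj⟩ => ?_⟩
  · obtain ⟨j, hj⟩ := SlopeFact.exists_isLeast_support_omegaAn hx hx0
    rw [SlopeFact.omegaAn_eq_omega] at hx ⊢
    exact SlopeFact.hasSlopeFactorization_omega hq SlopeFact.isStable_integralSeries hx hj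
  · rw [SlopeFact.omegaAlgAn_eq_omega] at hx ⊢
    exact SlopeFact.hasSlopeFactorization_omega hq (SlopeFact.isStable_algSeries hB hT) hx hj
  · rw [SlopeFact.omegaImmAn_eq_omega] at hx ⊢
    exact SlopeFact.hasSlopeFactorization_omega hq SlopeFact.isStable_univ hx hj
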